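/- **Conventions.** For a complex vector space $\mathcal M$ put $\mathcal M_{nc}=\coprod_{n\ge 1}\mathcal M^{n\times n}$, and $\Omega_n=\Omega\cap\mathcal M^{n\times n}$ for $\Omega\subseteq\mathcal M_{nc}$. An *nc set* is a subset of $\mathcal M_{nc}$ closed under direct sums $X\oplus Y=\left[\begin{smallmatrix}X&0\\0&Y\end{smallmatrix}\right]$. A subset is *invariant under similarity* if it contains $SXS^{-1}$ whenever it contains $X$ (of size $n$) and $S\in\mathrm{GL}(n,\mathbb C)$, and *invariant under direct summands* if it contains $X$ and $Y$ whenever it contains $X\oplus Y$. If $\mathcal M$ is an operator space, a subset $\Omega$ is *uniformly open* if for every $s$ and $Y\in\Omega_s$ it contains some nc ball $B_{nc}(Y,\varrho)=\coprod_m\{X\in\mathcal M^{ms\times ms}:\|X-Y^{\oplus m}\|<\varrho\}$, $\varrho>0$. An *nc function* on an nc set is a graded map into some $\mathcal W_{nc}$ that respects direct sums and similarities. It is *uniformly locally bounded* if every point $Y$ of its domain $D$ has an nc ball $B_{nc}(Y,\varrho)$ such that it is bounded on $D\cap B_{nc}(Y,\varrho)$; on a uniformly open domain it is *uniformly analytic*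 if it is uniformly locally bounded and Gâteaux differentiable at each level. Let $\mathcal V$ be an operator space, $d\in\mathbb N$, and let $\Omega\subseteq\mathbb C^d_{nc}$ be a uniformly open nc set which is invariant under similarity and direct summands. For an operator space $\mathcal W$ and a uniformly open nc set $\mathcal U\subseteq\Omega$ let $\mathfrak T_{\mathcal U}(\mathcal W)=\coprod_n\mathcal U_n\times\mathcal W^{n\times n}\subseteq(\mathbb C^d\times\mathcal W)_{nc}$, with projection $\pi(Z,A)=Z$. For $E\subseteq\mathfrak T_\Omega(\mathcal V)$ a *trivialization of rank $r$ over $\mathcal U$* is a uniformly analytic nc bijection $\varphi$ from $\mathfrak T_{\mathcal U}(\mathbb C^r)$ onto $E\cap\pi^{-1}(\mathcal U)$ with $\pi\circ\varphi=\pi$ which, on the fibre over each $Z\in\mathcal U_n$, is complex linear and a homomorphism of left $\mathbb C^{n\times n}$-modules. An *nc holomorphic vector bundle of rank $r$* over $\Omega$, embedded in $\mathfrak T_\Omega(\mathcal V)$, is an nc set $E\subseteq\mathfrak T_\Omega(\mathcal V)$ with $\pi(E)=\Omega$ such that $\Omega$ is covered by uniformly open nc subsets of $\Omega$ over which $E$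 has trivializations of rank $r$. Two such bundles $E,F$ are *isomorphic* if there is a bijective nc function $f:E\to F$ with $\pi\circ f=\pi$, complex linear and left $\mathbb C^{n\times n}$-linear on the fibre over each $Z\in\Omega_n$, such that $f$ and $f^{-1}$ are uniformly locally bounded. Let $\{\mathcal U_\alpha\}$ be a cover of $\Omega$ by uniformly open nc subsets. An *nc cocycle* of rank $r$ relative to it is a family of uniformly analytic nc functions $g_{\alpha\beta}:\mathcal U_\alpha\cap\mathcal U_\beta\to\coprod_n\mathrm{GL}(nr,\mathbb C)$ ($r\times r$ block matrices with $n\times n$ blocks, regarded as elements of $(\mathbb C^{r\times r})^{n\times n}$) which, acting on rows $[A_1\cdots A_r]$ of $n\times n$ matrices by right multiplication, satisfy $g_{\alpha\beta}\circ g_{\beta\gamma}\circ g_{\gamma\alpha}=\mathrm{Id}$, that is, as matrices, $g_{\gamma\alpha}(Z)g_{\beta\gamma}(Z)g_{\alpha\beta}(Z)=\mathrm{Id}$ for $Z\in\mathcal U_\alpha\cap\mathcal U_\beta\cap\mathcal U_\gamma$. It is the cocycle associated with trivializations $\varphi_\alpha$ over $\mathcal U_\alpha$ if $\varphi_\alpha^{-1}\varphi_\beta(Z,[A_1\cdots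 A_r])=(Z,[A_1\cdots A_r]\,g_{\alpha\beta}(Z))$ for $Z\in\mathcal U_\alpha\cap\mathcal U_\beta$. If all $\mathcal U_\alpha$ are invariant under similarity and direct summands, two nc cocycles $\{g_{\alpha\beta}\}$, $\{h_{\alpha\beta}\}$ of rank $r$ are *cohomologous* if there are uniformly analytic nc functions $\lambda_\alpha:\mathcal U_\alpha\to\coprod_n\mathrm{GL}(nr,\mathbb C)$ such that, as maps on rows, $g_{\alpha\beta}\circ\lambda_\beta=\lambda_\alpha\circ h_{\alpha\beta}$ on $\mathcal U_\alpha\cap\mathcal U_\beta$ for all $\alpha,\beta$, that is, as matrices, $\lambda_\beta(Z)g_{\alpha\beta}(Z)=h_{\alpha\beta}(Z)\lambda_\alpha(Z)$. **Theorem 5.12.** Let $E$ and $F$ be nc holomorphic vector bundles over $\Omega$, of possibly different ranks, both embedded in $\mathfrak T_\Omega(\mathcal V)$. Then $E$ and $F$ are isomorphic if and only if there are a cover $\{\mathcal U_\alpha\}$ of $\Omega$ by uniformly open nc subsets invariant under similarity and direct summands, and trivializations, of the same rank, $\{\varphi_\alpha\}$ of $E$ and $\{\psi_\alpha\}$ of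 $F$ over the sets $\mathcal U_\alpha$, such that the nc cocycles associated with $\{\varphi_\alpha\}$ and with $\{\psi_\alpha\}$ are cohomologous. -/

import Mathlib

open Filter Topology

universe u

namespace NCBundle

/-! ### Square matrices of positive size, scalar multiplication, direct sums, amplifications -/

/-- `n × n` matrices over `M`, for `n = 1, 2, 3, …`.  The nc space over `M` is the disjoint union
of these sets over all `n`. -/
abbrev Mat (n : ℕ+) (M : Type*) : Type _ := Matrix (Fin n) (Fin n) M

/-- The operator norm `ℂⁿ → ℂᵐ` (Euclidean norms) of a complex matrix. -/
noncomputable def opNorm {m n : Type*} [Fintype m] [Fintype n] [DecidableEq n]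
    (A : Matrix m n ℂ) : ℝ :=
  ‖(Matrix.toEuclideanLin (𝕜 := ℂ) (m := m) (n := n)).trans LinearMap.toContinuousLinearMap A‖

section Algebra

variable {M : Type*} [AddCommGroup M] [Module ℂ M]

/-- The product `S A` of a complex matrix and a matrix over `M`. -/
def lmul {m n p : Type*} [Fintype n] (S : Matrix m n ℂ) (A : Matrix n p M) : Matrix m p M :=
  Matrix.of fun i j => ∑ k, S i k • A k j

/-- The product `A S` of a matrix over `M` and a complex matrix. -/
def rmul {m n p : Type*} [Fintype n] (A : Matrix m n M) (S : Matrix n p ℂ) : Matrix m p M :=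
  Matrix.of fun i j => ∑ k, S k j • A i k

/-- `S A S⁻¹`. -/
noncomputable def conj {n : ℕ+} (S : GL (Fin n) ℂ) (A : Mat n M) : Mat n M :=
  rmul (lmul (S : Matrix (Fin n) (Fin n) ℂ) A) ((S⁻¹ : GL (Fin n) ℂ) : Matrix (Fin n) (Fin n) ℂ)

/-- The first `n` of `n + m` indices, followed by the last `m`. -/
def sumEquiv (n m : ℕ+) : Fin n ⊕ Fin m ≃ Fin (n + m : ℕ+) :=
  (finSumFinEquiv : Fin n ⊕ Fin m ≃ Fin ((n : ℕ) + m))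

/-- The direct sum `A ⊕ B`, i.e. the block diagonal matrix with blocks `A` and `B`. -/
def directSum {n m : ℕ+} (A : Mat n M) (B : Mat m M) : Mat (n + m) M :=
  Matrix.reindex (sumEquiv n m) (sumEquiv n m) (Matrix.fromBlocks A 0 0 B)

theorem directSum_apply {n m : ℕ+} (A : Mat n M) (B : Mat m M) (i j : Fin n ⊕ Fin m) :
    directSum A B (sumEquiv n m i) (sumEquiv n m j) = Matrix.fromBlocks A 0 0 B i j := by
  change Matrix.fromBlocks A 0 0 B ((sumEquiv n m).symm (sumEquiv n m i))
    ((sumEquiv n m).symm (sumEquiv n m j)) = _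
  rw [Equiv.symm_apply_apply, Equiv.symm_apply_apply]

/-- For `k = q n` this is the amplification `X ⊕ ⋯ ⊕ X` (`q` copies) of the `n × n` matrix `X`.
It is only used when `n` divides `k`. -/
def amp {n : ℕ+} (k : ℕ+) (X : Mat n M) : Mat k M :=
  Matrix.of fun i j =>
    if (i : ℕ) / n = (j : ℕ) / n then
      X ⟨(i : ℕ) % n, Nat.mod_lt _ n.pos⟩ ⟨(j : ℕ) % n, Nat.mod_lt _ n.pos⟩
    else 0

end Algebra

/-! ### Operator spaces -/

/-- An operator space: a complex vector space with norms on all the spaces of `n × n` matrices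
over it that satisfy Ruan's axioms (`directSum` is R1 and `lmul_rmul` is R2). -/
class OperatorSpace (V : Type*) [AddCommGroup V] [Module ℂ V] where
  /-- the norm of an `n × n` matrix over `V` -/
  mnorm : ∀ {n : ℕ+}, Mat n V → ℝ
  mnorm_add_le : ∀ {n : ℕ+} (A B : Mat n V), mnorm (A + B) ≤ mnorm A + mnorm B
  mnorm_smul : ∀ {n : ℕ+} (c : ℂ) (A : Mat n V), mnorm (c • A) = ‖c‖ * mnorm A
  eq_zero_of_mnorm : ∀ {n : ℕ+} (A : Mat n V), mnorm A = 0 → A = 0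
  mnorm_directSum : ∀ {n m : ℕ+} (A : Mat n V) (B : Mat m V),
    mnorm (directSum A B) = max (mnorm A) (mnorm B)
  mnorm_lmul_rmul : ∀ {n m : ℕ+} (X : Matrix (Fin m) (Fin n) ℂ) (A : Mat n V)
    (Y : Matrix (Fin n) (Fin m) ℂ),
    mnorm (rmul (lmul X A) Y) ≤ opNorm X * mnorm A * opNorm Y

open OperatorSpace

/-! #### Auxiliary facts on operator norms -/

section OpNorm

variable {m n p : Type*} [Fintype m] [Fintype n] [Fintype p] [DecidableEq n]
  [DecidableEq p]

theorem opNorm_nonneg (A : Matrix m n ℂ) : 0 ≤ opNorm A := norm_nonneg _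

theorem opNorm_bound (A : Matrix m n ℂ) (x : n → ℂ) :
    ∑ i, ‖(A.mulVec x) i‖ ^ 2 ≤ opNorm A ^ 2 * ∑ j, ‖x j‖ ^ 2 := by
  have h := ((Matrix.toEuclideanLin (𝕜 := ℂ) (m := m) (n := n)).trans
    LinearMap.toContinuousLinearMap A).le_opNorm (WithLp.toLp 2 x)
  have h2 := pow_le_pow_left₀ (norm_nonneg _) h 2
  rw [mul_pow, EuclideanSpace.norm_sq_eq, EuclideanSpace.norm_sq_eq] at h2
  exact h2

theorem opNorm_le {A : Matrix m n ℂ} {c : ℝ} (hc : 0 ≤ c)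
    (h : ∀ x : n → ℂ, ∑ i, ‖(A.mulVec x) i‖ ^ 2 ≤ c ^ 2 * ∑ j, ‖x j‖ ^ 2) : opNorm A ≤ c := by
  refine ContinuousLinearMap.opNorm_le_bound _ hc fun x => ?_
  refine (sq_le_sq₀ (norm_nonneg _) (by positivity)).mp ?_
  rw [mul_pow, EuclideanSpace.norm_sq_eq, EuclideanSpace.norm_sq_eq]
  exact h (fun i => x i)

theorem opNorm_add_le (A B : Matrix m n ℂ) : opNorm (A + B) ≤ opNorm A + opNorm B := by
  unfold opNorm
  rw [map_add]
  exact norm_add_le _ _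

theorem opNorm_smul (c : ℂ) (A : Matrix m n ℂ) : opNorm (c • A) = ‖c‖ * opNorm A := by
  unfold opNorm
  rw [map_smul, norm_smul]

theorem opNorm_eq_zero {A : Matrix m n ℂ} (h : opNorm A = 0) : A = 0 := by
  unfold opNorm at h
  rw [norm_eq_zero] at h
  exact (LinearEquiv.map_eq_zero_iff _).mp h

theorem opNorm_mul_le (A : Matrix m n ℂ) (B : Matrix n p ℂ) :
    opNorm (A * B) ≤ opNorm A * opNorm B := by
  refine opNorm_le (mul_nonneg (opNorm_nonneg _) (opNorm_nonneg _)) fun x => ?_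
  rw [← Matrix.mulVec_mulVec, mul_pow, mul_assoc]
  exact (opNorm_bound A _).trans
    (mul_le_mul_of_nonneg_left (opNorm_bound B x) (sq_nonneg _))

theorem opNorm_submatrix_le {m' n' : Type*} [Fintype m'] [Fintype n'] [DecidableEq n']
    (A : Matrix m n ℂ) (e : m' ≃ m) (f : n' ≃ n) :
    opNorm (A.submatrix e f) ≤ opNorm A := by
  refine opNorm_le (opNorm_nonneg _) fun x => ?_
  have h := opNorm_bound A (x ∘ f.symm)
  rw [Matrix.submatrix_mulVec_equiv]
  rw [← Equiv.sum_comp e] at h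
  rw [← Equiv.sum_comp f (fun j => ‖(x ∘ f.symm) j‖ ^ 2)] at h
  simpa using h

theorem opNorm_submatrix {m' n' : Type*} [Fintype m'] [Fintype n']
    [DecidableEq n'] (A : Matrix m n ℂ) (e : m' ≃ m) (f : n' ≃ n) :
    opNorm (A.submatrix e f) = opNorm A := by
  refine le_antisymm (opNorm_submatrix_le A e f) ?_
  have h := opNorm_submatrix_le (A.submatrix e f) e.symm f.symm
  simpa using h

theorem opNorm_fromBlocks [DecidableEq m] (A : Matrix n n ℂ) (B : Matrix m m ℂ) :
    opNorm (Matrix.fromBlocks A 0 0 B) = max (opNorm A) (opNorm B) := by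
  have hA := opNorm_nonneg A
  have hB := opNorm_nonneg B
  refine le_antisymm (opNorm_le (hA.trans (le_max_left _ _)) fun x => ?_) (max_le ?_ ?_)
  · rw [Matrix.fromBlocks_mulVec, Fintype.sum_sum_type, Fintype.sum_sum_type, mul_add]
    simp only [Sum.elim_inl, Sum.elim_inr, Matrix.zero_mulVec, add_zero, zero_add]
    refine add_le_add ((opNorm_bound A _).trans ?_) ((opNorm_bound B _).trans ?_)
    · exact mul_le_mul_of_nonneg_right (pow_le_pow_left₀ hA (le_max_left _ _) 2)
        (Finset.sum_nonneg fun _ _ => sq_nonneg _)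
    · exact mul_le_mul_of_nonneg_right (pow_le_pow_left₀ hB (le_max_right _ _) 2)
        (Finset.sum_nonneg fun _ _ => sq_nonneg _)
  · refine opNorm_le (opNorm_nonneg _) fun x => ?_
    have h := opNorm_bound (Matrix.fromBlocks A 0 0 B) (Sum.elim x 0)
    rw [Matrix.fromBlocks_mulVec, Fintype.sum_sum_type, Fintype.sum_sum_type] at h
    simpa [Matrix.mulVec_zero] using h
  · refine opNorm_le (opNorm_nonneg _) fun x => ?_
    have h := opNorm_bound (Matrix.fromBlocks A 0 0 B) (Sum.elim 0 x)
    rw [Matrix.fromBlocks_mulVec, Fintype.sum_sum_type, Fintype.sum_sum_type] at h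
    simpa [Matrix.mulVec_zero] using h

/-- the matrix `X ⊗ 1` -/
def tensorOne (r : ℕ) (X : Matrix m n ℂ) : Matrix (m × Fin r) (n × Fin r) ℂ :=
  Matrix.of fun a b => if a.2 = b.2 then X a.1 b.1 else 0

theorem opNorm_tensorOne_le (r : ℕ) (X : Matrix m n ℂ) : opNorm (tensorOne r X) ≤ opNorm X := by
  refine opNorm_le (opNorm_nonneg _) fun x => ?_
  have key : ∀ i k, ((tensorOne r X).mulVec x) (i, k) = (X.mulVec fun j => x (j, k)) i := by
    intro i k
    simp [tensorOne, Matrix.mulVec, dotProduct, Fintype.sum_prod_type]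
  rw [Fintype.sum_prod_type_right, Fintype.sum_prod_type_right, Finset.mul_sum]
  refine Finset.sum_le_sum fun k _ => ?_
  simp only [key]
  exact opNorm_bound X fun j => x (j, k)

end OpNorm

/-! #### The standard operator spaces -/

/-- `ℂᵈ` as an operator space: the norm of a `d`-tuple of matrices is the maximum of the operator
norms.  (All operator space structures on `ℂᵈ` are completely isomorphic, so they give the same
uniformly open sets and the same locally bounded functions.) -/
noncomputable instance instPi (d : ℕ) : OperatorSpace (Fin d → ℂ) where
  mnorm A := ‖fun a : Fin d => opNorm (A.map fun v => v a)‖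
  mnorm_add_le A B := by
    refine (pi_norm_le_iff_of_nonneg (by positivity)).2 fun a => ?_
    have h1 := norm_le_pi_norm (fun a : Fin d => opNorm (A.map fun v => v a)) a
    have h2 := norm_le_pi_norm (fun a : Fin d => opNorm (B.map fun v => v a)) a
    rw [Real.norm_of_nonneg (opNorm_nonneg _)] at h1 h2 ⊢
    exact (opNorm_add_le (A.map fun v => v a) (B.map fun v => v a)).trans (add_le_add h1 h2)
  mnorm_smul c A := by
    have : (fun a : Fin d => opNorm ((c • A).map fun v => v a))
        = ‖c‖ • fun a : Fin d => opNorm (A.map fun v => v a) := by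
      funext a
      exact opNorm_smul c (A.map fun v => v a)
    rw [this, norm_smul, norm_norm]
  eq_zero_of_mnorm A h := by
    rw [norm_eq_zero] at h
    ext i j a
    have := opNorm_eq_zero (congrFun h a)
    exact congrFun (congrFun this i) j
  mnorm_directSum {n m} A B := by
    have key : ∀ a : Fin d, opNorm ((directSum A B).map fun v => v a)
        = max (opNorm (A.map fun v => v a)) (opNorm (B.map fun v => v a)) := by
      intro a
      rw [← opNorm_fromBlocks]
      rw [← opNorm_submatrix ((directSum A B).map _) (sumEquiv n m) (sumEquiv n m)]
      congr 1
      ext i j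
      rw [Matrix.submatrix_apply, Matrix.map_apply, directSum_apply]
      rcases i with i | i <;> rcases j with j | j <;> rfl
    simp only [key]
    refine le_antisymm ?_ (max_le ?_ ?_)
    · refine (pi_norm_le_iff_of_nonneg ((norm_nonneg _).trans (le_max_left _ _))).2 fun a => ?_
      have h1 := norm_le_pi_norm (fun a : Fin d => opNorm (A.map fun v => v a)) a
      have h2 := norm_le_pi_norm (fun a : Fin d => opNorm (B.map fun v => v a)) a
      rw [Real.norm_of_nonneg (opNorm_nonneg _)] at h1 h2
      rw [Real.norm_of_nonneg ((opNorm_nonneg _).trans (le_max_left _ _))]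
      exact max_le_max h1 h2
    all_goals
      refine (pi_norm_le_iff_of_nonneg (norm_nonneg _)).2 fun a => ?_
      have h := norm_le_pi_norm (fun a : Fin d =>
        max (opNorm (A.map fun v => v a)) (opNorm (B.map fun v => v a))) a
      rw [Real.norm_of_nonneg ((opNorm_nonneg _).trans (le_max_left _ _))] at h
      rw [Real.norm_of_nonneg (opNorm_nonneg _)]
    · exact (le_max_left _ _).trans h
    · exact (le_max_right _ _).trans h
  mnorm_lmul_rmul X A Y := by
    refine (pi_norm_le_iff_of_nonneg (mul_nonneg (mul_nonneg (opNorm_nonneg _) (norm_nonneg _))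
      (opNorm_nonneg _))).2 fun a => ?_
    have h1 := norm_le_pi_norm (fun a : Fin d => opNorm (A.map fun v => v a)) a
    rw [Real.norm_of_nonneg (opNorm_nonneg _)] at h1 ⊢
    have : (rmul (lmul X A) Y).map (fun v => v a) = X * (A.map fun v => v a) * Y := by
      ext i j
      simp [rmul, lmul, Matrix.mul_apply, Finset.sum_apply, mul_comm]
    rw [this]
    refine (opNorm_mul_le _ _).trans (mul_le_mul_of_nonneg_right ?_ (opNorm_nonneg _))
    exact (opNorm_mul_le _ _).trans (mul_le_mul_of_nonneg_left h1 (opNorm_nonneg _))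

/-- The product of two operator spaces, with the maximum norm. -/
noncomputable instance instProd {V W : Type*} [AddCommGroup V] [Module ℂ V] [OperatorSpace V]
    [AddCommGroup W] [Module ℂ W] [OperatorSpace W] : OperatorSpace (V × W) where
  mnorm A := max (mnorm (A.map Prod.fst)) (mnorm (A.map Prod.snd))
  mnorm_add_le A B := by
    refine max_le ?_ ?_
    · exact (mnorm_add_le (A.map Prod.fst) (B.map Prod.fst)).trans
        (add_le_add (le_max_left _ _) (le_max_left _ _))
    · exact (mnorm_add_le (A.map Prod.snd) (B.map Prod.snd)).trans
        (add_le_add (le_max_right _ _) (le_max_right _ _))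
  mnorm_smul c A := by
    rw [mul_max_of_nonneg _ _ (norm_nonneg c), ← mnorm_smul, ← mnorm_smul]
    rfl
  eq_zero_of_mnorm {n} A h := by
    have nnV : 0 ≤ mnorm (A.map Prod.fst) := by
      have h0 : mnorm (0 : Mat n V) = 0 := by simpa using mnorm_smul (0 : ℂ) (0 : Mat n V)
      have h1 := mnorm_add_le (A.map Prod.fst) ((-1 : ℂ) • A.map Prod.fst)
      rw [mnorm_smul, neg_one_smul, add_neg_cancel, h0] at h1
      simp at h1
      linarith
    have nnW : 0 ≤ mnorm (A.map Prod.snd) := by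
      have h0 : mnorm (0 : Mat n W) = 0 := by simpa using mnorm_smul (0 : ℂ) (0 : Mat n W)
      have h1 := mnorm_add_le (A.map Prod.snd) ((-1 : ℂ) • A.map Prod.snd)
      rw [mnorm_smul, neg_one_smul, add_neg_cancel, h0] at h1
      simp at h1
      linarith
    have h1 := eq_zero_of_mnorm _ (le_antisymm ((le_max_left _ _).trans h.le) nnV)
    have h2 := eq_zero_of_mnorm _ (le_antisymm ((le_max_right _ _).trans h.le) nnW)
    ext i j
    · exact congrFun (congrFun h1 i) j
    · exact congrFun (congrFun h2 i) j
  mnorm_directSum {n m} A B := by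
    have h1 : (directSum A B).map Prod.fst = directSum (A.map Prod.fst) (B.map Prod.fst) := by
      ext i j
      obtain ⟨i, rfl⟩ := (sumEquiv n m).surjective i
      obtain ⟨j, rfl⟩ := (sumEquiv n m).surjective j
      rw [Matrix.map_apply, directSum_apply, directSum_apply]
      rcases i with i | i <;> rcases j with j | j <;> rfl
    have h2 : (directSum A B).map Prod.snd = directSum (A.map Prod.snd) (B.map Prod.snd) := by
      ext i j
      obtain ⟨i, rfl⟩ := (sumEquiv n m).surjective i
      obtain ⟨j, rfl⟩ := (sumEquiv n m).surjective j
      rw [Matrix.map_apply, directSum_apply, directSum_apply]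
      rcases i with i | i <;> rcases j with j | j <;> rfl
    rw [h1, h2, mnorm_directSum, mnorm_directSum, max_max_max_comm]
  mnorm_lmul_rmul X A Y := by
    have h1 : (rmul (lmul X A) Y).map Prod.fst = rmul (lmul X (A.map Prod.fst)) Y := by
      ext i j
      simp [rmul, lmul, Prod.fst_sum]
    have h2 : (rmul (lmul X A) Y).map Prod.snd = rmul (lmul X (A.map Prod.snd)) Y := by
      ext i j
      simp [rmul, lmul, Prod.snd_sum]
    rw [h1, h2]
    refine max_le ((mnorm_lmul_rmul _ _ _).trans ?_) ((mnorm_lmul_rmul _ _ _).trans ?_)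
    · exact mul_le_mul_of_nonneg_right (mul_le_mul_of_nonneg_left (le_max_left _ _)
        (opNorm_nonneg _)) (opNorm_nonneg _)
    · exact mul_le_mul_of_nonneg_right (mul_le_mul_of_nonneg_left (le_max_right _ _)
        (opNorm_nonneg _)) (opNorm_nonneg _)

/-- `r × r` complex matrices as an operator space: an `n × n` matrix over `ℂ^{r × r}` is an
`nr × nr` complex matrix and carries the operator norm. -/
noncomputable instance instMatrix (r : ℕ) : OperatorSpace (Matrix (Fin r) (Fin r) ℂ) where
  mnorm {n} A := opNorm (Matrix.comp (Fin n) (Fin n) (Fin r) (Fin r) ℂ A)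
  mnorm_add_le A B := opNorm_add_le (Matrix.comp _ _ _ _ ℂ A) (Matrix.comp _ _ _ _ ℂ B)
  mnorm_smul c A := opNorm_smul c (Matrix.comp _ _ _ _ ℂ A)
  eq_zero_of_mnorm A h := by
    have := opNorm_eq_zero h
    ext i j k l
    exact congrFun (congrFun this (i, k)) (j, l)
  mnorm_directSum {n m} A B := by
    let e : (Fin n × Fin r) ⊕ (Fin m × Fin r) ≃ Fin (n + m : ℕ+) × Fin r :=
      (Equiv.sumProdDistrib _ _ _).symm.trans ((sumEquiv n m).prodCongr (Equiv.refl (Fin r)))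
    rw [← opNorm_fromBlocks, ← opNorm_submatrix (Matrix.comp _ _ _ _ ℂ (directSum A B)) e e]
    congr 1
    ext i j
    rcases i with ⟨i, k⟩ | ⟨i, k⟩ <;> rcases j with ⟨j, l⟩ | ⟨j, l⟩
    · exact congrFun (congrFun (directSum_apply A B (Sum.inl i) (Sum.inl j)) k) l
    · exact congrFun (congrFun (directSum_apply A B (Sum.inl i) (Sum.inr j)) k) l
    · exact congrFun (congrFun (directSum_apply A B (Sum.inr i) (Sum.inl j)) k) l
    · exact congrFun (congrFun (directSum_apply A B (Sum.inr i) (Sum.inr j)) k) l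
  mnorm_lmul_rmul {n m} X A Y := by
    have : Matrix.comp _ _ _ _ ℂ (rmul (lmul X A) Y)
        = tensorOne r X * Matrix.comp _ _ _ _ ℂ A * tensorOne r Y := by
      ext ⟨i, k⟩ ⟨j, l⟩
      simp [rmul, lmul, tensorOne, Matrix.mul_apply, Matrix.sum_apply, Fintype.sum_prod_type,
        mul_comm]
    rw [this]
    have hA := opNorm_nonneg (Matrix.comp _ _ _ _ ℂ A)
    refine (opNorm_mul_le _ _).trans (mul_le_mul ((opNorm_mul_le _ _).trans
      (mul_le_mul_of_nonneg_right (opNorm_tensorOne_le r X) hA)) (opNorm_tensorOne_le r Y)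
      (opNorm_nonneg _) (mul_nonneg (opNorm_nonneg _) hA))

/-! ### nc sets and the uniformly open topology -/

/-- A subset `Ω` of the nc space over `M`, given by its levels: `Ω n` is the set of the `n × n`
matrices that belong to it. -/
abbrev NCSubset (M : Type*) : Type _ := ∀ n : ℕ+, Set (Mat n M)

/-- The intersection of two subsets of an nc space. -/
def inter {M : Type*} (U U' : NCSubset M) : NCSubset M := fun n => U n ∩ U' n

section Sets

variable {M : Type*} [AddCommGroup M] [Module ℂ M]

/-- nc sets: closed under direct sums. -/
def IsNCSet (Ω : NCSubset M) : Prop :=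
  ∀ (n m : ℕ+) (X : Mat n M) (Y : Mat m M), X ∈ Ω n → Y ∈ Ω m → directSum X Y ∈ Ω (n + m)

/-- Invariance under similarities. -/
def IsSimilarityInvariant (Ω : NCSubset M) : Prop :=
  ∀ (n : ℕ+) (S : GL (Fin n) ℂ) (X : Mat n M), X ∈ Ω n → conj S X ∈ Ω n

/-- Invariance under direct summands. -/
def IsSummandInvariant (Ω : NCSubset M) : Prop :=
  ∀ (n m : ℕ+) (X : Mat n M) (Y : Mat m M), directSum X Y ∈ Ω (n + m) → X ∈ Ω n ∧ Y ∈ Ω m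

variable [OperatorSpace M]

/-- The nc ball with centre `Y` (an `n × n` matrix) and radius `ρ`: all `qn × qn` matrices,
`q = 1, 2, …`, at distance less than `ρ` from the `q`-th amplification of `Y`. -/
def ncBall {n : ℕ+} (Y : Mat n M) (ρ : ℝ) : NCSubset M :=
  fun k => {X | (n : ℕ) ∣ k ∧ mnorm (X - amp k Y) < ρ}

/-- Open sets of the uniformly open topology, of which the nc balls are a basis. -/
def IsUniformlyOpen (Ω : NCSubset M) : Prop :=
  ∀ (n : ℕ+) (Y : Mat n M), Y ∈ Ω n → ∃ ρ > 0, ∀ k, ncBall Y ρ k ⊆ Ω k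

end Sets

/-! ### nc functions -/

/-- A graded map between nc spaces; as a map on a subset it is only looked at on that subset. -/
abbrev GradedMap (M W : Type*) : Type _ := ∀ n : ℕ+, Mat n M → Mat n W

section Functions

variable {M : Type*} [AddCommGroup M] [Module ℂ M] {W : Type*} [AddCommGroup W] [Module ℂ W]

/-- `f` is an nc function on the nc set `D`: it respects direct sums and similarities. -/
structure IsNCFunction (D : NCSubset M) (f : GradedMap M W) : Prop where
  map_directSum : ∀ (n m : ℕ+) (X : Mat n M) (Y : Mat m M), X ∈ D n → Y ∈ D m →
    f (n + m) (directSum X Y) = directSum (f n X) (f m Y)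
  map_conj : ∀ (n : ℕ+) (S : GL (Fin n) ℂ) (X : Mat n M), X ∈ D n → conj S X ∈ D n →
    f n (conj S X) = conj S (f n X)

variable [OperatorSpace M] [OperatorSpace W]

/-- `f` is uniformly locally bounded on `D`, for the relative uniformly open topology of `D`. -/
def IsLocallyBounded (D : NCSubset M) (f : GradedMap M W) : Prop :=
  ∀ (n : ℕ+) (Y : Mat n M), Y ∈ D n → ∃ ρ > 0, ∃ C : ℝ, ∀ (k : ℕ+) (X : Mat k M),
    X ∈ D k → X ∈ ncBall Y ρ k → mnorm (f k X) ≤ C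

/-- `f` is Gâteaux differentiable at each level of the uniformly open set `D`. -/
def IsGDifferentiable (D : NCSubset M) (f : GradedMap M W) : Prop :=
  ∀ (n : ℕ+) (X : Mat n M), X ∈ D n → ∀ Z : Mat n M, ∃ L : Mat n W,
    Tendsto (fun t : ℂ => mnorm (t⁻¹ • (f n (X + t • Z) - f n X) - L)) (𝓝[≠] 0) (𝓝 0)

/-- `f` is a uniformly analytic nc function on the uniformly open nc set `D`. -/
structure IsUniformlyAnalytic (D : NCSubset M) (f : GradedMap M W) : Prop where
  isNCFunction : IsNCFunction D f
  isLocallyBounded : IsLocallyBounded D f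
  isGDifferentiable : IsGDifferentiable D f

end Functions

/-! ### nc vector bundles -/

section Bundles

/-- The canonical projection `π (Z, A) = Z`. -/
def base {n : ℕ+} {M V : Type*} (P : Mat n (M × V)) : Mat n M := P.map Prod.fst

/-- The fibre component `A` of `(Z, A)`. -/
def fib {n : ℕ+} {M V : Type*} (P : Mat n (M × V)) : Mat n V := P.map Prod.snd

/-- The point `(Z, A)`. -/
def pair {n : ℕ+} {M V : Type*} (Z : Mat n M) (A : Mat n V) : Mat n (M × V) :=
  Matrix.of fun i j => (Z i j, A i j)

/-- The trivial bundle over `U` with fibres `V^{n × n}`. -/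
def trivialBundle {M : Type*} (V : Type*) (U : NCSubset M) : NCSubset (M × V) :=
  fun n => {P | base P ∈ U n}

/-- The part of `E` that lies over `U`. -/
def restrictTo {M V : Type*} (E : NCSubset (M × V)) (U : NCSubset M) : NCSubset (M × V) :=
  fun n => {P | P ∈ E n ∧ base P ∈ U n}

/-- On each fibre of `D` the map `f` is complex linear, and a homomorphism of left modules over
the ring of complex `n × n` matrices. -/
structure IsFibrewiseLinear {M V W : Type*} [AddCommGroup V] [Module ℂ V] [AddCommGroup W]
    [Module ℂ W] (D : NCSubset (M × V)) (f : GradedMap (M × V) (M × W)) : Prop where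
  map_add : ∀ (n : ℕ+) (Z : Mat n M) (A B : Mat n V), pair Z A ∈ D n → pair Z B ∈ D n →
    fib (f n (pair Z (A + B))) = fib (f n (pair Z A)) + fib (f n (pair Z B))
  map_smul : ∀ (n : ℕ+) (Z : Mat n M) (c : ℂ) (A : Mat n V), pair Z A ∈ D n →
    fib (f n (pair Z (c • A))) = c • fib (f n (pair Z A))
  map_lmul : ∀ (n : ℕ+) (Z : Mat n M) (S : Matrix (Fin n) (Fin n) ℂ) (A : Mat n V),
    pair Z A ∈ D n → fib (f n (pair Z (lmul S A))) = lmul S (fib (f n (pair Z A)))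

variable {d : ℕ} {V : Type u} [AddCommGroup V] [Module ℂ V] [OperatorSpace V]

/-- `φ` is a trivialization of rank `r` of `E` over `U`: a uniformly analytic nc bijection from the
trivial bundle over `U` with fibres `(ℂʳ)^{n × n}` onto the part of `E` over `U`, which commutes
with the projections and is linear and left module homomorphic on each fibre. -/
structure IsTrivialization (E : NCSubset ((Fin d → ℂ) × V)) (r : ℕ) (U : NCSubset (Fin d → ℂ))
    (φ : GradedMap ((Fin d → ℂ) × (Fin r → ℂ)) ((Fin d → ℂ) × V)) : Prop where
  isUniformlyAnalytic : IsUniformlyAnalytic (trivialBundle (Fin r → ℂ) U) φ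
  bijOn : ∀ n, Set.BijOn (φ n) (trivialBundle (Fin r → ℂ) U n) (restrictTo E U n)
  base_eq : ∀ n, ∀ P ∈ trivialBundle (Fin r → ℂ) U n, base (φ n P) = base P
  isFibrewiseLinear : IsFibrewiseLinear (trivialBundle (Fin r → ℂ) U) φ

/-- `U` is a cover of `Ω` by uniformly open nc subsets of `Ω`. -/
structure IsNCCover {ι : Type} (Ω : NCSubset (Fin d → ℂ)) (U : ι → NCSubset (Fin d → ℂ)) :
    Prop where
  isNCSet : ∀ α, IsNCSet (U α)
  isUniformlyOpen : ∀ α, IsUniformlyOpen (U α)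
  subset : ∀ α n, U α n ⊆ Ω n
  covers : ∀ n, ∀ Z ∈ Ω n, ∃ α, Z ∈ U α n

/-- `E` is an nc holomorphic vector bundle of rank `r` over `Ω`, embedded in the trivial bundle
over `Ω` with fibres `V^{n × n}`.  (A cover with index set in a larger universe would contain one
indexed by the points of `Ω`, which form a type in the lowest universe.) -/
structure IsNCVectorBundle (Ω : NCSubset (Fin d → ℂ)) (r : ℕ) (E : NCSubset ((Fin d → ℂ) × V)) :
    Prop where
  isNCSet : IsNCSet E
  subset : ∀ n, E n ⊆ trivialBundle V Ω n
  surj : ∀ n, ∀ Z ∈ Ω n, ∃ P ∈ E n, base P = Z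
  locally_trivial : ∃ (ι : Type) (U : ι → NCSubset (Fin d → ℂ))
    (φ : ι → GradedMap ((Fin d → ℂ) × (Fin r → ℂ)) ((Fin d → ℂ) × V)),
    IsNCCover Ω U ∧ ∀ α, IsTrivialization E r (U α) (φ α)

/-- The bundles `E` and `F` are isomorphic over the identity of the base: there is a bijective nc
map `f` from `E` onto `F`, linear and left module homomorphic on each fibre, commuting with the
projections, such that `f` and its inverse `f'` are uniformly locally bounded. -/
def AreIsomorphic (E F : NCSubset ((Fin d → ℂ) × V)) : Prop :=
  ∃ f f' : GradedMap ((Fin d → ℂ) × V) ((Fin d → ℂ) × V),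
    IsNCFunction E f ∧ IsLocallyBounded E f ∧ IsLocallyBounded F f' ∧
    (∀ n, Set.BijOn (f n) (E n) (F n)) ∧ (∀ n, Set.InvOn (f' n) (f n) (E n) (F n)) ∧
    (∀ n, ∀ P ∈ E n, base (f n P) = base P) ∧ IsFibrewiseLinear E f

/-! ### Transition functions and cocycles -/

/-- The product `[A₁ ⋯ A_r] g`, for a row of `r` complex `n × n` matrices and an `r × r` block
matrix `g` with blocks of size `n × n`.  The row is encoded as an `n × n` matrix over `ℂʳ` and `g`
as an `n × n` matrix over `ℂ^{r × r}`: the block `(a, b)` of `g` has the entries `g k l a b`. -/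
def rowMul {n : ℕ+} {r : ℕ} (A : Mat n (Fin r → ℂ)) (g : Mat n (Matrix (Fin r) (Fin r) ℂ)) :
    Mat n (Fin r → ℂ) :=
  Matrix.of fun k l b => ∑ m, ∑ a, A k m a * g m l a b

/-- A uniformly analytic nc function on `D` with values in the invertible `nr × nr` matrices,
`n = 1, 2, …`. -/
structure IsAnalyticGL {r : ℕ} (D : NCSubset (Fin d → ℂ))
    (g : GradedMap (Fin d → ℂ) (Matrix (Fin r) (Fin r) ℂ)) : Prop where
  isUniformlyAnalytic : IsUniformlyAnalytic D g
  isUnit : ∀ n, ∀ Z ∈ D n, IsUnit (g n Z)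

/-- nc cocycles with values in the invertible `nr × nr` matrices, relative to the cover `U`.  A
matrix `g` stands for the map `A ↦ A g` on rows, so the composition of the maps given by
`g_{αβ}`, `g_{βγ}` and `g_{γα}` (the last one applied first) is `A ↦ A g_{γα} g_{βγ} g_{αβ}`. -/
structure IsNCCocycle {ι : Type} {r : ℕ} (U : ι → NCSubset (Fin d → ℂ))
    (g : ι → ι → GradedMap (Fin d → ℂ) (Matrix (Fin r) (Fin r) ℂ)) : Prop where
  isAnalyticGL : ∀ α β, IsAnalyticGL (inter (U α) (U β)) (g α β)
  cocycle : ∀ α β γ n, ∀ Z : Mat n (Fin d → ℂ), Z ∈ U α n → Z ∈ U β n → Z ∈ U γ n →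
    g γ α n Z * g β γ n Z * g α β n Z = 1

/-- `g` is the nc cocycle of the transition functions of the local trivializations `φ` over `U`:
`φ_α⁻¹ (φ_β (Z, A)) = (Z, A g_{αβ}(Z))`. -/
structure IsTransitionCocycle {ι : Type} {r : ℕ} (U : ι → NCSubset (Fin d → ℂ))
    (φ : ι → GradedMap ((Fin d → ℂ) × (Fin r → ℂ)) ((Fin d → ℂ) × V))
    (g : ι → ι → GradedMap (Fin d → ℂ) (Matrix (Fin r) (Fin r) ℂ)) : Prop where
  isNCCocycle : IsNCCocycle U g
  transition : ∀ α β n, ∀ Z : Mat n (Fin d → ℂ), Z ∈ U α n → Z ∈ U β n →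
    ∀ A : Mat n (Fin r → ℂ), φ β n (pair Z A) = φ α n (pair Z (rowMul A (g α β n Z)))

/-- Two nc cocycles relative to a cover by sets invariant under similarities and direct summands
are equivalent (cohomologous).  As maps on rows, acting by multiplication from the right, the
equation says `g_{αβ} ∘ λ_β = λ_α ∘ h_{αβ}`. -/
def AreCohomologous {ι : Type} {r : ℕ} (U : ι → NCSubset (Fin d → ℂ))
    (g h : ι → ι → GradedMap (Fin d → ℂ) (Matrix (Fin r) (Fin r) ℂ)) : Prop :=
  ∃ lam : ι → GradedMap (Fin d → ℂ) (Matrix (Fin r) (Fin r) ℂ),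
    (∀ α, IsAnalyticGL (U α) (lam α)) ∧
    ∀ α β n, ∀ Z : Mat n (Fin d → ℂ), Z ∈ U α n → Z ∈ U β n →
      lam β n Z * g α β n Z = h α β n Z * lam α n Z

end Bundles

end NCBundle

set_option linter.unusedSectionVars false

namespace NCBundle

open OperatorSpace

/-! ### Matrices over a vector space as a bimodule over scalar matrices -/

section BimoduleAlgebra

variable {M : Type*} [AddCommGroup M] [Module ℂ M]
variable {k l m n p : Type*} [Fintype m] [Fintype n]

/-! A trivialization of rank `r` over `U` is the same thing as a frame: `r` uniformly locally
bounded nc functions `v_a` on `U` such that `A ↦ ∑ A_a v_a(Z)` maps rows bijectively onto the fibre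
over each `Z` (`IsTrivialization.isFrame`, `IsFrame.isTrivialization`). All the work is done with
frames.

Suppose first that `f : E → F` is an isomorphism. Take frames of `E` over some trivializing cover.
Its sets need not be invariant under similarities and direct summands, so each is enlarged to its
envelope, the set of all `X` with `QJ = 1`, `WJ = JX`, `QW = XQ` for some point `W` of the old set.
The envelope stays inside `Ω` (`IsRetract.mem`) and is uniformly open (`IsRetract.exists_near`). An
nc function extends by `v(X) = Q v(W) J`; this is well defined because nc functions respect
intertwinings (`IsNCFunction.map_intertwining`). The extended tuple is still a frame because the
fibre of `E` over `X` is the compression of the fibre over `W`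
(`IsNCVectorBundle.mem_iff_of_isRetract`). Applying `f` to the frames of `E` gives frames of `F`
(`IsFrame.map`), and fibrewise linearity of `f` makes the two families of transition functions
equal. The cocycles are then cohomologous through the identity.

Conversely, let `λ` realize the cohomology. Multiplying the frames of `E` by `λ` gives frames with
the same transition functions as those of `F`, so the maps sending frame to frame glue to a
bijection `E → F` (`exists_glued_map`). It respects direct sums and similarities because, by
invariance, a single set of the cover contains all the base points involved
(`areIsomorphic_of_frames`).

Two analytic facts support both directions. A uniformly locally bounded nc function is locally
Lipschitz and Gâteaux differentiable, so only boundedness ever has to be checked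
(`IsNCFunction.exists_lipschitz`, `IsNCFunction.isGDifferentiable`). And the coordinates with
respect to a frame are bounded uniformly over all amplifications (`IsFrame.exists_lower_bound`):
injectivity at the single level `n` gives a bound there, compressions carry it to all multiples of
`n`, and the Lipschitz estimate carries it to nearby points. -/

theorem lmul_apply (S : Matrix l n ℂ) (A : Matrix n p M) (i j) :
    lmul S A i j = ∑ k, S i k • A k j := rfl

theorem rmul_apply (A : Matrix l n M) (S : Matrix n p ℂ) (i j) :
    rmul A S i j = ∑ k, S k j • A i k := rfl

theorem lmul_lmul (S : Matrix k m ℂ) (T : Matrix m n ℂ) (A : Matrix n p M) :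
    lmul S (lmul T A) = lmul (S * T) A := by
  ext i j
  simp only [lmul_apply, Finset.smul_sum, Matrix.mul_apply, Finset.sum_smul, smul_smul]
  exact Finset.sum_comm

theorem rmul_rmul (A : Matrix k m M) (S : Matrix m n ℂ) (T : Matrix n p ℂ) :
    rmul (rmul A S) T = rmul A (S * T) := by
  ext i j
  simp only [rmul_apply, Finset.smul_sum, Matrix.mul_apply, Finset.sum_smul, smul_smul]
  rw [Finset.sum_comm]
  simp only [mul_comm]

theorem lmul_rmul (S : Matrix k m ℂ) (A : Matrix m n M) (T : Matrix n p ℂ) :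
    lmul S (rmul A T) = rmul (lmul S A) T := by
  ext i j
  simp only [rmul_apply, lmul_apply, Finset.smul_sum, smul_smul]
  rw [Finset.sum_comm]
  simp only [mul_comm]

theorem one_lmul [DecidableEq m] (A : Matrix m p M) : lmul (1 : Matrix m m ℂ) A = A := by
  ext i j
  simp [lmul_apply, Matrix.one_apply]

theorem rmul_one [DecidableEq n] (A : Matrix l n M) : rmul A (1 : Matrix n n ℂ) = A := by
  ext i j
  simp [rmul_apply, Matrix.one_apply]

theorem lmul_add (S : Matrix l n ℂ) (A B : Matrix n p M) :
    lmul S (A + B) = lmul S A + lmul S B := by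
  ext i j
  simp [lmul_apply, Finset.sum_add_distrib]

theorem lmul_zero (S : Matrix l n ℂ) : lmul S (0 : Matrix n p M) = 0 := by
  ext i j
  simp [lmul_apply]

theorem lmul_sub (S : Matrix l n ℂ) (A B : Matrix n p M) :
    lmul S (A - B) = lmul S A - lmul S B := by
  ext i j
  simp [lmul_apply, Finset.sum_sub_distrib, smul_sub]

theorem add_lmul (S T : Matrix l n ℂ) (A : Matrix n p M) :
    lmul (S + T) A = lmul S A + lmul T A := by
  ext i j
  simp [lmul_apply, Finset.sum_add_distrib, add_smul]

theorem smul_lmul (c : ℂ) (S : Matrix l n ℂ) (A : Matrix n p M) :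
    lmul (c • S) A = c • lmul S A := by
  ext i j
  simp [lmul_apply, Finset.smul_sum, smul_smul]

theorem zero_lmul (A : Matrix n p M) : lmul (0 : Matrix l n ℂ) A = 0 := by
  ext i j
  simp [lmul_apply]

theorem add_rmul (A B : Matrix l n M) (S : Matrix n p ℂ) :
    rmul (A + B) S = rmul A S + rmul B S := by
  ext i j
  simp [rmul_apply, Finset.sum_add_distrib]

theorem sub_rmul (A B : Matrix l n M) (S : Matrix n p ℂ) :
    rmul (A - B) S = rmul A S - rmul B S := by
  ext i j
  simp [rmul_apply, Finset.sum_sub_distrib, smul_sub]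

theorem zero_rmul (S : Matrix n p ℂ) : rmul (0 : Matrix l n M) S = 0 := by
  ext i j
  simp [rmul_apply]

theorem rmul_zero (A : Matrix l n M) : rmul A (0 : Matrix n p ℂ) = 0 := by
  ext i j
  simp [rmul_apply]

theorem rmul_smul (c : ℂ) (A : Matrix l n M) (S : Matrix n p ℂ) :
    rmul A (c • S) = c • rmul A S := by
  ext i j
  simp [rmul_apply, Finset.smul_sum, smul_smul]

theorem rmul_neg (A : Matrix l n M) (S : Matrix n p ℂ) : rmul A (-S) = -rmul A S := by
  ext i j
  simp [rmul_apply]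

theorem lmul_sum {ι : Type*} (s : Finset ι) (S : Matrix l n ℂ) (A : ι → Matrix n p M) :
    lmul S (∑ a ∈ s, A a) = ∑ a ∈ s, lmul S (A a) := by
  classical
  induction s using Finset.induction_on with
  | empty => simp [lmul_zero]
  | insert a s ha ih => rw [Finset.sum_insert ha, Finset.sum_insert ha, lmul_add, ih]

theorem sum_rmul {ι : Type*} (s : Finset ι) (A : ι → Matrix l n M) (S : Matrix n p ℂ) :
    rmul (∑ a ∈ s, A a) S = ∑ a ∈ s, rmul (A a) S := by
  classical
  induction s using Finset.induction_on with
  | empty => simp [zero_rmul]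
  | insert a s ha ih => rw [Finset.sum_insert ha, Finset.sum_insert ha, add_rmul, ih]

theorem lmul_eq_mul (S : Matrix l n ℂ) (A : Matrix n p ℂ) : lmul S A = S * A := by
  ext i j
  simp [lmul_apply, Matrix.mul_apply]

theorem rmul_eq_mul (A : Matrix l n ℂ) (S : Matrix n p ℂ) : rmul A S = A * S := by
  ext i j
  simp [rmul_apply, Matrix.mul_apply, mul_comm]

theorem lmul_submatrix {k' m' p' : Type*} [Fintype m'] (S : Matrix k m ℂ) (A : Matrix m p M)
    (e : k' → k) (f : m' ≃ m) (g : p' → p) :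
    lmul (S.submatrix e f) (A.submatrix f g) = (lmul S A).submatrix e g := by
  ext i j
  exact Equiv.sum_comp f fun x => S (e i) x • A x (g j)

theorem rmul_submatrix {k' m' p' : Type*} [Fintype m'] (A : Matrix k m M) (S : Matrix m p ℂ)
    (e : k' → k) (f : m' ≃ m) (g : p' → p) :
    rmul (A.submatrix e f) (S.submatrix f g) = (rmul A S).submatrix e g := by
  ext i j
  exact Equiv.sum_comp f fun x => S x (g j) • A (e i) x

theorem lmul_map {N : Type*} [AddCommGroup N] [Module ℂ N] (S : Matrix l n ℂ) (A : Matrix n p M)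
    (f : M →ₗ[ℂ] N) : (lmul S A).map f = lmul S (A.map f) := by
  ext i j
  simp [lmul_apply]

theorem rmul_map {N : Type*} [AddCommGroup N] [Module ℂ N] (A : Matrix l n M) (S : Matrix n p ℂ)
    (f : M →ₗ[ℂ] N) : (rmul A S).map f = rmul (A.map f) S := by
  ext i j
  simp [rmul_apply]

end BimoduleAlgebra

/-! ### Block matrices -/

section Blocks

variable {M : Type*} [AddCommGroup M] [Module ℂ M] {n m n' m' n'' m'' : ℕ+} {k : Type*}

/-- The matrix with the blocks `A`, `B` (first row) and `C`, `D` (second row). -/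
def blk (A : Matrix (Fin n) (Fin n') M) (B : Matrix (Fin n) (Fin m') M)
    (C : Matrix (Fin m) (Fin n') M) (D : Matrix (Fin m) (Fin m') M) :
    Matrix (Fin (n + m : ℕ+)) (Fin (n' + m' : ℕ+)) M :=
  (Matrix.fromBlocks A B C D).submatrix (sumEquiv n m).symm (sumEquiv n' m').symm

/-- The matrix with the blocks `A` and `C` below each other. -/
def blkCol (A : Matrix (Fin n) k M) (C : Matrix (Fin m) k M) : Matrix (Fin (n + m : ℕ+)) k M :=
  (Matrix.fromRows A C).submatrix (sumEquiv n m).symm id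

/-- The matrix with the blocks `A` and `B` next to each other. -/
def blkRow (A : Matrix k (Fin n) M) (B : Matrix k (Fin m) M) : Matrix k (Fin (n + m : ℕ+)) M :=
  (Matrix.fromCols A B).submatrix id (sumEquiv n m).symm

theorem blk_apply (A : Matrix (Fin n) (Fin n') M) (B : Matrix (Fin n) (Fin m') M)
    (C : Matrix (Fin m) (Fin n') M) (D : Matrix (Fin m) (Fin m') M) (i j) :
    blk A B C D (sumEquiv n m i) (sumEquiv n' m' j) = Matrix.fromBlocks A B C D i j := by
  rw [blk, Matrix.submatrix_apply, Equiv.symm_apply_apply, Equiv.symm_apply_apply]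

theorem blkCol_apply (A : Matrix (Fin n) k M) (C : Matrix (Fin m) k M) (i j) :
    blkCol A C (sumEquiv n m i) j = Matrix.fromRows A C i j := by
  rw [blkCol, Matrix.submatrix_apply, Equiv.symm_apply_apply, id]

theorem blkRow_apply (A : Matrix k (Fin n) M) (B : Matrix k (Fin m) M) (i j) :
    blkRow A B i (sumEquiv n m j) = Matrix.fromCols A B i j := by
  rw [blkRow, Matrix.submatrix_apply, Equiv.symm_apply_apply, id]

theorem directSum_eq_blk (A : Mat n M) (B : Mat m M) : directSum A B = blk A 0 0 B := rfl

theorem blk_inj {A A' : Matrix (Fin n) (Fin n') M} {B B' : Matrix (Fin n) (Fin m') M}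
    {C C' : Matrix (Fin m) (Fin n') M} {D D' : Matrix (Fin m) (Fin m') M} :
    blk A B C D = blk A' B' C' D' ↔ A = A' ∧ B = B' ∧ C = C' ∧ D = D' := by
  constructor
  · intro h
    have h2 := congrArg (fun X => X.submatrix (sumEquiv n m) (sumEquiv n' m')) h
    simp only [blk, Matrix.submatrix_submatrix, Equiv.symm_comp_self, Matrix.submatrix_id_id] at h2
    exact Matrix.fromBlocks_inj.mp h2
  · rintro ⟨rfl, rfl, rfl, rfl⟩
    rfl

theorem blk_add (A A' : Matrix (Fin n) (Fin n') M) (B B' : Matrix (Fin n) (Fin m') M)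
    (C C' : Matrix (Fin m) (Fin n') M) (D D' : Matrix (Fin m) (Fin m') M) :
    blk A B C D + blk A' B' C' D' = blk (A + A') (B + B') (C + C') (D + D') := by
  simp only [blk, ← Matrix.fromBlocks_add]
  rfl

theorem blk_sub (A A' : Matrix (Fin n) (Fin n') M) (B B' : Matrix (Fin n) (Fin m') M)
    (C C' : Matrix (Fin m) (Fin n') M) (D D' : Matrix (Fin m) (Fin m') M) :
    blk A B C D - blk A' B' C' D' = blk (A - A') (B - B') (C - C') (D - D') := by
  rw [sub_eq_iff_eq_add, blk_add]
  simp only [sub_add_cancel]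

theorem blk_one : blk (1 : Matrix (Fin n) (Fin n) ℂ) 0 0 (1 : Matrix (Fin m) (Fin m) ℂ) = 1 := by
  rw [blk, Matrix.fromBlocks_one, Matrix.submatrix_one_equiv]

theorem blk_map {N : Type*} [AddCommGroup N] [Module ℂ N] (f : M →ₗ[ℂ] N) (A : Matrix (Fin n) (Fin n') M)
    (B : Matrix (Fin n) (Fin m') M) (C : Matrix (Fin m) (Fin n') M)
    (D : Matrix (Fin m) (Fin m') M) :
    (blk A B C D).map f = blk (A.map f) (B.map f) (C.map f) (D.map f) := by
  rw [blk, blk, ← Matrix.fromBlocks_map]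
  rfl

theorem lmul_blk (P : Matrix (Fin n) (Fin n') ℂ) (Q : Matrix (Fin n) (Fin m') ℂ)
    (R : Matrix (Fin m) (Fin n') ℂ) (S : Matrix (Fin m) (Fin m') ℂ)
    (A : Matrix (Fin n') (Fin n'') M) (B : Matrix (Fin n') (Fin m'') M)
    (C : Matrix (Fin m') (Fin n'') M) (D : Matrix (Fin m') (Fin m'') M) :
    lmul (blk P Q R S) (blk A B C D) = blk (lmul P A + lmul Q C) (lmul P B + lmul Q D)
      (lmul R A + lmul S C) (lmul R B + lmul S D) := by
  rw [blk, blk, lmul_submatrix, blk]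
  congr 1
  ext i j
  rcases i with i | i <;> rcases j with j | j <;> simp [lmul_apply]

theorem rmul_blk (P : Matrix (Fin n') (Fin n'') ℂ) (Q : Matrix (Fin n') (Fin m'') ℂ)
    (R : Matrix (Fin m') (Fin n'') ℂ) (S : Matrix (Fin m') (Fin m'') ℂ)
    (A : Matrix (Fin n) (Fin n') M) (B : Matrix (Fin n) (Fin m') M)
    (C : Matrix (Fin m) (Fin n') M) (D : Matrix (Fin m) (Fin m') M) :
    rmul (blk A B C D) (blk P Q R S) = blk (rmul A P + rmul B R) (rmul A Q + rmul B S)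
      (rmul C P + rmul D R) (rmul C Q + rmul D S) := by
  rw [blk, blk, rmul_submatrix, blk]
  congr 1
  ext i j
  rcases i with i | i <;> rcases j with j | j <;> simp [rmul_apply]

theorem blk_mul (P : Matrix (Fin n) (Fin n') ℂ) (Q : Matrix (Fin n) (Fin m') ℂ)
    (R : Matrix (Fin m) (Fin n') ℂ) (S : Matrix (Fin m) (Fin m') ℂ)
    (A : Matrix (Fin n') (Fin n'') ℂ) (B : Matrix (Fin n') (Fin m'') ℂ)
    (C : Matrix (Fin m') (Fin n'') ℂ) (D : Matrix (Fin m') (Fin m'') ℂ) :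
    blk P Q R S * blk A B C D = blk (P * A + Q * C) (P * B + Q * D)
      (R * A + S * C) (R * B + S * D) := by
  simp only [← lmul_eq_mul, lmul_blk]

theorem lmul_blkRow_blk {l : Type*} (S : Matrix l (Fin n) ℂ) (T : Matrix l (Fin m) ℂ)
    (A : Matrix (Fin n) (Fin n') M) (B : Matrix (Fin n) (Fin m') M)
    (C : Matrix (Fin m) (Fin n') M) (D : Matrix (Fin m) (Fin m') M) :
    lmul (blkRow S T) (blk A B C D) = blkRow (lmul S A + lmul T C) (lmul S B + lmul T D) := by
  rw [blkRow, blk, lmul_submatrix, blkRow]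
  congr 1
  ext i j
  rcases j with j | j <;> simp [lmul_apply]

theorem rmul_blk_blkCol {l : Type*} (S : Matrix (Fin n') l ℂ) (T : Matrix (Fin m') l ℂ)
    (A : Matrix (Fin n) (Fin n') M) (B : Matrix (Fin n) (Fin m') M)
    (C : Matrix (Fin m) (Fin n') M) (D : Matrix (Fin m) (Fin m') M) :
    rmul (blk A B C D) (blkCol S T) = blkCol (rmul A S + rmul B T) (rmul C S + rmul D T) := by
  rw [blkCol, blk, rmul_submatrix, blkCol]
  congr 1
  ext i j
  rcases i with i | i <;> simp [rmul_apply]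

theorem rmul_blkRow_blkCol {l : Type*} (S : Matrix (Fin n) l ℂ) (T : Matrix (Fin m) l ℂ)
    (A : Matrix k (Fin n) M) (B : Matrix k (Fin m) M) :
    rmul (blkRow A B) (blkCol S T) = rmul A S + rmul B T := by
  rw [blkCol, blkRow, rmul_submatrix]
  ext i j
  simp [rmul_apply]

theorem lmul_blkCol {l p : Type*} [Fintype l] (S : Matrix (Fin n) l ℂ) (T : Matrix (Fin m) l ℂ)
    (A : Matrix l p M) : lmul (blkCol S T) A = blkCol (lmul S A) (lmul T A) := by
  ext i j
  obtain ⟨i, rfl⟩ := (sumEquiv n m).surjective i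
  rcases i with i | i <;> simp [-PNat.add_coe, lmul_apply, blkCol_apply]

theorem rmul_blkRow {l p : Type*} [Fintype l] (A : Matrix p l M) (S : Matrix l (Fin n) ℂ)
    (T : Matrix l (Fin m) ℂ) : rmul A (blkRow S T) = blkRow (rmul A S) (rmul A T) := by
  ext i j
  obtain ⟨j, rfl⟩ := (sumEquiv n m).surjective j
  rcases j with j | j <;> simp [-PNat.add_coe, rmul_apply, blkRow_apply]

theorem rmul_blkCol_blkRow {l : Type*} [Fintype l] (A : Matrix (Fin n) l M) (C : Matrix (Fin m) l M)
    (S : Matrix l (Fin n') ℂ) (T : Matrix l (Fin m') ℂ) :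
    rmul (blkCol A C) (blkRow S T) = blk (rmul A S) (rmul A T) (rmul C S) (rmul C T) := by
  ext i j
  obtain ⟨i, rfl⟩ := (sumEquiv n m).surjective i
  obtain ⟨j, rfl⟩ := (sumEquiv n' m').surjective j
  rcases i with i | i <;> rcases j with j | j <;> 
    simp [-PNat.add_coe, rmul_apply, blkRow_apply, blkCol_apply, blk_apply]

/-- Coordinate inclusions and projections are contractions, so by Ruan's second axiom passing to a
corner, or padding by zeros, does not increase norms. -/
theorem opNorm_blkCol_one_zero_le :
    opNorm (blkCol (1 : Matrix (Fin n) (Fin n) ℂ) (0 : Matrix (Fin m) (Fin n) ℂ)) ≤ 1 := by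
  refine opNorm_le zero_le_one fun x => ?_
  rw [← Equiv.sum_comp (sumEquiv n m)]
  simp [-PNat.add_coe, blkCol_apply, Matrix.mulVec, dotProduct, Matrix.one_apply]

theorem opNorm_blkRow_zero_one_le :
    opNorm (blkRow (0 : Matrix (Fin m) (Fin n) ℂ) (1 : Matrix (Fin m) (Fin m) ℂ)) ≤ 1 := by
  refine opNorm_le zero_le_one fun x => ?_
  rw [← Equiv.sum_comp (sumEquiv n m) fun j => ‖x j‖ ^ 2]
  have : ∀ i, (blkRow (0 : Matrix (Fin m) (Fin n) ℂ) (1 : Matrix (Fin m) (Fin m) ℂ)).mulVec x i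
      = x (sumEquiv n m (Sum.inr i)) := by
    intro i
    rw [Matrix.mulVec, dotProduct, ← Equiv.sum_comp (sumEquiv n m)]
    simp [-PNat.add_coe, blkRow_apply, Matrix.one_apply]
  simp only [this, Fintype.sum_sum_type, one_pow, one_mul, le_add_iff_nonneg_left]
  exact Finset.sum_nonneg fun _ _ => sq_nonneg _

theorem opNorm_blkRow_one_zero_le :
    opNorm (blkRow (1 : Matrix (Fin n) (Fin n) ℂ) (0 : Matrix (Fin n) (Fin m) ℂ)) ≤ 1 := by
  refine opNorm_le zero_le_one fun x => ?_
  rw [← Equiv.sum_comp (sumEquiv n m) fun j => ‖x j‖ ^ 2]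
  have : ∀ i, (blkRow (1 : Matrix (Fin n) (Fin n) ℂ) (0 : Matrix (Fin n) (Fin m) ℂ)).mulVec x i
      = x (sumEquiv n m (Sum.inl i)) := by
    intro i
    rw [Matrix.mulVec, dotProduct, ← Equiv.sum_comp (sumEquiv n m)]
    simp [-PNat.add_coe, blkRow_apply, Matrix.one_apply]
  simp only [this, Fintype.sum_sum_type, one_pow, one_mul, le_add_iff_nonneg_right]
  exact Finset.sum_nonneg fun _ _ => sq_nonneg _

theorem opNorm_blkCol_zero_one_le :
    opNorm (blkCol (0 : Matrix (Fin n) (Fin m) ℂ) (1 : Matrix (Fin m) (Fin m) ℂ)) ≤ 1 := by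
  refine opNorm_le zero_le_one fun x => ?_
  rw [← Equiv.sum_comp (sumEquiv n m)]
  simp [-PNat.add_coe, blkCol_apply, Matrix.mulVec, dotProduct, Matrix.one_apply]

end Blocks

/-! ### Elementary properties of the norms of an operator space -/

section MNorm

variable {V : Type*} [AddCommGroup V] [Module ℂ V] [OperatorSpace V] {n m : ℕ+}

theorem mnorm_zero : mnorm (0 : Mat n V) = 0 := by
  simpa using mnorm_smul (0 : ℂ) (0 : Mat n V)

theorem mnorm_neg (A : Mat n V) : mnorm (-A) = mnorm A := by
  simpa using mnorm_smul (-1 : ℂ) A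

theorem mnorm_nonneg (A : Mat n V) : 0 ≤ mnorm A := by
  have h := mnorm_add_le A (-A)
  rw [add_neg_cancel, mnorm_zero, mnorm_neg] at h
  linarith

theorem mnorm_sub_le (A B : Mat n V) : mnorm (A - B) ≤ mnorm A + mnorm B := by
  rw [sub_eq_add_neg, ← mnorm_neg B]
  exact mnorm_add_le _ _

theorem mnorm_sub_comm (A B : Mat n V) : mnorm (A - B) = mnorm (B - A) := by
  rw [← mnorm_neg, neg_sub]

theorem mnorm_sum_le {ι : Type*} (s : Finset ι) (A : ι → Mat n V) :
    mnorm (∑ a ∈ s, A a) ≤ ∑ a ∈ s, mnorm (A a) := by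
  classical
  induction s using Finset.induction_on with
  | empty => simp [mnorm_zero]
  | insert a s ha ih =>
    rw [Finset.sum_insert ha, Finset.sum_insert ha]
    exact (mnorm_add_le _ _).trans (by linarith)

theorem opNorm_one_le {n : Type*} [Fintype n] [DecidableEq n] :
    opNorm (1 : Matrix n n ℂ) ≤ 1 :=
  opNorm_le zero_le_one fun x => by simp

theorem mnorm_lmul_le (S : Matrix (Fin n) (Fin n) ℂ) (A : Mat n V) :
    mnorm (lmul S A) ≤ opNorm S * mnorm A := by
  have h := mnorm_lmul_rmul S A 1
  rw [rmul_one] at h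
  refine h.trans ?_
  exact mul_le_of_le_one_right (mul_nonneg (opNorm_nonneg _) (mnorm_nonneg _)) opNorm_one_le

theorem mnorm_lmul_rmul_le {X : Matrix (Fin m) (Fin n) ℂ} {A : Mat n V}
    {Y : Matrix (Fin n) (Fin m) ℂ} (hX : opNorm X ≤ 1) (hY : opNorm Y ≤ 1) :
    mnorm (rmul (lmul X A) Y) ≤ mnorm A := by
  refine (mnorm_lmul_rmul X A Y).trans ?_
  refine (mul_le_of_le_one_right (mul_nonneg (opNorm_nonneg _) (mnorm_nonneg _)) hY).trans ?_
  exact mul_le_of_le_one_left (mnorm_nonneg _) hX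

theorem mnorm_corner_le (A B C D : Mat n V) : mnorm B ≤ mnorm (blk A B C D) := by
  have h := mnorm_lmul_rmul_le (A := blk A B C D) (opNorm_blkRow_one_zero_le (n := n) (m := n))
    (opNorm_blkCol_zero_one_le (n := n) (m := n))
  simpa only [lmul_blkRow_blk, rmul_blkRow_blkCol, one_lmul, rmul_one, zero_lmul, rmul_zero,
    add_zero, zero_add] using h

theorem mnorm_blk_corner_le (B : Mat n V) : mnorm (blk 0 B 0 0) ≤ mnorm B := by
  have h := mnorm_lmul_rmul_le (A := B) (opNorm_blkCol_one_zero_le (n := n) (m := n))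
    (opNorm_blkRow_zero_one_le (n := n) (m := n))
  simpa only [lmul_blkCol, rmul_blkCol_blkRow, one_lmul, rmul_one, zero_lmul, rmul_zero, zero_rmul]
    using h

end MNorm

/-! ### Amplifications -/

section Amplification

variable {M : Type*} [AddCommGroup M] [Module ℂ M] {n N : ℕ+}

/-- Since `n` divides `k`, the cut after index `k` falls between two copies of `X`. The second size
`k'` is arbitrary. -/
theorem amp_add {k k' : ℕ+} (h : (n : ℕ) ∣ k) (X : Mat n M) :
    amp (k + k') X = directSum (amp k X) (amp k' X) := by
  obtain ⟨q, hq⟩ := h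
  have hn := n.pos
  ext i j
  obtain ⟨i, rfl⟩ := (sumEquiv k k').surjective i
  obtain ⟨j, rfl⟩ := (sumEquiv k k').surjective j
  rw [directSum_apply]
  have h1 : ∀ a : Fin k, ((sumEquiv k k' (Sum.inl a) : Fin (k + k' : ℕ+)) : ℕ) = a := fun a => rfl
  have h2 : ∀ a : Fin k', ((sumEquiv k k' (Sum.inr a) : Fin (k + k' : ℕ+)) : ℕ) = n * q + a :=
    fun a => by rw [← hq]; rfl
  have h3 : ∀ a : Fin k, (a : ℕ) / n < q := fun a =>
    Nat.div_lt_of_lt_mul (hq ▸ a.2)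
  rcases i with i | i <;> rcases j with j | j
  · rfl
  · have : ¬ (i : ℕ) / n = q + (j : ℕ) / n := fun h =>
      (h3 i).not_ge (h.symm ▸ Nat.le_add_right _ _)
    simp [-PNat.add_coe, amp, h1, h2, Nat.mul_add_div hn, this]
  · have : ¬ q + (i : ℕ) / n = (j : ℕ) / n := fun h =>
      (h3 j).not_ge (h ▸ Nat.le_add_right _ _)
    simp [-PNat.add_coe, amp, h1, h2, Nat.mul_add_div hn, this]
  · simp [-PNat.add_coe, amp, h2, Nat.mul_add_div hn]

theorem amp_self (X : Mat n M) : amp n X = X := by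
  ext i j
  simp [amp, Nat.div_eq_of_lt i.2, Nat.div_eq_of_lt j.2, Nat.mod_eq_of_lt i.2, Nat.mod_eq_of_lt j.2]

/-- The indices of an `n q × n q` matrix, in `q` groups of size `n`. -/
def ampEquiv (n q : ℕ+) : Fin n × Fin q ≃ Fin (n * q : ℕ+) :=
  (Equiv.prodComm _ _).trans (finProdFinEquiv.trans (finCongr (by rw [PNat.mul_coe, mul_comm])))

theorem ampEquiv_apply (q : ℕ+) (x : Fin n × Fin q) :
    (ampEquiv n q x : ℕ) = x.1 + n * x.2 := rfl

/-- The amplification of a rectangular matrix. -/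
def ampRect (q : ℕ+) (A : Matrix (Fin N) (Fin n) M) :
    Matrix (Fin (N * q : ℕ+)) (Fin (n * q : ℕ+)) M :=
  (Matrix.of fun (x : Fin N × Fin q) (y : Fin n × Fin q) =>
    if x.2 = y.2 then A x.1 y.1 else 0).submatrix (ampEquiv N q).symm (ampEquiv n q).symm

theorem amp_mul (q : ℕ+) (X : Mat n M) : amp (n * q) X = ampRect q X := by
  ext i j
  obtain ⟨⟨i, a⟩, rfl⟩ := (ampEquiv n q).surjective i
  obtain ⟨⟨j, b⟩, rfl⟩ := (ampEquiv n q).surjective j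
  rw [ampRect, Matrix.submatrix_apply, Equiv.symm_apply_apply, Equiv.symm_apply_apply]
  simp [-PNat.mul_coe, amp, ampEquiv_apply, Nat.add_mul_div_left _ _ n.pos,
    Nat.div_eq_of_lt i.2, Nat.div_eq_of_lt j.2, Nat.mod_eq_of_lt i.2, Nat.mod_eq_of_lt j.2,
    Fin.ext_iff]

theorem lmul_ampRect {n' : ℕ+} (q : ℕ+) (S : Matrix (Fin N) (Fin n) ℂ)
    (A : Matrix (Fin n) (Fin n') M) : lmul (ampRect q S) (ampRect q A) = ampRect q (lmul S A) := by
  rw [ampRect, ampRect, lmul_submatrix, ampRect]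
  congr 1
  ext ⟨i, a⟩ ⟨j, b⟩
  by_cases h : a = b <;>
    simp [lmul_apply, Fintype.sum_prod_type, h, ite_smul]

theorem rmul_ampRect {n' : ℕ+} (q : ℕ+) (A : Matrix (Fin N) (Fin n) M)
    (S : Matrix (Fin n) (Fin n') ℂ) : rmul (ampRect q A) (ampRect q S) = ampRect q (rmul A S) := by
  rw [ampRect, ampRect, rmul_submatrix, ampRect]
  congr 1
  ext ⟨i, a⟩ ⟨j, b⟩
  by_cases h : a = b <;>
    simp [rmul_apply, Fintype.sum_prod_type, h, ite_smul]

theorem ampRect_mul {n' : ℕ+} (q : ℕ+) (S : Matrix (Fin N) (Fin n) ℂ)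
    (T : Matrix (Fin n) (Fin n') ℂ) : ampRect q S * ampRect q T = ampRect q (S * T) := by
  rw [← lmul_eq_mul, lmul_ampRect, lmul_eq_mul]

theorem ampRect_one (q : ℕ+) : ampRect q (1 : Matrix (Fin n) (Fin n) ℂ) = 1 := by
  ext i j
  obtain ⟨⟨i, a⟩, rfl⟩ := (ampEquiv n q).surjective i
  obtain ⟨⟨j, b⟩, rfl⟩ := (ampEquiv n q).surjective j
  rw [ampRect, Matrix.submatrix_apply, Equiv.symm_apply_apply, Equiv.symm_apply_apply]
  simp only [Matrix.of_apply, Matrix.one_apply, EmbeddingLike.apply_eq_iff_eq, Prod.mk.injEq,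
    ← ite_and, and_comm]

theorem opNorm_ampRect_le (q : ℕ+) (S : Matrix (Fin N) (Fin n) ℂ) :
    opNorm (ampRect q S) ≤ opNorm S :=
  (opNorm_submatrix (tensorOne q S) (ampEquiv N q).symm (ampEquiv n q).symm).trans_le
    (opNorm_tensorOne_le _ _)

/-- The matrix `ξ ⊗ 1` with `q` square blocks of size `n` below each other. -/
def ampCol (n : ℕ+) {q : ℕ+} (ξ : Fin q → ℂ) : Matrix (Fin (n * q : ℕ+)) (Fin n) ℂ :=
  (Matrix.of fun (x : Fin n × Fin q) (y : Fin n) => if x.1 = y then ξ x.2 else 0).submatrix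
    (ampEquiv n q).symm id

/-- Stacked scalar blocks `ξ_c 1` intertwine the amplification of `A` with `A` itself. This brings
estimates for amplifications back to the fixed level `n`. -/
theorem rmul_ampRect_ampCol {q : ℕ+} (A : Mat n M) (ξ : Fin q → ℂ) :
    rmul (ampRect q A) (ampCol n ξ) = lmul (ampCol n ξ) A := by
  rw [ampRect, ampCol, rmul_submatrix]
  ext i j
  obtain ⟨⟨i, a⟩, rfl⟩ := (ampEquiv n q).surjective i
  rw [Matrix.submatrix_apply, Equiv.symm_apply_apply]
  simp [-PNat.mul_coe, rmul_apply, lmul_apply, Fintype.sum_prod_type, ite_smul]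

theorem ampCol_mulVec {q : ℕ+} (ξ : Fin q → ℂ) (x : Fin n → ℂ) (y : Fin n × Fin q) :
    (ampCol n ξ).mulVec x (ampEquiv n q y) = ξ y.2 * x y.1 := by
  simp [-PNat.mul_coe, ampCol, Matrix.mulVec, dotProduct]

theorem opNorm_ampCol_le {q : ℕ+} (ξ : Fin q → ℂ) {c : ℝ} (hc : 0 ≤ c)
    (h : ∑ a, ‖ξ a‖ ^ 2 ≤ c ^ 2) : opNorm (ampCol n ξ) ≤ c := by
  refine opNorm_le hc fun x => ?_
  rw [← Equiv.sum_comp (ampEquiv n q)]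
  simp only [ampCol_mulVec, norm_mul, mul_pow, Fintype.sum_prod_type, ← Finset.sum_mul]
  rw [← Finset.mul_sum]
  exact mul_le_mul_of_nonneg_right h (Finset.sum_nonneg fun _ _ => sq_nonneg _)

theorem exists_eq_mul_of_dvd {k : ℕ+} (h : (n : ℕ) ∣ k) : ∃ q : ℕ+, k = n * q :=
  PNat.dvd_iff.mpr h

theorem amp_mem {D : NCSubset M} (hD : IsNCSet D) {X : Mat n M} (hX : X ∈ D n) {k : ℕ+}
    (h : (n : ℕ) ∣ k) : amp k X ∈ D k := by
  obtain ⟨q, rfl⟩ := exists_eq_mul_of_dvd h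
  clear h
  induction q using PNat.recOn with
  | one => rwa [mul_one, amp_self]
  | succ q ih =>
    rw [mul_add, mul_one, amp_add (by simp)]
    refine hD _ _ _ _ ih ?_
    rwa [amp_self]

variable {W : Type*} [AddCommGroup W] [Module ℂ W]

theorem IsNCFunction.map_amp {D : NCSubset M} {f : GradedMap M W} (hf : IsNCFunction D f)
    (hD : IsNCSet D) {X : Mat n M} (hX : X ∈ D n) {k : ℕ+} (h : (n : ℕ) ∣ k) :
    f k (amp k X) = amp k (f n X) := by
  obtain ⟨q, rfl⟩ := exists_eq_mul_of_dvd h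
  clear h
  induction q using PNat.recOn with
  | one => rw [mul_one, amp_self, amp_self]
  | succ q ih =>
    rw [mul_add, mul_one, amp_add (by simp), amp_add (by simp), amp_self, amp_self,
      hf.map_directSum _ _ _ _ (amp_mem hD hX (by simp)) hX, ih]

theorem mem_ncBall [OperatorSpace M] {X : Mat n M} {ρ : ℝ} (hρ : 0 < ρ) : X ∈ ncBall X ρ n := by
  refine ⟨dvd_rfl, ?_⟩
  rwa [amp_self, sub_self, mnorm_zero]

theorem ncBall_mono [OperatorSpace M] {X : Mat n M} {ρ ρ' : ℝ} (h : ρ ≤ ρ') (k : ℕ+) :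
    ncBall X ρ k ⊆ ncBall X ρ' k := fun _ hY => ⟨hY.1, hY.2.trans_le h⟩

theorem amp_mem_ncBall [OperatorSpace M] {X : Mat n M} {ρ : ℝ} (hρ : 0 < ρ) {k : ℕ+}
    (h : (n : ℕ) ∣ k) : amp k X ∈ ncBall X ρ k := by
  refine ⟨h, ?_⟩
  rwa [sub_self, mnorm_zero]

end Amplification

/-! ### nc functions respect intertwinings -/

section Intertwining

variable {M : Type*} [AddCommGroup M] [Module ℂ M] {W : Type*} [AddCommGroup W] [Module ℂ W]
  {n m : ℕ+}

/-- The invertible matrix with blocks `1`, `T`, `0`, `1`. -/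
def shear (T : Matrix (Fin n) (Fin m) ℂ) : GL (Fin (n + m : ℕ+)) ℂ where
  val := blk 1 T 0 1
  inv := blk 1 (-T) 0 1
  val_inv := by simp [-PNat.add_coe, blk_mul, blk_one]
  inv_val := by simp [-PNat.add_coe, blk_mul, blk_one]

theorem conj_shear_directSum (T : Matrix (Fin n) (Fin m) ℂ) (A : Mat n M) (B : Mat m M) :
    conj (shear T) (directSum A B) = blk A (lmul T B - rmul A T) 0 B := by
  change rmul (lmul (blk 1 T 0 1) (directSum A B)) (blk 1 (-T) 0 1) = _
  simp only [directSum_eq_blk, lmul_blk, rmul_blk, one_lmul, rmul_one, lmul_zero, rmul_zero,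
    zero_lmul, zero_rmul, add_zero, zero_add, rmul_neg, neg_add_eq_sub, neg_zero]

/-- The upper triangular matrix is a shear of `X ⊕ Y`, so similarities and direct sums already
determine the value. For scalar `T` its corner is a multiple of `f(Y) - f(X)`, so bounds on `f`
become bounds on differences. -/
theorem IsNCFunction.map_blk {D : NCSubset M} {f : GradedMap M W} (hf : IsNCFunction D f)
    (hD : IsNCSet D) {X : Mat n M} {Y : Mat m M} (hX : X ∈ D n) (hY : Y ∈ D m)
    (T : Matrix (Fin n) (Fin m) ℂ) (h : blk X (lmul T Y - rmul X T) 0 Y ∈ D (n + m)) :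
    f (n + m) (blk X (lmul T Y - rmul X T) 0 Y) =
      blk (f n X) (lmul T (f m Y) - rmul (f n X) T) 0 (f m Y) := by
  rw [← conj_shear_directSum] at h ⊢
  rw [hf.map_conj _ _ _ (hD _ _ _ _ hX hY) h, hf.map_directSum _ _ _ _ hX hY,
    conj_shear_directSum]

/-- When the corner `TY - XT` vanishes, the shear fixes `X ⊕ Y`, so its image must fix `f(X) ⊕
f(Y)`. No invariance of `D` under similarities is needed, since the conjugated point is `X ⊕ Y`
again. -/
theorem IsNCFunction.map_intertwining {D : NCSubset M} {f : GradedMap M W}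
    (hf : IsNCFunction D f) (hD : IsNCSet D) {X : Mat n M} {Y : Mat m M} (hX : X ∈ D n)
    (hY : Y ∈ D m) {T : Matrix (Fin n) (Fin m) ℂ} (h : rmul X T = lmul T Y) :
    rmul (f n X) T = lmul T (f m Y) := by
  have h1 : blk X (lmul T Y - rmul X T) 0 Y = directSum X Y := by
    rw [h, sub_self, directSum_eq_blk]
  have h2 := hf.map_blk hD hX hY T (h1 ▸ hD _ _ _ _ hX hY)
  rw [h1, hf.map_directSum _ _ _ _ hX hY, directSum_eq_blk, blk_inj] at h2
  exact (sub_eq_zero.mp h2.2.1.symm).symm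

end Intertwining

/-! ### Continuity and differentiability of locally bounded nc functions -/

section Continuity

variable {M : Type*} [AddCommGroup M] [Module ℂ M] [OperatorSpace M]
  {W : Type*} [AddCommGroup W] [Module ℂ W] [OperatorSpace W]

theorem lmul_smul_one_sub {n : ℕ+} (a : ℂ) (X Y : Mat n M) :
    lmul (a • (1 : Matrix (Fin n) (Fin n) ℂ)) Y - rmul X (a • (1 : Matrix (Fin n) (Fin n) ℂ))
      = a • (Y - X) := by
  rw [smul_lmul, rmul_smul, one_lmul, rmul_one, smul_sub]

/-- With `Z` the amplification of `Y`, the matrix with diagonal `X`, `Z` and corner `a(Z - X)` stays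
in the ball on which `f` is bounded by `C`. The corner of its image is `a(f(Z) - f(X))`, so the
difference is at most `C / |a|`. -/
theorem IsNCFunction.exists_lipschitz {D : NCSubset M} {f : GradedMap M W}
    (hf : IsNCFunction D f) (hb : IsLocallyBounded D f) (hD : IsNCSet D)
    (ho : IsUniformlyOpen D) {n : ℕ+} {Y : Mat n M} (hY : Y ∈ D n) :
    ∃ ρ > 0, ∃ C ≥ 0, ∀ (k : ℕ+) (X : Mat k M), X ∈ ncBall Y ρ k →
      X ∈ D k ∧ mnorm (f k X - amp k (f n Y)) ≤ C * mnorm (X - amp k Y) := by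
  obtain ⟨ρ₁, hρ₁, h₁⟩ := ho n Y hY
  obtain ⟨ρ₂, hρ₂, C, hC⟩ := hb n Y hY
  set ρ := min ρ₁ ρ₂ with hρdef
  have hρ : 0 < ρ := lt_min hρ₁ hρ₂
  have hball : ∀ k (X : Mat k M), X ∈ ncBall Y ρ k → X ∈ D k ∧ mnorm (f k X) ≤ C := by
    intro k X hX
    have hXD := h₁ k (ncBall_mono (min_le_left _ _) k hX)
    exact ⟨hXD, hC k X hXD (ncBall_mono (min_le_right _ _) k hX)⟩
  have hC0 : 0 ≤ C := (mnorm_nonneg _).trans (hball n Y (mem_ncBall hρ)).2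
  refine ⟨ρ / 2, by positivity, 2 * C / ρ, by positivity, fun k X hX => ?_⟩
  have hXD := (hball k X (ncBall_mono (by linarith) k hX)).1
  refine ⟨hXD, ?_⟩
  obtain ⟨hdvd, hlt⟩ := hX
  have hYk := amp_mem hD hY hdvd
  rw [← hf.map_amp hD hY hdvd]
  set Z := amp k Y with hZ
  set δ := mnorm (X - Z) with hδ
  -- The scaling factor below divides by the distance, so distance zero is treated apart.
  rcases (mnorm_nonneg (X - Z)).eq_or_lt with h0 | hpos
  · have : X = Z := sub_eq_zero.mp (eq_zero_of_mnorm _ h0.symm)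
    rw [this, sub_self, mnorm_zero]
    exact mul_nonneg (by positivity) (hδ ▸ h0.le)
  rw [← hδ] at hpos
  -- The factor stretches the corner to norm `ρ / 2`. The diagonal deviation is `δ < ρ / 2`, so the
  -- two together stay below `ρ`.
  set a : ℂ := ((ρ / (2 * δ) : ℝ) : ℂ) with ha
  have hna : ‖a‖ = ρ / (2 * δ) := by
    rw [ha, Complex.norm_real, Real.norm_of_nonneg (by positivity)]
  have hmem : blk X (a • (Z - X)) 0 Z ∈ ncBall Y ρ (k + k) := by
    refine ⟨by rw [PNat.add_coe]; exact dvd_add hdvd hdvd, ?_⟩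
    have h1 : blk X (a • (Z - X)) 0 Z - amp (k + k) Y
        = directSum (X - Z) 0 + blk 0 (a • (Z - X)) 0 0 := by
      rw [amp_add hdvd, ← hZ, directSum_eq_blk, directSum_eq_blk, blk_sub, blk_add]
      simp only [sub_zero, add_zero, zero_add, sub_self]
    rw [h1]
    refine (mnorm_add_le _ _).trans_lt ?_
    rw [mnorm_directSum, mnorm_zero, max_eq_left (mnorm_nonneg _)]
    have h2 := mnorm_blk_corner_le (a • (Z - X))
    rw [mnorm_smul, mnorm_sub_comm, ← hδ, hna] at h2
    have h3 : ρ / (2 * δ) * δ = ρ / 2 := by field_simp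
    linarith
  obtain ⟨hmD, hmC⟩ := hball _ _ hmem
  have key := hf.map_blk hD hXD hYk (a • (1 : Matrix (Fin k) (Fin k) ℂ))
    (by rwa [lmul_smul_one_sub])
  rw [lmul_smul_one_sub, lmul_smul_one_sub] at key
  rw [key] at hmC
  have h4 := (mnorm_corner_le (f k X) (a • (f k Z - f k X)) 0 (f k Z)).trans hmC
  rw [mnorm_smul, mnorm_sub_comm, hna] at h4
  rw [div_mul_eq_mul_div, le_div_iff₀ hρ]
  rw [div_mul_eq_mul_div, div_le_iff₀ (by positivity)] at h4
  linarith

/-- A uniformly locally bounded nc function on a uniformly open nc set is Gâteaux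
differentiable. -/
theorem IsNCFunction.isGDifferentiable {D : NCSubset M} {f : GradedMap M W}
    (hf : IsNCFunction D f) (hb : IsLocallyBounded D f) (hD : IsNCSet D)
    (ho : IsUniformlyOpen D) : IsGDifferentiable D f := by
  intro n X hX Z
  obtain ⟨ρ₁, hρ₁, h₁⟩ := ho n X hX
  -- Small enough that the corner `s Z` keeps `P` inside the ball around `X`. The `+ 1` covers `Z =
  -- 0`.
  set s : ℝ := ρ₁ / (mnorm Z + 1) with hs
  have hZ1 : 0 < mnorm Z + 1 := by linarith [mnorm_nonneg Z]
  have hs0 : 0 < s := by positivity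
  have hsC : (s : ℂ) ≠ 0 := by exact_mod_cast hs0.ne'
  have hns : ‖(s : ℂ)‖ = s := by rw [Complex.norm_real, Real.norm_of_nonneg hs0.le]
  set P : Mat (n + n) M := blk X ((s : ℂ) • Z) 0 X with hP
  have hPD : P ∈ D (n + n) := by
    refine h₁ _ ⟨by simp, ?_⟩
    have h1 : P - amp (n + n) X = blk 0 ((s : ℂ) • Z) 0 0 := by
      rw [amp_add dvd_rfl, amp_self, directSum_eq_blk, hP, blk_sub]
      simp only [sub_self, sub_zero]
    rw [h1]
    refine (mnorm_blk_corner_le _).trans_lt ?_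
    rw [mnorm_smul, hns, hs, div_mul_eq_mul_div, div_lt_iff₀ hZ1]
    nlinarith
  obtain ⟨ρ₂, hρ₂, C, hC, hlip⟩ := hf.exists_lipschitz hb hD ho hPD
  set G := f (n + n) P with hG
  -- The derivative is the rescaled corner of the value of `f` at the block matrix with diagonal
  -- `X`, `X` and corner `s Z`.
  set L : Mat n W := (s : ℂ)⁻¹ • rmul (lmul (blkRow 1 0) G) (blkCol 0 1) with hL
  refine ⟨L, ?_⟩
  have bound : ∀ᶠ t : ℂ in 𝓝[≠] 0,
      mnorm (t⁻¹ • (f n (X + t • Z) - f n X) - L) ≤ s⁻¹ * (C * mnorm Z) * ‖t‖ := by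
    have hsmall : ∀ᶠ t : ℂ in 𝓝[≠] 0, ‖t‖ * (mnorm Z + 1) < min ρ₁ ρ₂ := by
      apply eventually_nhdsWithin_of_eventually_nhds
      have : Tendsto (fun t : ℂ => ‖t‖ * (mnorm Z + 1)) (𝓝 0) (𝓝 (‖(0 : ℂ)‖ * (mnorm Z + 1))) :=
        (continuous_norm.tendsto 0).mul_const _
      rw [norm_zero, zero_mul] at this
      exact this.eventually (gt_mem_nhds (lt_min hρ₁ hρ₂))
    filter_upwards [hsmall, self_mem_nhdsWithin] with t ht ht0
    have ht0 : t ≠ 0 := ht0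
    have htZ : ‖t‖ * mnorm Z < min ρ₁ ρ₂ := by
      have := norm_nonneg t
      linarith
    have hX' : X + t • Z ∈ D n := by
      refine h₁ _ ⟨dvd_rfl, ?_⟩
      rw [amp_self, add_sub_cancel_left, mnorm_smul]
      exact htZ.trans_le (min_le_left _ _)
    have hdiff : blk (X + t • Z) ((s : ℂ) • Z) 0 X - amp (n + n) P = directSum (t • Z) 0 := by
      rw [amp_self, hP, blk_sub, directSum_eq_blk]
      simp only [sub_self, add_sub_cancel_left]
    have hnorm : mnorm (blk (X + t • Z) ((s : ℂ) • Z) 0 X - amp (n + n) P) = ‖t‖ * mnorm Z := by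
      rw [hdiff, mnorm_directSum, mnorm_zero, max_eq_left (mnorm_nonneg _), mnorm_smul]
    obtain ⟨hQD, hQ⟩ := hlip (n + n) (blk (X + t • Z) ((s : ℂ) • Z) 0 X)
      ⟨dvd_rfl, hnorm.trans_lt (htZ.trans_le (min_le_right _ _))⟩
    have hcorner : (-(s : ℂ) / t) • (X - (X + t • Z)) = (s : ℂ) • Z := by
      rw [sub_add_cancel_left, smul_neg, smul_smul, div_mul_cancel₀ _ ht0, neg_smul, neg_neg]
    -- The scalar `-s/t` turns the difference of the diagonal entries into exactly `s Z`, so the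
    -- corner of the value is `s` times the difference quotient. Lipschitz continuity at `P` then
    -- compares it with the corner at `t = 0`.
    have key := hf.map_blk hD hX' hX ((-(s : ℂ) / t) • (1 : Matrix (Fin n) (Fin n) ℂ))
      (by rwa [lmul_smul_one_sub, hcorner])
    rw [lmul_smul_one_sub, lmul_smul_one_sub, hcorner] at key
    rw [key, hnorm, amp_self] at hQ
    have h5 := (mnorm_lmul_rmul_le (opNorm_blkRow_one_zero_le (n := n) (m := n))
      (opNorm_blkCol_zero_one_le (n := n) (m := n))).trans hQ
    rw [lmul_sub, sub_rmul, lmul_blkRow_blk, rmul_blkRow_blkCol] at h5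
    simp only [one_lmul, zero_lmul, rmul_zero, rmul_one, add_zero, zero_add] at h5
    have h6 : t⁻¹ • (f n (X + t • Z) - f n X) - L = (s : ℂ)⁻¹ •
        ((-(s : ℂ) / t) • (f n X - f n (X + t • Z)) - rmul (lmul (blkRow 1 0) G) (blkCol 0 1)) := by
      rw [hL, smul_sub (s : ℂ)⁻¹, smul_smul, ← neg_sub (f n (X + t • Z)) (f n X), smul_neg, ← neg_smul]
      congr 2
      field_simp
    rw [h6, mnorm_smul, norm_inv, hns, mul_assoc]
    exact mul_le_mul_of_nonneg_left (h5.trans (by linarith)) (by positivity)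
  refine squeeze_zero' (Eventually.of_forall fun t => mnorm_nonneg _) bound ?_
  have : Tendsto (fun t : ℂ => s⁻¹ * (C * mnorm Z) * ‖t‖) (𝓝[≠] 0)
      (𝓝 (s⁻¹ * (C * mnorm Z) * ‖(0 : ℂ)‖)) :=
    ((continuous_norm.tendsto 0).const_mul _).mono_left nhdsWithin_le_nhds
  simpa using this

theorem IsNCFunction.isUniformlyAnalytic {D : NCSubset M} {f : GradedMap M W}
    (hf : IsNCFunction D f) (hb : IsLocallyBounded D f) (hD : IsNCSet D)
    (ho : IsUniformlyOpen D) : IsUniformlyAnalytic D f :=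
  ⟨hf, hb, hf.isGDifferentiable hb hD ho⟩

end Continuity

/-! ### Rows of matrices acting on tuples of matrices -/

section Act

variable {V : Type*} [AddCommGroup V] [Module ℂ V] {r : ℕ}
variable {k l m n p : Type*} [Fintype l] [Fintype n]

/-- The block `a` of the row `A`. -/
def coord (a : Fin r) (A : Matrix k l (Fin r → ℂ)) : Matrix k l ℂ := A.map fun x => x a

theorem coord_ext {A B : Matrix k l (Fin r → ℂ)} (h : ∀ a, coord a A = coord a B) : A = B := by
  ext i j a
  exact congrFun (congrFun (h a) i) j

theorem coord_lmul (a : Fin r) (S : Matrix k l ℂ) (A : Matrix l p (Fin r → ℂ)) :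
    coord a (lmul S A) = S * coord a A := by
  rw [← lmul_eq_mul]
  exact lmul_map S A (LinearMap.proj (R := ℂ) (φ := fun _ : Fin r => ℂ) a)

theorem coord_rmul (a : Fin r) (A : Matrix k l (Fin r → ℂ)) (S : Matrix l p ℂ) :
    coord a (rmul A S) = coord a A * S := by
  rw [← rmul_eq_mul]
  exact rmul_map A S (LinearMap.proj (R := ℂ) (φ := fun _ : Fin r => ℂ) a)

/-- The sum of the products `A_a v_a` for a row `A = [A₁ ⋯ A_r]`. -/
def act (A : Matrix k l (Fin r → ℂ)) (v : Fin r → Matrix l p V) : Matrix k p V :=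
  ∑ a, lmul (coord a A) (v a)

theorem act_add (A B : Matrix k l (Fin r → ℂ)) (v : Fin r → Matrix l p V) :
    act (A + B) v = act A v + act B v := by
  rw [act, act, act, ← Finset.sum_add_distrib]
  exact Finset.sum_congr rfl fun a _ => add_lmul (coord a A) (coord a B) (v a)

theorem act_smul (c : ℂ) (A : Matrix k l (Fin r → ℂ)) (v : Fin r → Matrix l p V) :
    act (c • A) v = c • act A v := by
  rw [act, act, Finset.smul_sum]
  exact Finset.sum_congr rfl fun a _ => smul_lmul c (coord a A) (v a)

/-- The map `A ↦ ∑ A_a v_a` as a linear map. -/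
def actLinear (v : Fin r → Matrix l p V) : Matrix k l (Fin r → ℂ) →ₗ[ℂ] Matrix k p V where
  toFun A := act A v
  map_add' A B := act_add A B v
  map_smul' c A := act_smul c A v

theorem act_zero (v : Fin r → Matrix l p V) : act (0 : Matrix k l (Fin r → ℂ)) v = 0 :=
  (actLinear v).map_zero

theorem act_lmul (S : Matrix m l ℂ) (A : Matrix l n (Fin r → ℂ)) (v : Fin r → Matrix n p V) :
    act (lmul S A) v = lmul S (act A v) := by
  simp only [act, lmul_sum, lmul_lmul, coord_lmul]

theorem act_rmul (A : Matrix k l (Fin r → ℂ)) (S : Matrix l n ℂ) (v : Fin r → Matrix n p V) :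
    act (rmul A S) v = act A fun a => lmul S (v a) := by
  simp only [act, lmul_lmul, coord_rmul]

theorem rmul_act (A : Matrix k l (Fin r → ℂ)) (v : Fin r → Matrix l n V) (S : Matrix n p ℂ) :
    rmul (act A v) S = act A fun a => rmul (v a) S := by
  simp only [act, sum_rmul, lmul_rmul]

theorem act_sub_right (A : Matrix k l (Fin r → ℂ)) (v w : Fin r → Matrix l p V) :
    act A v - act A w = act A fun a => v a - w a := by
  simp only [act, lmul_sub, Finset.sum_sub_distrib]

theorem sum_blk {n m n' m' : ℕ+} {ι : Type*} (s : Finset ι) (A : ι → Matrix (Fin n) (Fin n') V)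
    (B : ι → Matrix (Fin n) (Fin m') V) (C : ι → Matrix (Fin m) (Fin n') V)
    (D : ι → Matrix (Fin m) (Fin m') V) : ∑ a ∈ s, blk (A a) (B a) (C a) (D a) =
      blk (∑ a ∈ s, A a) (∑ a ∈ s, B a) (∑ a ∈ s, C a) (∑ a ∈ s, D a) := by
  classical
  induction s using Finset.induction_on with
  | empty =>
    simp only [Finset.sum_empty, blk, Matrix.fromBlocks_zero]
    rfl
  | insert a s ha ih => simp only [Finset.sum_insert ha, ih, blk_add]

theorem act_blk {n m : ℕ+} (A : Mat n (Fin r → ℂ)) (B : Matrix (Fin n) (Fin m) (Fin r → ℂ))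
    (C : Matrix (Fin m) (Fin n) (Fin r → ℂ)) (D : Mat m (Fin r → ℂ)) (v : Fin r → Mat n V)
    (w : Fin r → Mat m V) : act (blk A B C D) (fun a => directSum (v a) (w a)) =
      blk (act A v) (act B w) (act C v) (act D w) := by
  have h : ∀ a, coord a (blk A B C D) = blk (coord a A) (coord a B) (coord a C) (coord a D) :=
    fun a => blk_map (LinearMap.proj (R := ℂ) (φ := fun _ : Fin r => ℂ) a) A B C D
  simp only [act, h, directSum_eq_blk, lmul_blk, lmul_zero, add_zero, zero_add, sum_blk]

theorem act_directSum {n m : ℕ+} (A : Mat n (Fin r → ℂ)) (B : Mat m (Fin r → ℂ))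
    (v : Fin r → Mat n V) (w : Fin r → Mat m V) :
    act (directSum A B) (fun a => directSum (v a) (w a)) = directSum (act A v) (act B w) := by
  rw [directSum_eq_blk A B, act_blk, act_zero, act_zero, directSum_eq_blk]

theorem act_conj {n : ℕ+} (S : GL (Fin n) ℂ) (A : Mat n (Fin r → ℂ)) (v : Fin r → Mat n V) :
    act (conj S A) (fun a => conj S (v a)) = conj S (act A v) := by
  have h : ((S⁻¹ : GL (Fin n) ℂ) : Matrix (Fin n) (Fin n) ℂ) * (S : Matrix (Fin n) (Fin n) ℂ) = 1 :=
    S.inv_mul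
  simp only [conj]
  rw [act_rmul]
  simp only [lmul_rmul, lmul_lmul, h, one_lmul]
  rw [act_lmul, ← lmul_rmul, rmul_act]

/-- The row with the block `1` at the place `a` and with the other blocks `0`. -/
def unitRow (n : ℕ+) (a : Fin r) : Mat n (Fin r → ℂ) :=
  Matrix.of fun i j => if i = j then Pi.single a 1 else 0

theorem coord_unitRow {n : ℕ+} (a b : Fin r) :
    coord b (unitRow n a) = if b = a then 1 else 0 := by
  ext i j
  by_cases h : i = j <;> by_cases h' : b = a <;>
    simp [coord, unitRow, h, h', Matrix.one_apply]

theorem act_unitRow {n : ℕ+} (a : Fin r) (v : Fin r → Matrix (Fin n) p V) :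
    act (unitRow n a) v = v a := by
  rw [act, Finset.sum_eq_single a]
  · rw [coord_unitRow, if_pos rfl, one_lmul]
  · intro b _ hb
    rw [coord_unitRow, if_neg hb, zero_lmul]
  · simp

theorem act_row_unitRow {n : ℕ+} (A : Matrix k (Fin n) (Fin r → ℂ)) :
    act A (fun a => unitRow n a) = A := by
  ext i j b
  simp [act, Matrix.sum_apply, lmul_apply, unitRow, coord, Pi.single_apply]

theorem unitRow_directSum {n m : ℕ+} (a : Fin r) :
    unitRow (n + m) a = directSum (unitRow n a) (unitRow m a) := by
  ext i j
  obtain ⟨i, rfl⟩ := (sumEquiv n m).surjective i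
  obtain ⟨j, rfl⟩ := (sumEquiv n m).surjective j
  rw [directSum_apply]
  rcases i with i | i <;> rcases j with j | j <;>
    simp [-PNat.add_coe, unitRow, EmbeddingLike.apply_eq_iff_eq]

theorem lmul_unitRow {n : ℕ+} (S : Matrix (Fin n) (Fin n) ℂ) (a : Fin r) :
    lmul S (unitRow n a) = rmul (unitRow n a) S := by
  refine coord_ext fun b => ?_
  rw [coord_lmul, coord_rmul, coord_unitRow]
  split_ifs <;> simp

theorem conj_unitRow {n : ℕ+} (S : GL (Fin n) ℂ) (a : Fin r) :
    conj S (unitRow n a) = unitRow n a := by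
  have h : (S : Matrix (Fin n) (Fin n) ℂ) * ((S⁻¹ : GL (Fin n) ℂ) : Matrix (Fin n) (Fin n) ℂ) = 1 :=
    S.mul_inv
  rw [conj, lmul_unitRow, rmul_rmul, h, rmul_one]

theorem amp_unitRow {n k : ℕ+} (h : (n : ℕ) ∣ k) (a : Fin r) :
    amp k (unitRow n a) = unitRow k a := by
  obtain ⟨q, rfl⟩ := exists_eq_mul_of_dvd h
  clear h
  induction q using PNat.recOn with
  | one => rw [mul_one, amp_self]
  | succ q ih => rw [mul_add, mul_one, amp_add (by simp), amp_self, ih, unitRow_directSum]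

theorem opNorm_coord_le {n : ℕ+} (A : Mat n (Fin r → ℂ)) (a : Fin r) :
    opNorm (coord a A) ≤ mnorm A := by
  have h := norm_le_pi_norm (fun a : Fin r => opNorm (A.map fun v => v a)) a
  rw [Real.norm_of_nonneg (opNorm_nonneg _)] at h
  exact h

theorem mnorm_row_le {n : ℕ+} {A : Mat n (Fin r → ℂ)} {c : ℝ} (hc : 0 ≤ c)
    (h : ∀ a, opNorm (coord a A) ≤ c) : mnorm A ≤ c := by
  refine (pi_norm_le_iff_of_nonneg hc).2 fun a => ?_
  rw [Real.norm_of_nonneg (opNorm_nonneg _)]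
  exact h a

theorem mnorm_act_le {n : ℕ+} [OperatorSpace V] (A : Mat n (Fin r → ℂ)) (v : Fin r → Mat n V) :
    mnorm (act A v) ≤ mnorm A * ∑ a, mnorm (v a) := by
  rw [Finset.mul_sum]
  refine (mnorm_sum_le _ _).trans (Finset.sum_le_sum fun a _ => ?_)
  exact (mnorm_lmul_le _ _).trans
    (mul_le_mul_of_nonneg_right (opNorm_coord_le A a) (mnorm_nonneg _))

theorem mnorm_amp [OperatorSpace V] {n k : ℕ+} (h : (n : ℕ) ∣ k) (A : Mat n V) :
    mnorm (amp k A) = mnorm A := by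
  obtain ⟨q, rfl⟩ := exists_eq_mul_of_dvd h
  clear h
  induction q using PNat.recOn with
  | one => rw [mul_one, amp_self]
  | succ q ih => rw [mul_add, mul_one, amp_add (by simp), amp_self, mnorm_directSum, ih, max_self]

end Act

/-! ### A lower bound for amplifications of injective row maps -/

section LowerBound

variable {V : Type*} [AddCommGroup V] [Module ℂ V] [OperatorSpace V] {r : ℕ} {n : ℕ+}

/-- The normed group of `n × n` matrices over an operator space. -/
noncomputable abbrev matNormedAddCommGroup (V : Type*) [AddCommGroup V] [Module ℂ V]
    [OperatorSpace V] (n : ℕ+) : NormedAddCommGroup (Mat n V) :=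
  AddGroupNorm.toNormedAddCommGroup
    { toFun := mnorm
      map_zero' := mnorm_zero
      add_le' := mnorm_add_le
      neg' := mnorm_neg
      eq_zero_of_map_eq_zero' := eq_zero_of_mnorm }

/-- The space of rows is finite-dimensional, so an injective linear map on it is bounded below,
however large `V` may be. -/
theorem exists_mnorm_le_mnorm_act {v : Fin r → Mat n V}
    (hv : ∀ A : Mat n (Fin r → ℂ), act A v = 0 → A = 0) :
    ∃ C ≥ 0, ∀ A : Mat n (Fin r → ℂ), mnorm A ≤ C * mnorm (act A v) := by
  let := matNormedAddCommGroup V n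
  let := matNormedAddCommGroup (Fin r → ℂ) n
  let : NormedSpace ℂ (Mat n V) := ⟨fun c A => (mnorm_smul c A).le⟩
  let : NormedSpace ℂ (Mat n (Fin r → ℂ)) := ⟨fun c A => (mnorm_smul c A).le⟩
  have hfin : FiniteDimensional ℂ (Mat n (Fin r → ℂ)) :=
    inferInstanceAs (FiniteDimensional ℂ (Fin n → Fin n → Fin r → ℂ))
  obtain ⟨K, -, hK⟩ := LinearMap.exists_antilipschitzWith
    (actLinear v : Mat n (Fin r → ℂ) →ₗ[ℂ] Mat n V) (LinearMap.ker_eq_bot'.mpr hv)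
  refine ⟨K, K.2, fun A => ?_⟩
  exact hK.le_mul_norm (map_zero _) A

theorem norm_entry_le_opNorm {m n : Type*} [Fintype m] [Fintype n] [DecidableEq n]
    (A : Matrix m n ℂ) (i : m) (j : n) : ‖A i j‖ ≤ opNorm A := by
  have h := opNorm_bound A (Pi.single j 1)
  have h2 : ∑ x, ‖(Pi.single j (1 : ℂ) : n → ℂ) x‖ ^ 2 = 1 := by
    rw [Finset.sum_eq_single j] <;> simp +contextual
  rw [h2, mul_one] at h
  refine (sq_le_sq₀ (norm_nonneg _) (opNorm_nonneg _)).mp (le_trans ?_ h)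
  simp only [Matrix.mulVec_single_one]
  exact Finset.single_le_sum (f := fun i => ‖A i j‖ ^ 2) (fun _ _ => sq_nonneg _)
    (Finset.mem_univ i)

theorem opNorm_row_le {m n : Type*} [Fintype m] [Fintype n] [DecidableEq m] [DecidableEq n] (i : m)
    (y : n → ℂ) {c : ℝ} (hc : 0 ≤ c) (hy : ∑ j, ‖y j‖ ^ 2 ≤ c ^ 2) :
    opNorm (Matrix.of fun (k : m) j => if k = i then y j else 0) ≤ c := by
  refine opNorm_le hc fun x => ?_
  rw [Finset.sum_eq_single i]
  · simp only [Matrix.mulVec, dotProduct, Matrix.of_apply, if_true]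
    have h1 : ‖∑ j, y j * x j‖ ≤ ∑ j, ‖y j‖ * ‖x j‖ :=
      (norm_sum_le _ _).trans (by simp)
    refine (pow_le_pow_left₀ (norm_nonneg _) h1 2).trans ?_
    refine (Finset.sum_mul_sq_le_sq_mul_sq _ _ _).trans ?_
    exact mul_le_mul_of_nonneg_right hy (Finset.sum_nonneg fun _ _ => sq_nonneg _)
  · intro k _ hk
    simp [Matrix.mulVec, dotProduct, hk]
  · simp

/-- Let `y = Bx`. Choose `X` with one nonzero row, the conjugate of `y`, and split `x` into `n`
vectors `ξ_j`, collecting the `j`th coordinates of its `q` groups. Then `‖y‖²` is a sum of `n`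
entries of compressions, each at most `κ ‖y‖ ‖x‖`. The factor `n` does not depend on `q`. -/
theorem opNorm_le_of_compressions {q : ℕ+} {B : Mat (n * q) ℂ} {κ : ℝ} (hκ : 0 ≤ κ)
    (h : ∀ (X : Matrix (Fin n) (Fin (n * q : ℕ+)) ℂ) (ξ : Fin q → ℂ) (i j : Fin n),
      ‖(X * B * ampCol n ξ) i j‖ ≤ κ * opNorm X * opNorm (ampCol n ξ)) :
    opNorm B ≤ n * κ := by
  refine opNorm_le (by positivity) fun x => ?_
  set y := B.mulVec x with hy
  set a := ∑ i, ‖y i‖ ^ 2 with ha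
  set b := ∑ i, ‖x i‖ ^ 2 with hb
  have ha0 : 0 ≤ a := Finset.sum_nonneg fun _ _ => sq_nonneg _
  have hb0 : 0 ≤ b := Finset.sum_nonneg fun _ _ => sq_nonneg _
  let i₀ : Fin n := ⟨0, n.pos⟩
  let X : Matrix (Fin n) (Fin (n * q : ℕ+)) ℂ :=
    Matrix.of fun k j => if k = i₀ then star (y j) else 0
  have hX : opNorm X ≤ √a := by
    refine opNorm_row_le i₀ _ (Real.sqrt_nonneg _) ?_
    rw [Real.sq_sqrt ha0]
    simp [-PNat.mul_coe, ha]
  let ξ : Fin n → Fin q → ℂ := fun j c => x (ampEquiv n q (j, c))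
  have hξ : ∀ j, opNorm (ampCol n (ξ j)) ≤ √b := by
    intro j
    refine opNorm_ampCol_le _ (Real.sqrt_nonneg _) ?_
    rw [Real.sq_sqrt hb0, hb, ← Equiv.sum_comp (ampEquiv n q), Fintype.sum_prod_type]
    exact Finset.single_le_sum (f := fun j => ∑ c, ‖x (ampEquiv n q (j, c))‖ ^ 2)
      (fun _ _ => Finset.sum_nonneg fun _ _ => sq_nonneg _) (Finset.mem_univ j)
  have hx : x = ∑ j, (ampCol n (ξ j)).mulVec (Pi.single j 1) := by
    ext i
    obtain ⟨⟨i, c⟩, rfl⟩ := (ampEquiv n q).surjective i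
    simp only [Finset.sum_apply, ampCol_mulVec, Pi.single_apply, ξ, mul_ite, mul_one, mul_zero,
      Finset.sum_ite_eq, Finset.mem_univ, if_true]
  have hsum : ((a : ℝ) : ℂ) = ∑ j, (X * B * ampCol n (ξ j)) i₀ j := by
    have h1 : ((a : ℝ) : ℂ) = (X.mulVec y) i₀ := by
      simp only [ha, Matrix.mulVec, dotProduct, X, Matrix.of_apply, if_true]
      push_cast
      refine Finset.sum_congr rfl fun i _ => ?_
      rw [Complex.star_def, Complex.conj_mul']
    rw [h1, hy, Matrix.mulVec_mulVec]
    conv_lhs => rw [hx]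
    rw [Matrix.mulVec_sum, Finset.sum_apply]
    refine Finset.sum_congr rfl fun j _ => ?_
    rw [Matrix.mulVec_mulVec, Matrix.mulVec_single_one]
    rfl
  have hle : a ≤ n * (κ * √a * √b) := by
    have h2 : ‖((a : ℝ) : ℂ)‖ ≤ ∑ _j : Fin n, κ * √a * √b := by
      rw [hsum]
      refine (norm_sum_le _ _).trans (Finset.sum_le_sum fun j _ => (h X (ξ j) i₀ j).trans ?_)
      exact mul_le_mul (mul_le_mul_of_nonneg_left hX hκ) (hξ j) (opNorm_nonneg _) (by positivity)
    rw [Complex.norm_real, Real.norm_of_nonneg ha0] at h2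
    simpa using h2
  have hsa : √a ≤ n * κ * √b := by
    rcases (Real.sqrt_nonneg a).eq_or_lt with h0 | hpos
    · rw [← h0]
      positivity
    · refine le_of_mul_le_mul_right ?_ hpos
      rw [Real.mul_self_sqrt ha0]
      linarith
  have := pow_le_pow_left₀ (Real.sqrt_nonneg a) hsa 2
  rwa [mul_pow, Real.sq_sqrt ha0, Real.sq_sqrt hb0] at this

/-- Compressing a row to level `n` by `X` on the left and `ampCol n ξ` on the right commutes with
the row map, as the column passes through the amplified frame. The bound at level `n` thus controls
all compressions of each block of the row. -/
theorem exists_mnorm_le_mnorm_act_amp {v : Fin r → Mat n V}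
    (hv : ∀ A : Mat n (Fin r → ℂ), act A v = 0 → A = 0) :
    ∃ C ≥ 0, ∀ (k : ℕ+), (n : ℕ) ∣ k → ∀ A : Mat k (Fin r → ℂ),
      mnorm A ≤ C * mnorm (act A fun a => amp k (v a)) := by
  obtain ⟨C, hC, h⟩ := exists_mnorm_le_mnorm_act hv
  refine ⟨n * C, by positivity, fun k hk A => ?_⟩
  obtain ⟨q, rfl⟩ := exists_eq_mul_of_dvd hk
  simp only [amp_mul]
  set P := act A fun a => ampRect q (v a) with hP
  have hP0 := mnorm_nonneg P
  refine mnorm_row_le (by positivity) fun b => ?_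
  rw [mul_assoc]
  refine opNorm_le_of_compressions (by positivity) fun X ξ i j => ?_
  have h1 := h (rmul (lmul X A) (ampCol n ξ))
  have h2 : act (rmul (lmul X A) (ampCol n ξ)) v = rmul (lmul X P) (ampCol n ξ) := by
    rw [act_rmul, act_lmul, hP, ← lmul_rmul, rmul_act]
    simp only [rmul_ampRect_ampCol]
  rw [h2] at h1
  have h3 := h1.trans (mul_le_mul_of_nonneg_left (mnorm_lmul_rmul X P (ampCol n ξ)) hC)
  have h4 := (norm_entry_le_opNorm _ i j).trans ((opNorm_coord_le _ b).trans h3)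
  rw [coord_rmul, coord_lmul] at h4
  linarith

end LowerBound

/-! ### Points of trivial bundles -/

section Pair

variable {M : Type*} [AddCommGroup M] [Module ℂ M] {V : Type*} [AddCommGroup V] [Module ℂ V]
  {n m k : ℕ+}

theorem base_pair (Z : Mat n M) (A : Mat n V) : base (pair Z A) = Z := rfl

theorem fib_pair (Z : Mat n M) (A : Mat n V) : fib (pair Z A) = A := rfl

theorem pair_base_fib (P : Mat n (M × V)) : pair (base P) (fib P) = P := rfl

theorem base_conj (S : GL (Fin n) ℂ) (P : Mat n (M × V)) : base (conj S P) = conj S (base P) := by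
  rw [conj, conj]
  exact (rmul_map _ _ (LinearMap.fst ℂ M V)).trans
    (congrArg (fun X => rmul X _) (lmul_map _ _ (LinearMap.fst ℂ M V)))

theorem fib_conj (S : GL (Fin n) ℂ) (P : Mat n (M × V)) : fib (conj S P) = conj S (fib P) := by
  rw [conj, conj]
  exact (rmul_map _ _ (LinearMap.snd ℂ M V)).trans
    (congrArg (fun X => rmul X _) (lmul_map _ _ (LinearMap.snd ℂ M V)))

theorem base_directSum (P : Mat n (M × V)) (Q : Mat m (M × V)) :
    base (directSum P Q) = directSum (base P) (base Q) :=
  blk_map (LinearMap.fst ℂ M V) P 0 0 Q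

theorem fib_directSum (P : Mat n (M × V)) (Q : Mat m (M × V)) :
    fib (directSum P Q) = directSum (fib P) (fib Q) :=
  blk_map (LinearMap.snd ℂ M V) P 0 0 Q

theorem conj_pair (S : GL (Fin n) ℂ) (Z : Mat n M) (A : Mat n V) :
    conj S (pair Z A) = pair (conj S Z) (conj S A) := by
  rw [← pair_base_fib (conj S (pair Z A)), base_conj, fib_conj, base_pair, fib_pair]

theorem directSum_pair (Z : Mat n M) (A : Mat n V) (Z' : Mat m M) (A' : Mat m V) :
    directSum (pair Z A) (pair Z' A') = pair (directSum Z Z') (directSum A A') := by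
  rw [← pair_base_fib (directSum (pair Z A) _), base_directSum, fib_directSum]
  rfl

theorem base_amp (P : Mat n (M × V)) : base (amp k P) = amp k (base P) := by
  ext i j
  simp only [base, amp, Matrix.map_apply, Matrix.of_apply]
  split_ifs <;> rfl

theorem fib_amp (P : Mat n (M × V)) : fib (amp k P) = amp k (fib P) := by
  ext i j
  simp only [fib, amp, Matrix.map_apply, Matrix.of_apply]
  split_ifs <;> rfl

theorem mnorm_prod [OperatorSpace M] [OperatorSpace V] (P : Mat n (M × V)) :
    mnorm P = max (mnorm (base P)) (mnorm (fib P)) := rfl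

theorem mnorm_sub_amp_prod [OperatorSpace M] [OperatorSpace V] (P : Mat k (M × V))
    (Q : Mat n (M × V)) : mnorm (P - amp k Q) =
      max (mnorm (base P - amp k (base Q))) (mnorm (fib P - amp k (fib Q))) := by
  rw [mnorm_prod, ← base_amp, ← fib_amp]
  rfl

theorem base_mem_ncBall [OperatorSpace M] [OperatorSpace V] {P : Mat k (M × V)}
    {Q : Mat n (M × V)} {ρ : ℝ} (h : P ∈ ncBall Q ρ k) : base P ∈ ncBall (base Q) ρ k :=
  ⟨h.1, (le_max_left _ _).trans_lt (mnorm_sub_amp_prod P Q ▸ h.2)⟩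

theorem fib_mem_ncBall [OperatorSpace M] [OperatorSpace V] {P : Mat k (M × V)}
    {Q : Mat n (M × V)} {ρ : ℝ} (h : P ∈ ncBall Q ρ k) : fib P ∈ ncBall (fib Q) ρ k :=
  ⟨h.1, (le_max_right _ _).trans_lt (mnorm_sub_amp_prod P Q ▸ h.2)⟩

theorem pair_mem_ncBall [OperatorSpace M] [OperatorSpace V] {Z : Mat k M} {A : Mat k V}
    {Q : Mat n (M × V)} {ρ : ℝ} (h : Z ∈ ncBall (base Q) ρ k) (h' : A ∈ ncBall (fib Q) ρ k) :
    pair Z A ∈ ncBall Q ρ k :=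
  ⟨h.1, by rw [mnorm_sub_amp_prod]; exact max_lt h.2 h'.2⟩

theorem mnorm_le_of_mem_ncBall [OperatorSpace V] {A : Mat n V} {B : Mat k V} {ρ : ℝ}
    (h : B ∈ ncBall A ρ k) : mnorm B ≤ ρ + mnorm A := by
  have h1 := mnorm_add_le (B - amp k A) (amp k A)
  rw [sub_add_cancel, mnorm_amp h.1] at h1
  linarith [h.2]

theorem isNCSet_trivialBundle {U : NCSubset M} (hU : IsNCSet U) :
    IsNCSet (trivialBundle V U) := by
  intro n m P Q hP hQ
  change base (directSum P Q) ∈ U (n + m)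
  rw [base_directSum]
  exact hU _ _ _ _ hP hQ

theorem isUniformlyOpen_trivialBundle [OperatorSpace M] [OperatorSpace V] {U : NCSubset M}
    (hU : IsUniformlyOpen U) : IsUniformlyOpen (trivialBundle V U) := by
  intro n P hP
  obtain ⟨ρ, hρ, h⟩ := hU n (base P) hP
  exact ⟨ρ, hρ, fun k Q hQ => h k (base_mem_ncBall hQ)⟩

end Pair

/-- Stated through a filter instead of a minimum, so that the empty family, which occurs for rank
`0`, is no exception. -/
theorem exists_pos_forall_le {ι : Type*} [Finite ι] (ρ : ι → ℝ) (h : ∀ a, 0 < ρ a) :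
    ∃ ε > 0, ∀ a, ε ≤ ρ a := by
  have h1 : ∀ᶠ ε in 𝓝[>] (0 : ℝ), ∀ a, ε ≤ ρ a :=
    eventually_all.mpr fun a =>
      ((gt_mem_nhds (h a)).mono fun _ hx => le_of_lt hx).filter_mono nhdsWithin_le_nhds
  obtain ⟨ε, h2, h3⟩ := (h1.and self_mem_nhdsWithin).exists
  exact ⟨ε, h3, h2⟩

/-! ### Frames -/

section Frames

variable {d r : ℕ} {V : Type*} [AddCommGroup V] [Module ℂ V] [OperatorSpace V]

/-- `v` is an nc holomorphic frame of `E` over `U`. -/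
structure IsFrame (E : NCSubset ((Fin d → ℂ) × V)) (U : NCSubset (Fin d → ℂ))
    (v : Fin r → GradedMap (Fin d → ℂ) V) : Prop where
  isNCFunction : ∀ a, IsNCFunction U (v a)
  isLocallyBounded : ∀ a, IsLocallyBounded U (v a)
  injective : ∀ n, ∀ Z ∈ U n, ∀ A : Mat n (Fin r → ℂ), act A (fun a => v a n Z) = 0 → A = 0
  mem_iff : ∀ n, ∀ Z ∈ U n, ∀ B : Mat n V,
    pair Z B ∈ E n ↔ ∃ A : Mat n (Fin r → ℂ), act A (fun a => v a n Z) = B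

/-- The map `(Z, A) ↦ (Z, ∑ A_a v_a(Z))` of a tuple `v` of functions. -/
def frameMap (v : Fin r → GradedMap (Fin d → ℂ) V) :
    GradedMap ((Fin d → ℂ) × (Fin r → ℂ)) ((Fin d → ℂ) × V) :=
  fun n P => pair (base P) (act (fib P) fun a => v a n (base P))

variable {E : NCSubset ((Fin d → ℂ) × V)} {U : NCSubset (Fin d → ℂ)}
  {v : Fin r → GradedMap (Fin d → ℂ) V}

theorem IsFrame.act_injective (hv : IsFrame E U v) {n : ℕ+} {Z : Mat n (Fin d → ℂ)}
    (hZ : Z ∈ U n) : Function.Injective fun A : Mat n (Fin r → ℂ) => act A fun a => v a n Z :=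
  (injective_iff_map_eq_zero
    (actLinear (k := Fin n) fun a => v a n Z)).mpr (hv.injective n Z hZ)

theorem exists_common_bound (h : ∀ a, IsLocallyBounded U (v a)) {n : ℕ+} {Z : Mat n (Fin d → ℂ)}
    (hZ : Z ∈ U n) : ∃ ρ > 0, ∃ C ≥ 0, ∀ (k : ℕ+) (X : Mat k (Fin d → ℂ)),
      X ∈ U k → X ∈ ncBall Z ρ k → ∑ a, mnorm (v a k X) ≤ C := by
  choose ρ hρ C hC using fun a => h a n Z hZ
  obtain ⟨ε, hε, hle⟩ := exists_pos_forall_le ρ hρ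
  refine ⟨ε, hε, ∑ a, C a, ?_, fun k X hX hXZ => ?_⟩
  · exact Finset.sum_nonneg fun a _ => (mnorm_nonneg _).trans (hC a n Z hZ (mem_ncBall (hρ a)))
  · exact Finset.sum_le_sum fun a _ => hC a k X hX (ncBall_mono (hle a) k hXZ)

theorem isNCFunction_frameMap (hv : ∀ a, IsNCFunction U (v a)) :
    IsNCFunction (trivialBundle (Fin r → ℂ) U) (frameMap v) where
  map_directSum n m P Q hP hQ := by
    simp only [frameMap, base_directSum, fib_directSum, directSum_pair,
      fun a => (hv a).map_directSum n m _ _ hP hQ, act_directSum]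
  map_conj n S P hP hP' := by
    have hP' : conj S (base P) ∈ U n := by rw [← base_conj]; exact hP'
    simp only [frameMap, base_conj, fib_conj, conj_pair,
      fun a => (hv a).map_conj n S _ hP hP', act_conj]

theorem isLocallyBounded_frameMap (hv : ∀ a, IsLocallyBounded U (v a)) :
    IsLocallyBounded (trivialBundle (Fin r → ℂ) U) (frameMap v) := by
  intro n P hP
  obtain ⟨ρ, hρ, C, hC, h⟩ := exists_common_bound hv hP
  refine ⟨ρ, hρ, max (ρ + mnorm (base P)) ((ρ + mnorm (fib P)) * C), fun k Q hQ hQP => ?_⟩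
  rw [mnorm_prod]
  refine max_le_max (mnorm_le_of_mem_ncBall (base_mem_ncBall hQP)) ?_
  refine (mnorm_act_le _ _).trans ?_
  exact mul_le_mul (mnorm_le_of_mem_ncBall (fib_mem_ncBall hQP))
    (h k _ hQ (base_mem_ncBall hQP)) (Finset.sum_nonneg fun _ _ => mnorm_nonneg _)
    (by linarith [mnorm_nonneg (fib P)])

theorem IsFrame.isTrivialization (hv : IsFrame E U v) (hU : IsNCSet U) (ho : IsUniformlyOpen U) :
    IsTrivialization E r U (frameMap v) where
  isUniformlyAnalytic := (isNCFunction_frameMap hv.isNCFunction).isUniformlyAnalytic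
    (isLocallyBounded_frameMap hv.isLocallyBounded) (isNCSet_trivialBundle hU)
    (isUniformlyOpen_trivialBundle ho)
  bijOn n := by
    refine ⟨fun P hP => ⟨(hv.mem_iff n _ hP _).mpr ⟨_, rfl⟩, hP⟩, fun P hP Q hQ h => ?_,
      fun P hP => ?_⟩
    · have h1 : base P = base Q :=
        (congrArg base h : base (frameMap v n P) = base (frameMap v n Q))
      have h2 := congrArg fib h
      simp only [frameMap, fib_pair, ← h1] at h2
      rw [← pair_base_fib P, ← pair_base_fib Q, ← h1, hv.act_injective hP h2]
    · obtain ⟨A, hA⟩ := (hv.mem_iff n (base P) hP.2 (fib P)).mp hP.1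
      exact ⟨pair (base P) A, hP.2, congrArg (pair (base P)) hA⟩
  base_eq n P _ := rfl
  isFibrewiseLinear := ⟨fun n Z A B _ _ => act_add A B _, fun n Z c A _ => act_smul c A _,
    fun n Z S A _ => act_lmul S A _⟩

/-- Fibrewise additivity is available only at points of `D`. The induction on the sum therefore has
to know that every partial sum is again a row combination of `v`. -/
theorem IsFibrewiseLinear.fib_act {W W' : Type*} [AddCommGroup W] [Module ℂ W] [AddCommGroup W']
    [Module ℂ W'] {D : NCSubset ((Fin d → ℂ) × W)}
    {f : GradedMap ((Fin d → ℂ) × W) ((Fin d → ℂ) × W')} (hf : IsFibrewiseLinear D f) {n : ℕ+}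
    {Z : Mat n (Fin d → ℂ)} {v : Fin r → Mat n W}
    (hD : ∀ A : Mat n (Fin r → ℂ), pair Z (act A v) ∈ D n) (A : Mat n (Fin r → ℂ)) :
    fib (f n (pair Z (act A v))) = act A fun a => fib (f n (pair Z (v a))) := by
  have hva : ∀ a, pair Z (v a) ∈ D n := fun a => by simpa only [act_unitRow] using hD (unitRow n a)
  have h0 : fib (f n (pair Z 0)) = 0 := by
    have h := hf.map_smul n Z 0 _ (hD 0)
    rwa [zero_smul, zero_smul] at h
  have hl : ∀ a, pair Z (lmul (coord a A) (v a)) ∈ D n := fun a => by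
    have := hD (lmul (coord a A) (unitRow n a))
    rwa [act_lmul, act_unitRow] at this
  -- The partial sum over `s` comes from the row `A` with the blocks outside `s` deleted.
  have hrow : ∀ s : Finset (Fin r), ∃ A' : Mat n (Fin r → ℂ),
      act A' v = ∑ a ∈ s, lmul (coord a A) (v a) := by
    intro s
    refine ⟨∑ a ∈ s, lmul (coord a A) (unitRow n a), ?_⟩
    change actLinear v _ = _
    rw [map_sum]
    refine Finset.sum_congr rfl fun a _ => ?_
    change act _ _ = _
    rw [act_lmul, act_unitRow]
  have key : ∀ s : Finset (Fin r), fib (f n (pair Z (∑ a ∈ s, lmul (coord a A) (v a)))) =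
      ∑ a ∈ s, lmul (coord a A) (fib (f n (pair Z (v a)))) := by
    intro s
    induction s using Finset.induction_on with
    | empty => simpa using h0
    | insert a s ha ih =>
      obtain ⟨A', hA'⟩ := hrow s
      rw [Finset.sum_insert ha, Finset.sum_insert ha, hf.map_add n Z _ _ (hl a) (hA' ▸ hD A'), ih,
        hf.map_lmul n Z _ _ (hva a)]
  exact key Finset.univ

/-- The frame of a trivialization. -/
def frameOf (φ : GradedMap ((Fin d → ℂ) × (Fin r → ℂ)) ((Fin d → ℂ) × V)) :
    Fin r → GradedMap (Fin d → ℂ) V :=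
  fun a n Z => fib (φ n (pair Z (unitRow n a)))

/-- Every row is a combination of unit rows with matrix coefficients, so left module linearity
determines `φ` from its values on them. -/
theorem IsTrivialization.eq_frameMap
    {φ : GradedMap ((Fin d → ℂ) × (Fin r → ℂ)) ((Fin d → ℂ) × V)}
    (hφ : IsTrivialization E r U φ) {n : ℕ+} {Z : Mat n (Fin d → ℂ)} (hZ : Z ∈ U n)
    (A : Mat n (Fin r → ℂ)) : φ n (pair Z A) = pair Z (act A fun a => frameOf φ a n Z) := by
  have h := hφ.isFibrewiseLinear.fib_act (v := fun a => unitRow n a) (fun _ => hZ) A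
  rw [act_row_unitRow] at h
  rw [← pair_base_fib (φ n (pair Z A)), h, hφ.base_eq n (pair Z A) hZ]
  rfl

/-- The unit rows are compatible with direct sums, similarities and amplifications. Hence `φ`
evaluated along them inherits the nc property and local boundedness. -/
theorem IsTrivialization.isFrame {φ : GradedMap ((Fin d → ℂ) × (Fin r → ℂ)) ((Fin d → ℂ) × V)}
    (hφ : IsTrivialization E r U φ) : IsFrame E U (frameOf φ) where
  isNCFunction a := by
    refine ⟨fun n m X Y hX hY => ?_, fun n S X hX hX' => ?_⟩
    · rw [frameOf, unitRow_directSum, ← directSum_pair,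
        hφ.isUniformlyAnalytic.isNCFunction.map_directSum n m (pair X _) (pair Y _) hX hY,
        fib_directSum]
      rfl
    · have hX'' : conj S (pair X (unitRow n a)) ∈ trivialBundle (Fin r → ℂ) U n := by
        rw [conj_pair]
        exact hX'
      have h := hφ.isUniformlyAnalytic.isNCFunction.map_conj n S (pair X (unitRow n a)) hX hX''
      rw [conj_pair, conj_unitRow] at h
      rw [frameOf, h, fib_conj]
      rfl
  isLocallyBounded a := by
    intro n Y hY
    obtain ⟨ρ, hρ, C, hC⟩ := hφ.isUniformlyAnalytic.isLocallyBounded n (pair Y (unitRow n a)) hY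
    refine ⟨ρ, hρ, C, fun k X hX hXY => ?_⟩
    refine (le_max_right _ _).trans (hC k (pair X (unitRow k a)) hX (pair_mem_ncBall hXY ?_))
    rw [fib_pair, ← amp_unitRow hXY.1]
    exact amp_mem_ncBall hρ hXY.1
  injective n Z hZ A hA := by
    have h : φ n (pair Z A) = φ n (pair Z 0) := by
      rw [hφ.eq_frameMap hZ, hφ.eq_frameMap hZ, hA, act_zero]
    exact congrArg fib ((hφ.bijOn n).injOn (x₁ := pair Z A) (x₂ := pair Z 0) hZ hZ h)
  mem_iff n Z hZ B := by
    constructor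
    · intro hB
      obtain ⟨P, hP, hPB⟩ := (hφ.bijOn n).surjOn ⟨hB, hZ⟩
      have hb : base P = Z := by
        rw [← hφ.base_eq n P hP, hPB, base_pair]
      rw [← pair_base_fib P, hb, hφ.eq_frameMap hZ] at hPB
      exact ⟨fib P, congrArg fib hPB⟩
    · rintro ⟨A, rfl⟩
      rw [← hφ.eq_frameMap hZ]
      exact ((hφ.bijOn n).mapsTo (x := pair Z A) hZ).1

/-- The inverse of the row map of a frame is uniformly locally bounded. -/
theorem IsFrame.exists_lower_bound (hv : IsFrame E U v) (hU : IsNCSet U) (ho : IsUniformlyOpen U)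
    {n : ℕ+} {Z : Mat n (Fin d → ℂ)} (hZ : Z ∈ U n) :
    ∃ ρ > 0, ∃ C ≥ 0, ∀ (k : ℕ+) (X : Mat k (Fin d → ℂ)), X ∈ ncBall Z ρ k →
      X ∈ U k ∧ ∀ A : Mat k (Fin r → ℂ), mnorm A ≤ C * mnorm (act A fun a => v a k X) := by
  obtain ⟨C, hC, hlow⟩ := exists_mnorm_le_mnorm_act_amp (hv.injective n Z hZ)
  choose ρ hρ L hL hlip using fun a =>
    (hv.isNCFunction a).exists_lipschitz (hv.isLocallyBounded a) hU ho hZ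
  obtain ⟨ρ₀, hρ₀, h₀⟩ := ho n Z hZ
  obtain ⟨ε, hε, hle⟩ := exists_pos_forall_le ρ hρ
  set K := C * ∑ a, L a with hK
  have hK0 : 0 ≤ K := mul_nonneg hC (Finset.sum_nonneg fun a _ => hL a)
  -- The last radius makes the perturbation term at most `mnorm A / 2`. It is absorbed on the left,
  -- which doubles the constant `C` found at the centre.
  refine ⟨min ρ₀ (min ε (1 / (2 * (K + 1)))), lt_min hρ₀ (lt_min hε (by positivity)), 2 * C,
    by positivity, fun k X hX => ?_⟩
  refine ⟨h₀ k (ncBall_mono (min_le_left _ _) k hX), fun A => ?_⟩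
  have hXε := ncBall_mono ((min_le_right _ _).trans (min_le_left _ _)) k hX
  have hXK := ncBall_mono ((min_le_right _ _).trans (min_le_right _ _)) k hX
  have hA := mnorm_nonneg A
  have h1 : mnorm (act A fun a => amp k (v a n Z)) ≤
      mnorm (act A fun a => v a k X) + mnorm A * ((∑ a, L a) * mnorm (X - amp k Z)) := by
    have h2 : (act A fun a => amp k (v a n Z)) =
        (act A fun a => v a k X) - act A fun a => v a k X - amp k (v a n Z) := by
      rw [← act_sub_right, sub_sub_cancel]
    rw [h2]
    refine (mnorm_sub_le _ _).trans (add_le_add_right ((mnorm_act_le _ _).trans ?_) _)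
    refine mul_le_mul_of_nonneg_left ?_ hA
    rw [Finset.sum_mul]
    exact Finset.sum_le_sum fun a _ => (hlip a k X (ncBall_mono (hle a) k hXε)).2
  have h3 : K * mnorm (X - amp k Z) ≤ 1 / 2 := by
    have h4 := mul_le_mul_of_nonneg_left hXK.2.le hK0
    refine h4.trans ?_
    rw [mul_one_div, div_le_div_iff₀ (by positivity) (by positivity)]
    linarith
  have h5 := (hlow k hX.1 A).trans (mul_le_mul_of_nonneg_left h1 hC)
  have h6 := mul_le_mul_of_nonneg_left h3 hA
  have h7 : C * (mnorm (act A fun a => v a k X) + mnorm A * ((∑ a, L a) * mnorm (X - amp k Z))) =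
      C * mnorm (act A fun a => v a k X) + mnorm A * (K * mnorm (X - amp k Z)) := by
    rw [hK]
    ring
  rw [h7] at h5
  linarith

end Frames

/-! ### Retracts -/

section Retracts

variable {M : Type*} [AddCommGroup M] [Module ℂ M] {n m N N' : ℕ+}

/-- `X` is a retract of `W`: a direct summand of `W`, or equal to `W`, up to similarity. -/
structure IsRetract (X : Mat n M) (W : Mat N M) (J : Matrix (Fin N) (Fin n) ℂ)
    (Q : Matrix (Fin n) (Fin N) ℂ) : Prop where
  mul_eq_one : Q * J = 1
  inclusion : rmul W J = lmul J X
  projection : lmul Q W = rmul X Q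

theorem IsRetract.refl (X : Mat n M) : IsRetract X X 1 1 :=
  ⟨one_mul _, by rw [rmul_one, one_lmul], by rw [rmul_one, one_lmul]⟩

theorem IsRetract.trans {X : Mat n M} {W : Mat N M} {W' : Mat N' M}
    {J : Matrix (Fin N) (Fin n) ℂ} {Q : Matrix (Fin n) (Fin N) ℂ}
    {J' : Matrix (Fin N') (Fin N) ℂ} {Q' : Matrix (Fin N) (Fin N') ℂ}
    (h : IsRetract X W J Q) (h' : IsRetract W W' J' Q') : IsRetract X W' (J' * J) (Q * Q') where
  mul_eq_one := by
    rw [Matrix.mul_assoc, ← Matrix.mul_assoc Q', h'.mul_eq_one, Matrix.one_mul, h.mul_eq_one]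
  inclusion := by
    rw [← rmul_rmul, h'.inclusion, ← lmul_rmul, h.inclusion, lmul_lmul]
  projection := by
    rw [← lmul_lmul, h'.projection, lmul_rmul, h.projection, rmul_rmul]

theorem IsRetract.sum {X : Mat n M} {W : Mat N M} {X' : Mat m M} {W' : Mat N' M}
    {J : Matrix (Fin N) (Fin n) ℂ} {Q : Matrix (Fin n) (Fin N) ℂ}
    {J' : Matrix (Fin N') (Fin m) ℂ} {Q' : Matrix (Fin m) (Fin N') ℂ}
    (h : IsRetract X W J Q) (h' : IsRetract X' W' J' Q') :
    IsRetract (directSum X X') (directSum W W') (blk J 0 0 J') (blk Q 0 0 Q') where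
  mul_eq_one := by
    simp only [blk_mul, h.mul_eq_one, h'.mul_eq_one, Matrix.mul_zero, Matrix.zero_mul, add_zero,
      zero_add, blk_one]
  inclusion := by
    simp only [directSum_eq_blk, lmul_blk, rmul_blk, h.inclusion, h'.inclusion, lmul_zero,
      zero_lmul, rmul_zero, zero_rmul, add_zero, zero_add]
  projection := by
    simp only [directSum_eq_blk, lmul_blk, rmul_blk, h.projection, h'.projection, lmul_zero,
      zero_lmul, rmul_zero, zero_rmul, add_zero, zero_add]

theorem isRetract_directSum_left (X : Mat n M) (Y : Mat m M) :
    IsRetract X (directSum X Y) (blkCol 1 0) (blkRow 1 0) where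
  mul_eq_one := by
    rw [← rmul_eq_mul, rmul_blkRow_blkCol, rmul_one, rmul_zero, add_zero]
  inclusion := by
    simp only [directSum_eq_blk, rmul_blk_blkCol, lmul_blkCol, one_lmul, rmul_one, zero_lmul,
      rmul_zero, add_zero]
  projection := by
    simp only [directSum_eq_blk, lmul_blkRow_blk, rmul_blkRow, one_lmul, rmul_one, zero_lmul,
      rmul_zero, lmul_zero, add_zero]

theorem isRetract_directSum_right (X : Mat n M) (Y : Mat m M) :
    IsRetract Y (directSum X Y) (blkCol 0 1) (blkRow 0 1) where
  mul_eq_one := by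
    rw [← rmul_eq_mul, rmul_blkRow_blkCol, rmul_one, rmul_zero, zero_add]
  inclusion := by
    simp only [directSum_eq_blk, rmul_blk_blkCol, lmul_blkCol, one_lmul, rmul_one, zero_lmul,
      rmul_zero, add_zero, zero_add]
  projection := by
    simp only [directSum_eq_blk, lmul_blkRow_blk, rmul_blkRow, one_lmul, rmul_one, zero_lmul,
      rmul_zero, lmul_zero, add_zero, zero_add]

theorem isRetract_conj (S : GL (Fin n) ℂ) (X : Mat n M) :
    IsRetract (conj S X) X ((S⁻¹ : GL (Fin n) ℂ) : Matrix (Fin n) (Fin n) ℂ)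
      (S : Matrix (Fin n) (Fin n) ℂ) where
  mul_eq_one := S.mul_inv
  inclusion := by
    have h : ((S⁻¹ : GL (Fin n) ℂ) : Matrix (Fin n) (Fin n) ℂ) * (S : Matrix (Fin n) (Fin n) ℂ)
      = 1 := S.inv_mul
    rw [conj, lmul_rmul, lmul_lmul, h, one_lmul]
  projection := by
    have h : ((S⁻¹ : GL (Fin n) ℂ) : Matrix (Fin n) (Fin n) ℂ) * (S : Matrix (Fin n) (Fin n) ℂ)
      = 1 := S.inv_mul
    rw [conj, rmul_rmul, h, rmul_one]

theorem IsRetract.compress {X : Mat n M} {W : Mat N M} {J : Matrix (Fin N) (Fin n) ℂ}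
    {Q : Matrix (Fin n) (Fin N) ℂ} (h : IsRetract X W J Q) : rmul (lmul Q W) J = X := by
  rw [h.projection, rmul_rmul, h.mul_eq_one, rmul_one]

/-- Write `X'` as the amplification of `X` plus `D`, and perturb the amplification of `W` by `J D
Q`, with `J` and `Q` amplified too. Because `QJ = 1`, the same `J` and `Q` exhibit `X'` as a
retract, and the perturbation has norm at most `‖J‖ ‖D‖ ‖Q‖`. Both the openness of envelopes and the
boundedness of extensions rest on this. -/
theorem IsRetract.exists_near [OperatorSpace M] {X : Mat n M} {W : Mat N M}
    {J : Matrix (Fin N) (Fin n) ℂ} {Q : Matrix (Fin n) (Fin N) ℂ} (h : IsRetract X W J Q) {ρ : ℝ}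
    (hρ : 0 < ρ) : ∃ σ > 0, ∀ (k : ℕ+) (X' : Mat k M), X' ∈ ncBall X σ k →
      ∃ (K : ℕ+) (W' : Mat K M) (J' : Matrix (Fin K) (Fin k) ℂ) (Q' : Matrix (Fin k) (Fin K) ℂ),
        W' ∈ ncBall W ρ K ∧ IsRetract X' W' J' Q' ∧ opNorm J' ≤ opNorm J ∧
          opNorm Q' ≤ opNorm Q := by
  have hJ := opNorm_nonneg J
  have hQ := opNorm_nonneg Q
  have hJQ : 0 < opNorm J * opNorm Q + 1 := by positivity
  refine ⟨ρ / (opNorm J * opNorm Q + 1), by positivity, fun k X' hX' => ?_⟩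
  obtain ⟨q, rfl⟩ := exists_eq_mul_of_dvd hX'.1
  have hlt := hX'.2
  rw [amp_mul] at hlt
  set D := X' - ampRect q X with hD
  have hX'D : X' = ampRect q X + D := by rw [hD, add_sub_cancel]
  have hone : ampRect q Q * ampRect q J = 1 := by rw [ampRect_mul, h.mul_eq_one, ampRect_one]
  refine ⟨N * q, ampRect q W + rmul (lmul (ampRect q J) D) (ampRect q Q), ampRect q J, ampRect q Q,
    ⟨by simp, ?_⟩, ⟨hone, ?_, ?_⟩, opNorm_ampRect_le q J, opNorm_ampRect_le q Q⟩
  · rw [amp_mul, add_sub_cancel_left]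
    refine (mnorm_lmul_rmul _ _ _).trans_lt ?_
    have hD0 := mnorm_nonneg D
    have h1 : opNorm (ampRect q J) * mnorm D * opNorm (ampRect q Q) ≤
        opNorm J * mnorm D * opNorm Q :=
      mul_le_mul (mul_le_mul_of_nonneg_right (opNorm_ampRect_le q J) hD0) (opNorm_ampRect_le q Q)
        (opNorm_nonneg _) (mul_nonneg hJ hD0)
    rw [lt_div_iff₀ hJQ] at hlt
    linarith
  · rw [add_rmul, rmul_rmul, hone, rmul_one, rmul_ampRect, h.inclusion, ← lmul_ampRect, ← lmul_add,
      ← hX'D]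
  · rw [lmul_add, lmul_rmul, lmul_lmul, hone, one_lmul, lmul_ampRect, h.projection,
      ← rmul_ampRect, ← add_rmul, ← hX'D]

/-- The kernel of `q` complements the range of `j` and has the dimension of `G`. Identify it with
`G` and project onto it by `1 - jq`. -/
theorem _root_.LinearMap.exists_complement {F G H : Type*} [AddCommGroup F] [Module ℂ F]
    [AddCommGroup G] [Module ℂ G] [AddCommGroup H] [Module ℂ H] [FiniteDimensional ℂ F]
    [FiniteDimensional ℂ G] [FiniteDimensional ℂ H] {j : F →ₗ[ℂ] H} {q : H →ₗ[ℂ] F}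
    (h : ∀ x, q (j x) = x)
    (hrank : Module.finrank ℂ H = Module.finrank ℂ F + Module.finrank ℂ G) :
    ∃ (k : G →ₗ[ℂ] H) (s : H →ₗ[ℂ] G), (∀ x, q (k x) = 0) ∧ (∀ x, s (j x) = 0) ∧
      ∀ x, s (k x) = x := by
  have hker : Module.finrank ℂ (LinearMap.ker q) = Module.finrank ℂ G := by
    have h1 := LinearMap.finrank_range_add_finrank_ker q
    rw [LinearMap.range_eq_top.mpr fun x => ⟨j x, h x⟩, finrank_top] at h1
    omega
  let e : LinearMap.ker q ≃ₗ[ℂ] G := LinearEquiv.ofFinrankEq _ _ hker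
  have hmem : ∀ x, (LinearMap.id - j ∘ₗ q : H →ₗ[ℂ] H) x ∈ LinearMap.ker q := fun x => by
    rw [LinearMap.mem_ker, LinearMap.sub_apply, map_sub, LinearMap.comp_apply, h,
      LinearMap.id_apply, sub_self]
  refine ⟨(LinearMap.ker q).subtype ∘ₗ e.symm.toLinearMap,
    e.toLinearMap ∘ₗ LinearMap.codRestrict (LinearMap.ker q)
      (LinearMap.id - j ∘ₗ q : H →ₗ[ℂ] H) hmem,
    fun x => (e.symm x).2, fun x => ?_, fun x => ?_⟩
  · rw [LinearMap.comp_apply]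
    refine (congrArg e (Subtype.ext ?_)).trans (map_zero e)
    simp [h]
  · rw [LinearMap.comp_apply]
    refine (congrArg e (Subtype.ext ?_)).trans (e.apply_symm_apply x)
    simp

theorem exists_complement {J : Matrix (Fin N) (Fin n) ℂ} {Q : Matrix (Fin n) (Fin N) ℂ}
    (hN : N = n + m) (h : Q * J = 1) :
    ∃ (K : Matrix (Fin N) (Fin m) ℂ) (R : Matrix (Fin m) (Fin N) ℂ),
      Q * K = 0 ∧ R * J = 0 ∧ R * K = 1 := by
  have hrank : Module.finrank ℂ (Fin N → ℂ) =
      Module.finrank ℂ (Fin n → ℂ) + Module.finrank ℂ (Fin m → ℂ) := by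
    simp only [Module.finrank_fin_fun, hN, PNat.add_coe]
  obtain ⟨k, s, h1, h2, h3⟩ := LinearMap.exists_complement (j := Matrix.toLin' J)
    (q := Matrix.toLin' Q) (fun x => by
      rw [← LinearMap.comp_apply, ← Matrix.toLin'_mul, h, Matrix.toLin'_one,
        LinearMap.id_apply]) hrank
  refine ⟨LinearMap.toMatrix' k, LinearMap.toMatrix' s, ?_, ?_, ?_⟩ <;>
    apply Matrix.toLin'.injective <;>
    rw [Matrix.toLin'_mul] <;>
    refine LinearMap.ext fun x => ?_
  · rw [Matrix.toLin'_toMatrix', LinearMap.comp_apply, h1, map_zero, LinearMap.zero_apply]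
  · rw [Matrix.toLin'_toMatrix', LinearMap.comp_apply, h2, map_zero, LinearMap.zero_apply]
  · rw [Matrix.toLin'_toMatrix', Matrix.toLin'_toMatrix', LinearMap.comp_apply, h3,
      Matrix.toLin'_one, LinearMap.id_apply]

/-- Completing `J` and `Q` to mutually inverse square matrices shows that `W` is similar to a direct
sum with `X` as a summand. -/
theorem IsRetract.mem {Ω : NCSubset M} (hsim : IsSimilarityInvariant Ω)
    (hsum : IsSummandInvariant Ω) {X : Mat n M} {W : Mat N M} {J : Matrix (Fin N) (Fin n) ℂ}
    {Q : Matrix (Fin n) (Fin N) ℂ} (h : IsRetract X W J Q) (hW : W ∈ Ω N) : X ∈ Ω n := by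
  have hle : (n : ℕ) ≤ N := by
    have hinj : Function.Injective (Matrix.toLin' J) := by
      refine Function.LeftInverse.injective (g := Matrix.toLin' Q) fun x => ?_
      rw [← LinearMap.comp_apply, ← Matrix.toLin'_mul, h.mul_eq_one, Matrix.toLin'_one,
        LinearMap.id_apply]
    simpa using LinearMap.finrank_le_finrank_of_injective hinj
  -- Matrices have positive size, so for `n = N` there is no complementary summand and `X` is merely
  -- similar to `W`.
  rcases (PNat.coe_le_coe n N).mp hle |>.eq_or_lt with rfl | hlt
  · let S : GL (Fin n) ℂ := ⟨Q, J, h.mul_eq_one, mul_eq_one_comm.mp h.mul_eq_one⟩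
    have := hsim n S W hW
    rwa [show conj S W = X from h.compress] at this
  · obtain ⟨m, rfl⟩ : ∃ m : ℕ+, N = n + m := ⟨N - n, (PNat.add_sub_of_lt hlt).symm⟩
    obtain ⟨K, R, hQK, hRJ, hRK⟩ := exists_complement rfl h.mul_eq_one
    have hone : blkCol Q R * blkRow J K = 1 := by
      rw [← rmul_eq_mul, rmul_blkCol_blkRow]
      simp only [rmul_eq_mul, h.mul_eq_one, hQK, hRJ, hRK, blk_one]
    let S : GL (Fin (n + m : ℕ+)) ℂ := ⟨blkCol Q R, blkRow J K, hone,
      mul_eq_one_comm.mp hone⟩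
    -- The off-diagonal blocks vanish: `Q W K = X Q K = 0` and `R W J = R J X = 0`.
    have h1 : conj S W = directSum X (rmul (lmul R W) K) := by
      change rmul (lmul (blkCol Q R) W) (blkRow J K) = _
      rw [lmul_blkCol, rmul_blkCol_blkRow, h.compress, h.projection, rmul_rmul, hQK, rmul_zero,
        ← lmul_rmul R W J, h.inclusion, lmul_lmul, hRJ, zero_lmul, directSum_eq_blk]
    have h2 := hsim _ S W hW
    rw [h1] at h2
    exact (hsum n m X _ h2).1

/-- The set of the retracts of the points of `U`. -/
def envelope (U : NCSubset M) : NCSubset M := fun n =>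
  {X | ∃ (N : ℕ+) (W : Mat N M) (J : Matrix (Fin N) (Fin n) ℂ) (Q : Matrix (Fin n) (Fin N) ℂ),
    W ∈ U N ∧ IsRetract X W J Q}

variable {U : NCSubset M}

theorem subset_envelope (n : ℕ+) : U n ⊆ envelope U n :=
  fun X hX => ⟨n, X, 1, 1, hX, IsRetract.refl X⟩

theorem IsRetract.mem_envelope {X : Mat n M} {W : Mat N M} {J : Matrix (Fin N) (Fin n) ℂ}
    {Q : Matrix (Fin n) (Fin N) ℂ} (h : IsRetract X W J Q) (hW : W ∈ envelope U N) :
    X ∈ envelope U n := by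
  obtain ⟨K, W', J', Q', hW', h'⟩ := hW
  exact ⟨K, W', _, _, hW', h.trans h'⟩

theorem isNCSet_envelope (hU : IsNCSet U) : IsNCSet (envelope U) := by
  rintro n m X Y ⟨N, W, J, Q, hW, h⟩ ⟨N', W', J', Q', hW', h'⟩
  exact ⟨N + N', _, _, _, hU _ _ _ _ hW hW', h.sum h'⟩

theorem isSimilarityInvariant_envelope : IsSimilarityInvariant (envelope U) :=
  fun _ S X hX => (isRetract_conj S X).mem_envelope hX

theorem isSummandInvariant_envelope : IsSummandInvariant (envelope U) := fun _ _ X Y h =>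
  ⟨(isRetract_directSum_left X Y).mem_envelope h, (isRetract_directSum_right X Y).mem_envelope h⟩

theorem envelope_subset {Ω : NCSubset M} (hsim : IsSimilarityInvariant Ω)
    (hsum : IsSummandInvariant Ω) (h : ∀ n, U n ⊆ Ω n) (n : ℕ+) : envelope U n ⊆ Ω n := by
  rintro X ⟨N, W, J, Q, hW, hr⟩
  exact hr.mem hsim hsum (h N hW)

theorem isUniformlyOpen_envelope [OperatorSpace M] (ho : IsUniformlyOpen U) :
    IsUniformlyOpen (envelope U) := by
  rintro n X ⟨N, W, J, Q, hW, h⟩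
  obtain ⟨ρ, hρ, hball⟩ := ho N W hW
  obtain ⟨σ, hσ, hnear⟩ := h.exists_near hρ
  refine ⟨σ, hσ, fun k X' hX' => ?_⟩
  obtain ⟨K, W', J', Q', hW', hr, -⟩ := hnear k X' hX'
  exact ⟨K, W', J', Q', hball K hW', hr⟩

end Retracts

/-! ### Extension of nc functions to the envelope -/

section Extension

variable {M : Type*} [AddCommGroup M] [Module ℂ M] {V : Type*} [AddCommGroup V] [Module ℂ V]
  {n m N N' : ℕ+} {U : NCSubset M} {f : GradedMap M V}

open Classical in
/-- The extension of an nc function on `U` to the envelope of `U`. -/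
noncomputable def extension (U : NCSubset M) (f : GradedMap M V) : GradedMap M V := fun n X =>
  if h : X ∈ envelope U n then
    rmul (lmul h.choose_spec.choose_spec.choose_spec.choose (f _ h.choose_spec.choose))
      h.choose_spec.choose_spec.choose
  else 0

/-- The product `J Q'` intertwines `W` with `W'`, hence also `f(W)` with `f(W')`. This makes the
extension independent of the chosen retraction. -/
theorem IsNCFunction.compress_eq_compress (hf : IsNCFunction U f) (hU : IsNCSet U) {X : Mat n M}
    {W : Mat N M} {J : Matrix (Fin N) (Fin n) ℂ} {Q : Matrix (Fin n) (Fin N) ℂ} {W' : Mat N' M}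
    {J' : Matrix (Fin N') (Fin n) ℂ} {Q' : Matrix (Fin n) (Fin N') ℂ} (hW : W ∈ U N)
    (hW' : W' ∈ U N') (h : IsRetract X W J Q) (h' : IsRetract X W' J' Q') :
    rmul (lmul Q (f N W)) J = rmul (lmul Q' (f N' W')) J' := by
  have h1 : rmul W (J * Q') = lmul (J * Q') W' := by
    rw [← rmul_rmul, h.inclusion, ← lmul_lmul, h'.projection, lmul_rmul]
  have h2 := hf.map_intertwining hU hW hW' h1
  calc rmul (lmul Q (f N W)) J = rmul (lmul Q (rmul (f N W) (J * Q'))) J' := by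
        rw [lmul_rmul, rmul_rmul, Matrix.mul_assoc, h'.mul_eq_one, Matrix.mul_one]
    _ = rmul (lmul Q' (f N' W')) J' := by
        rw [h2, lmul_lmul, ← Matrix.mul_assoc, h.mul_eq_one, Matrix.one_mul]

theorem IsNCFunction.extension_eq (hf : IsNCFunction U f) (hU : IsNCSet U) {X : Mat n M}
    {W : Mat N M} {J : Matrix (Fin N) (Fin n) ℂ} {Q : Matrix (Fin n) (Fin N) ℂ} (hW : W ∈ U N)
    (h : IsRetract X W J Q) : extension U f n X = rmul (lmul Q (f N W)) J := by
  have hX : X ∈ envelope U n := ⟨N, W, J, Q, hW, h⟩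
  rw [extension, dif_pos hX]
  exact hf.compress_eq_compress hU hX.choose_spec.choose_spec.choose_spec.choose_spec.1 hW
    hX.choose_spec.choose_spec.choose_spec.choose_spec.2 h

theorem IsNCFunction.extension (hf : IsNCFunction U f) (hU : IsNCSet U) :
    IsNCFunction (envelope U) (extension U f) where
  map_directSum := by
    rintro n m X Y ⟨N, W, J, Q, hW, h⟩ ⟨N', W', J', Q', hW', h'⟩
    rw [hf.extension_eq hU hW h, hf.extension_eq hU hW' h',
      hf.extension_eq hU (hU _ _ _ _ hW hW') (h.sum h'), hf.map_directSum _ _ _ _ hW hW']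
    simp only [directSum_eq_blk, lmul_blk, rmul_blk, lmul_zero, zero_lmul, rmul_zero, zero_rmul,
      add_zero, zero_add]
  map_conj := by
    rintro n S X ⟨N, W, J, Q, hW, h⟩ -
    rw [hf.extension_eq hU hW h, hf.extension_eq hU hW ((isRetract_conj S X).trans h), conj,
      lmul_rmul, rmul_rmul, lmul_lmul]

theorem IsNCFunction.isLocallyBounded_extension [OperatorSpace M] [OperatorSpace V]
    (hf : IsNCFunction U f) (hb : IsLocallyBounded U f) (hU : IsNCSet U) (ho : IsUniformlyOpen U) :
    IsLocallyBounded (envelope U) (NCBundle.extension U f) := by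
  rintro n X ⟨N, W, J, Q, hW, h⟩
  obtain ⟨ρ₁, hρ₁, hball⟩ := ho N W hW
  obtain ⟨ρ₂, hρ₂, C, hC⟩ := hb N W hW
  obtain ⟨σ, hσ, hnear⟩ := h.exists_near (lt_min hρ₁ hρ₂)
  refine ⟨σ, hσ, opNorm Q * C * opNorm J, fun k X' _ hX' => ?_⟩
  obtain ⟨K, W', J', Q', hW', hr, hJ, hQ⟩ := hnear k X' hX'
  have hWU := hball K (ncBall_mono (min_le_left _ _) K hW')
  have hbd := hC K W' hWU (ncBall_mono (min_le_right _ _) K hW')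
  have hC0 := (mnorm_nonneg _).trans hbd
  rw [hf.extension_eq hU hWU hr]
  refine (mnorm_lmul_rmul _ _ _).trans ?_
  exact mul_le_mul (mul_le_mul hQ hbd (mnorm_nonneg _) (opNorm_nonneg _)) hJ (opNorm_nonneg _)
    (mul_nonneg (opNorm_nonneg _) hC0)

end Extension

/-! ### Fibres of a bundle over retracts -/

section Fibres

variable {d r : ℕ} {V : Type u} [AddCommGroup V] [Module ℂ V] [OperatorSpace V]
  {Ω U : NCSubset (Fin d → ℂ)} {E : NCSubset ((Fin d → ℂ) × V)} {n N : ℕ+}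

theorem exists_eq_blk {M : Type*} (A : Mat (n + N) M) : ∃ (A₁ : Mat n M)
    (A₂ : Matrix (Fin n) (Fin N) M) (A₃ : Matrix (Fin N) (Fin n) M) (A₄ : Mat N M),
    A = blk A₁ A₂ A₃ A₄ := by
  refine ⟨(A.submatrix (sumEquiv n N) (sumEquiv n N)).toBlocks₁₁,
    (A.submatrix (sumEquiv n N) (sumEquiv n N)).toBlocks₁₂,
    (A.submatrix (sumEquiv n N) (sumEquiv n N)).toBlocks₂₁,
    (A.submatrix (sumEquiv n N) (sumEquiv n N)).toBlocks₂₂, ?_⟩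
  rw [blk, Matrix.fromBlocks_toBlocks, Matrix.submatrix_submatrix, Equiv.self_comp_symm,
    Matrix.submatrix_id_id]

theorem IsNCVectorBundle.exists_frames (hE : IsNCVectorBundle Ω r E) :
    ∃ (ι : Type) (U : ι → NCSubset (Fin d → ℂ)) (v : ι → Fin r → GradedMap (Fin d → ℂ) V),
      IsNCCover Ω U ∧ ∀ α, IsFrame E (U α) (v α) := by
  obtain ⟨ι, U, φ, hU, hφ⟩ := hE.locally_trivial
  exact ⟨ι, U, fun α => frameOf (φ α), hU, fun α => (hφ α).isFrame⟩

/-- A tuple of the size of a frame that generates a set containing the fibre generates the fibre. -/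
theorem fibre_eq_of_subset {u x : Fin r → Mat n V} {s : Set (Mat n V)}
    (hs : ∀ B, B ∈ s ↔ ∃ A : Mat n (Fin r → ℂ), act A u = B)
    (hu : ∀ A : Mat n (Fin r → ℂ), act A u = 0 → A = 0)
    (hx : ∀ B ∈ s, ∃ A : Mat n (Fin r → ℂ), act A x = B) (B : Mat n V) :
    B ∈ s ↔ ∃ A : Mat n (Fin r → ℂ), act A x = B := by
  have hfin : FiniteDimensional ℂ (Mat n (Fin r → ℂ)) :=
    inferInstanceAs (FiniteDimensional ℂ (Fin n → Fin n → Fin r → ℂ))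
  let f : Mat n (Fin r → ℂ) →ₗ[ℂ] Mat n V := actLinear u
  let g : Mat n (Fin r → ℂ) →ₗ[ℂ] Mat n V := actLinear x
  have hle : LinearMap.range f ≤ LinearMap.range g := by
    rintro _ ⟨A, rfl⟩
    exact hx _ ((hs _).mpr ⟨A, rfl⟩)
  have heq : LinearMap.range f = LinearMap.range g := by
    -- As `u` is free, the range of `f` has the full dimension of the row space, which the range of
    -- `g` cannot exceed.
    refine Submodule.eq_of_le_of_finrank_le hle ?_
    rw [LinearMap.finrank_range_of_inj ((injective_iff_map_eq_zero f).mpr hu)]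
    exact LinearMap.finrank_range_le g
  rw [hs]
  exact SetLike.ext_iff.mp heq B

theorem IsNCVectorBundle.zero_mem (hE : IsNCVectorBundle Ω r E) {X : Mat n (Fin d → ℂ)}
    (hX : X ∈ Ω n) : pair X 0 ∈ E n := by
  obtain ⟨ι, U, v, hU, hv⟩ := hE.exists_frames
  obtain ⟨α, hα⟩ := hU.covers n X hX
  exact ((hv α).mem_iff n X hα 0).mpr ⟨0, act_zero _⟩

/-- Two points of the base have frames of their fibres that are compatible with a given
retraction. -/
theorem IsNCVectorBundle.exists_fibre_frames (hE : IsNCVectorBundle Ω r E) (hΩ : IsNCSet Ω)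
    {X : Mat n (Fin d → ℂ)} {W : Mat N (Fin d → ℂ)} {J : Matrix (Fin N) (Fin n) ℂ}
    {Q : Matrix (Fin n) (Fin N) ℂ} (hX : X ∈ Ω n) (hW : W ∈ Ω N) (h : IsRetract X W J Q) :
    ∃ (x : Fin r → Mat n V) (w : Fin r → Mat N V),
      (∀ B, pair X B ∈ E n ↔ ∃ A : Mat n (Fin r → ℂ), act A x = B) ∧
      (∀ B, pair W B ∈ E N ↔ ∃ A : Mat N (Fin r → ℂ), act A w = B) ∧
      (∀ a, rmul (x a) Q = lmul Q (w a)) ∧ ∀ a, rmul (w a) J = lmul J (x a) := by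
  obtain ⟨ι, U, v, hU, hv⟩ := hE.exists_frames
  -- The frames will be cut out of a local frame at `X ⊕ W`. Its domain need not contain `X` or `W`,
  -- so the sets `U α` and `U β` below serve only to give the fibres there the right dimension.
  obtain ⟨γ, hγ⟩ := hU.covers _ _ (hΩ _ _ _ _ hX hW)
  obtain ⟨α, hα⟩ := hU.covers _ _ hX
  obtain ⟨β, hβ⟩ := hU.covers _ _ hW
  choose x y z w hxw using fun a => exists_eq_blk (v γ a (n + N) (directSum X W))
  have hcomm : ∀ (a : Fin r) (T : Mat (n + N) ℂ), rmul (directSum X W) T = lmul T (directSum X W) →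
      rmul (blk (x a) (y a) (z a) (w a)) T = lmul T (blk (x a) (y a) (z a) (w a)) := by
    intro a T hT
    rw [← hxw]
    exact ((hv γ).isNCFunction a).map_intertwining (hU.isNCSet γ) hγ hγ hT
  -- The projection onto the first summand commutes with `X ⊕ W`, hence with the frame there, whose
  -- values are therefore block diagonal.
  have hyz : ∀ a, y a = 0 ∧ z a = 0 := by
    intro a
    have h1 := hcomm a (blk 1 0 0 0) (by
      simp only [directSum_eq_blk, lmul_blk, rmul_blk, one_lmul, rmul_one, lmul_zero, zero_lmul,
        rmul_zero, add_zero])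
    simp only [lmul_blk, rmul_blk, one_lmul, rmul_one, zero_lmul, rmul_zero, add_zero,
      blk_inj] at h1
    exact ⟨h1.2.1.symm, h1.2.2.1⟩
  have hxw' : ∀ a, v γ a (n + N) (directSum X W) = directSum (x a) (w a) := by
    intro a
    rw [hxw, (hyz a).1, (hyz a).2, directSum_eq_blk]
  -- Because `QW = XQ`, the matrix with `Q` in the upper right corner commutes with `X ⊕ W`; `J` is
  -- handled likewise in the lower left corner.
  have hQ : ∀ a, rmul (x a) Q = lmul Q (w a) := by
    intro a
    have h1 := hcomm a (blk 0 Q 0 0) (by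
      simp only [directSum_eq_blk, lmul_blk, rmul_blk, lmul_zero, zero_lmul,
        rmul_zero, zero_rmul, add_zero, zero_add, h.projection])
    simp only [lmul_blk, rmul_blk, zero_lmul, rmul_zero, add_zero, zero_add, blk_inj] at h1
    exact h1.2.1
  have hJ : ∀ a, rmul (w a) J = lmul J (x a) := by
    intro a
    have h1 := hcomm a (blk 0 0 J 0) (by
      simp only [directSum_eq_blk, lmul_blk, rmul_blk, lmul_zero, zero_lmul,
        rmul_zero, zero_rmul, add_zero, zero_add, h.inclusion])
    simp only [lmul_blk, rmul_blk, zero_lmul, rmul_zero, add_zero, zero_add, blk_inj] at h1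
    exact h1.2.2.1
  -- Closure of `E` under direct sums gives only one inclusion: the diagonal blocks of the frame
  -- generate at least the fibres over `X` and `W`. The dimension count in `fibre_eq_of_subset`
  -- gives equality.
  have hsum : ∀ B C, pair X B ∈ E n → pair W C ∈ E N →
      (∃ A : Mat n (Fin r → ℂ), act A x = B) ∧ ∃ A : Mat N (Fin r → ℂ), act A w = C := by
    intro B C hB hC
    have h1 := hE.isNCSet _ _ _ _ hB hC
    rw [directSum_pair, (hv γ).mem_iff _ _ hγ] at h1
    obtain ⟨A, hA⟩ := h1
    obtain ⟨A₁, A₂, A₃, A₄, rfl⟩ := exists_eq_blk A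
    simp only [hxw', act_blk] at hA
    rw [directSum_eq_blk, blk_inj] at hA
    exact ⟨⟨A₁, hA.1⟩, A₄, hA.2.2.2⟩
  refine ⟨x, w, ?_, ?_, hQ, hJ⟩
  · exact fibre_eq_of_subset (s := {B | pair X B ∈ E n}) ((hv α).mem_iff n X hα)
      ((hv α).injective n X hα) fun B hB => (hsum B 0 hB (hE.zero_mem hW)).1
  · exact fibre_eq_of_subset (s := {B | pair W B ∈ E N}) ((hv β).mem_iff N W hβ)
      ((hv β).injective N W hβ) fun B hB => (hsum 0 B (hE.zero_mem hX) hB).2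

/-- The definition of a bundle only asks `E` to be closed under direct sums; local triviality at `X
⊕ W` supplies the compatibility with similarities and summands. In compatible frames a row `A` over
`X` lifts to `J A Q` over `W`, and a row over `W` compresses by `Q` and `J`. -/
theorem IsNCVectorBundle.mem_iff_of_isRetract (hE : IsNCVectorBundle Ω r E) (hΩ : IsNCSet Ω)
    {X : Mat n (Fin d → ℂ)} {W : Mat N (Fin d → ℂ)} {J : Matrix (Fin N) (Fin n) ℂ}
    {Q : Matrix (Fin n) (Fin N) ℂ} (hX : X ∈ Ω n) (hW : W ∈ Ω N) (h : IsRetract X W J Q)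
    (B : Mat n V) : pair X B ∈ E n ↔ ∃ B', pair W B' ∈ E N ∧ rmul (lmul Q B') J = B := by
  obtain ⟨x, w, hx, hw, hQ, hJ⟩ := hE.exists_fibre_frames hΩ hX hW h
  rw [hx]
  constructor
  · rintro ⟨A, rfl⟩
    refine ⟨act (rmul (lmul J A) Q) w, (hw _).mpr ⟨_, rfl⟩, ?_⟩
    rw [act_rmul, act_lmul, lmul_lmul, h.mul_eq_one, one_lmul, rmul_act]
    simp only [← hQ, rmul_rmul, h.mul_eq_one, rmul_one]
  · rintro ⟨B', hB', rfl⟩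
    obtain ⟨A, rfl⟩ := (hw B').mp hB'
    refine ⟨rmul (lmul Q A) J, ?_⟩
    rw [act_rmul, act_lmul, ← lmul_rmul, rmul_act]
    simp only [hJ]

/-- A frame over `U` extends to a frame over the envelope of `U`. -/
theorem IsFrame.extension (hE : IsNCVectorBundle Ω r E) (hΩ : IsNCSet Ω)
    (hsim : IsSimilarityInvariant Ω) (hsum : IsSummandInvariant Ω) (hU : IsNCSet U)
    (ho : IsUniformlyOpen U) (hUΩ : ∀ n, U n ⊆ Ω n) {v : Fin r → GradedMap (Fin d → ℂ) V}
    (hv : IsFrame E U v) : IsFrame E (envelope U) fun a => extension U (v a) where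
  isNCFunction a := (hv.isNCFunction a).extension hU
  isLocallyBounded a :=
    (hv.isNCFunction a).isLocallyBounded_extension (hv.isLocallyBounded a) hU ho
  injective := by
    rintro n X ⟨N, W, J, Q, hW, h⟩ A hA
    -- The idempotent `J Q` commutes with `W`, hence with the values of the frame at `W`.
    have hcomm : ∀ a, rmul (v a N W) (J * Q) = lmul (J * Q) (v a N W) := fun a =>
      (hv.isNCFunction a).map_intertwining hU hW hW (by
        rw [← rmul_rmul, h.inclusion, ← lmul_lmul, h.projection, lmul_rmul])
    simp only [fun a => (hv.isNCFunction a).extension_eq hU hW h] at hA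
    -- Multiplying the relation over `X` by `J` and `Q` and moving `J Q` past the frame gives a
    -- relation over `W` for the lifted row `J A Q`.
    have h1 : act (rmul (lmul J A) Q) (fun a => v a N W) = 0 := by
      have h2 : rmul (lmul J (act A fun a => rmul (lmul Q (v a N W)) J)) Q = 0 := by
        rw [hA, lmul_zero, zero_rmul]
      rw [← lmul_rmul, rmul_act] at h2
      simp only [rmul_rmul] at h2
      simp only [← lmul_rmul, hcomm, lmul_lmul] at h2
      simp only [← Matrix.mul_assoc, h.mul_eq_one, Matrix.one_mul] at h2
      rwa [act_rmul, act_lmul]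
    have h3 := hv.injective N W hW _ h1
    calc A = rmul (lmul Q (rmul (lmul J A) Q)) J := by
          rw [lmul_rmul, lmul_lmul, rmul_rmul, h.mul_eq_one, one_lmul, rmul_one]
      _ = 0 := by rw [h3, lmul_zero, zero_rmul]
  mem_iff := by
    intro n X hX B
    have hXΩ := envelope_subset hsim hsum hUΩ n hX
    obtain ⟨N, W, J, Q, hW, h⟩ := hX
    have hJ : ∀ a, rmul (v a N W) (J * Q) = lmul (J * Q) (v a N W) := fun a =>
      (hv.isNCFunction a).map_intertwining hU hW hW (by
        rw [← rmul_rmul, h.inclusion, ← lmul_lmul, h.projection, lmul_rmul])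
    simp only [fun a => (hv.isNCFunction a).extension_eq hU hW h]
    rw [hE.mem_iff_of_isRetract hΩ hXΩ (hUΩ N hW) h]
    constructor
    · rintro ⟨B', hB', rfl⟩
      obtain ⟨A, rfl⟩ := (hv.mem_iff N W hW B').mp hB'
      refine ⟨rmul (lmul Q A) J, ?_⟩
      rw [act_rmul, act_lmul, ← lmul_rmul, rmul_act]
      congr 2
      funext a
      rw [lmul_rmul, lmul_lmul, ← hJ, rmul_rmul, Matrix.mul_assoc, h.mul_eq_one, Matrix.mul_one]
    · rintro ⟨A, rfl⟩
      refine ⟨act (rmul (lmul J A) Q) fun a => v a N W, (hv.mem_iff N W hW _).mpr ⟨_, rfl⟩, ?_⟩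
      rw [act_rmul, act_lmul, lmul_lmul, h.mul_eq_one, one_lmul, rmul_act]

end Fibres

/-! ### Block matrices acting on rows -/

section RowMul

variable {n m : ℕ+} {r : ℕ}

/-- The block `(a, b)` of a block matrix. -/
def entry (a b : Fin r) (g : Mat n (Matrix (Fin r) (Fin r) ℂ)) : Mat n ℂ := g.map fun x => x a b

/-- The row `a` of a block matrix. -/
def blockRow (a : Fin r) (g : Mat n (Matrix (Fin r) (Fin r) ℂ)) : Mat n (Fin r → ℂ) :=
  g.map fun x => x a

/-- The block matrix with given rows. -/
def ofBlockRows (A : Fin r → Mat n (Fin r → ℂ)) : Mat n (Matrix (Fin r) (Fin r) ℂ) :=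
  Matrix.of fun i j => Matrix.of fun a => A a i j

theorem blockRow_ofBlockRows (A : Fin r → Mat n (Fin r → ℂ)) (a : Fin r) :
    blockRow a (ofBlockRows A) = A a := rfl

theorem ofBlockRows_blockRow (g : Mat n (Matrix (Fin r) (Fin r) ℂ)) :
    ofBlockRows (fun a => blockRow a g) = g := rfl

/-- Taking a row of a matrix, as a linear map. -/
def rowLinear (r : ℕ) (a : Fin r) : Matrix (Fin r) (Fin r) ℂ →ₗ[ℂ] (Fin r → ℂ) where
  toFun x := x a
  map_add' _ _ := rfl
  map_smul' _ _ := rfl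

theorem blockRow_directSum (a : Fin r) (g : Mat n (Matrix (Fin r) (Fin r) ℂ))
    (h : Mat m (Matrix (Fin r) (Fin r) ℂ)) :
    blockRow a (directSum g h) = directSum (blockRow a g) (blockRow a h) :=
  blk_map (rowLinear r a) g 0 0 h

theorem blockRow_conj (a : Fin r) (S : GL (Fin n) ℂ) (g : Mat n (Matrix (Fin r) (Fin r) ℂ)) :
    blockRow a (conj S g) = conj S (blockRow a g) := by
  rw [conj, conj]
  exact (rmul_map _ _ (rowLinear r a)).trans
    (congrArg (fun X => rmul X _) (lmul_map _ _ (rowLinear r a)))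

theorem coord_rowMul (A : Mat n (Fin r → ℂ)) (g : Mat n (Matrix (Fin r) (Fin r) ℂ)) (b : Fin r) :
    coord b (rowMul A g) = ∑ a, coord a A * entry a b g := by
  ext i j
  simp only [coord, entry, rowMul, Matrix.map_apply, Matrix.of_apply, Matrix.sum_apply,
    Matrix.mul_apply]
  exact Finset.sum_comm

theorem rowMul_eq_act (A : Mat n (Fin r → ℂ)) (g : Mat n (Matrix (Fin r) (Fin r) ℂ)) :
    rowMul A g = act A fun a => blockRow a g := by
  ext i j b
  simp only [rowMul, act, Matrix.of_apply, Matrix.sum_apply, lmul_apply, coord, blockRow,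
    Matrix.map_apply, Finset.sum_apply, Pi.smul_apply, smul_eq_mul]
  exact Finset.sum_comm

theorem act_rowMul {V : Type*} [AddCommGroup V] [Module ℂ V] (A : Mat n (Fin r → ℂ))
    (g : Mat n (Matrix (Fin r) (Fin r) ℂ)) (v : Fin r → Mat n V) :
    act (rowMul A g) v = act A fun a => act (blockRow a g) v := by
  rw [rowMul_eq_act]
  change actLinear v (∑ a, lmul (coord a A) (blockRow a g)) = _
  rw [map_sum]
  exact Finset.sum_congr rfl fun a _ => act_lmul _ _ _

theorem rowMul_mul (A : Mat n (Fin r → ℂ)) (g h : Mat n (Matrix (Fin r) (Fin r) ℂ)) :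
    rowMul A (g * h) = rowMul (rowMul A g) h := by
  refine coord_ext fun b => ?_
  have hgh : ∀ a, entry a b (g * h) = ∑ c, entry a c g * entry c b h := by
    intro a
    ext i j
    simp only [entry, Matrix.map_apply, Matrix.mul_apply, Matrix.sum_apply]
    exact Finset.sum_comm
  simp only [coord_rowMul, hgh, Finset.mul_sum, Finset.sum_mul, Matrix.mul_assoc]
  exact Finset.sum_comm

theorem rowMul_one (A : Mat n (Fin r → ℂ)) :
    rowMul A (1 : Mat n (Matrix (Fin r) (Fin r) ℂ)) = A := by
  rw [rowMul_eq_act]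
  refine Eq.trans (congrArg (act A) (funext fun a => ?_)) (act_row_unitRow A)
  ext i j b
  by_cases h : i = j <;> by_cases h' : a = b <;>
    simp [blockRow, unitRow, h, h', eq_comm]

theorem rowMul_ext {g h : Mat n (Matrix (Fin r) (Fin r) ℂ)} (H : ∀ A, rowMul A g = rowMul A h) :
    g = h := by
  have h1 : ∀ a, blockRow a g = blockRow a h := fun a => by
    simpa only [rowMul_eq_act, act_unitRow] using H (unitRow n a)
  rw [← ofBlockRows_blockRow g, ← ofBlockRows_blockRow h]
  simp only [h1]

/-- The norm of a row is the largest norm of its blocks, and each block is a compression of `g` to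
one slot on either side. -/
theorem mnorm_blockRow_le (g : Mat n (Matrix (Fin r) (Fin r) ℂ)) (a : Fin r) :
    mnorm (blockRow a g) ≤ mnorm g := by
  refine mnorm_row_le (mnorm_nonneg g) fun b => ?_
  change opNorm (entry a b g) ≤ opNorm (Matrix.comp (Fin n) (Fin n) (Fin r) (Fin r) ℂ g)
  refine opNorm_le (opNorm_nonneg _) fun x => ?_
  let y : Fin n × Fin r → ℂ := fun p => if p.2 = b then x p.1 else 0
  have h1 := opNorm_bound (Matrix.comp (Fin n) (Fin n) (Fin r) (Fin r) ℂ g) y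
  have h2 : ∑ p, ‖y p‖ ^ 2 = ∑ j, ‖x j‖ ^ 2 := by
    rw [Fintype.sum_prod_type]
    refine Finset.sum_congr rfl fun j _ => ?_
    rw [Finset.sum_eq_single b] <;> simp +contextual [y]
  have h3 : ∀ i, (Matrix.comp (Fin n) (Fin n) (Fin r) (Fin r) ℂ g).mulVec y (i, a) =
      (entry a b g).mulVec x i := by
    intro i
    simp [Matrix.mulVec, dotProduct, Fintype.sum_prod_type, y, entry]
  rw [h2, Fintype.sum_prod_type] at h1
  refine le_trans (Finset.sum_le_sum fun i _ => ?_) h1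
  rw [← h3]
  exact Finset.single_le_sum
    (f := fun c => ‖(Matrix.comp (Fin n) (Fin n) (Fin r) (Fin r) ℂ g).mulVec y (i, c)‖ ^ 2)
    (fun _ _ => sq_nonneg _) (Finset.mem_univ a)

theorem opNorm_sum_le {m n ι : Type*} [Fintype m] [Fintype n] [DecidableEq n] (s : Finset ι)
    (A : ι → Matrix m n ℂ) : opNorm (∑ a ∈ s, A a) ≤ ∑ a ∈ s, opNorm (A a) := by
  unfold opNorm
  rw [map_sum]
  exact norm_sum_le _ _

/-- Split `g` into its `r²` single-block pieces and bound each by the norm of its row. The constant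
is crude, but it does not depend on the level `n`, as uniform boundedness requires. -/
theorem mnorm_le_sum_blockRow (g : Mat n (Matrix (Fin r) (Fin r) ℂ)) :
    mnorm g ≤ r * ∑ a, mnorm (blockRow a g) := by
  have h1 : Matrix.comp (Fin n) (Fin n) (Fin r) (Fin r) ℂ g = ∑ a, ∑ b,
      Matrix.of fun (x y : Fin n × Fin r) =>
        if x.2 = a then if y.2 = b then g x.1 y.1 a b else 0 else 0 := by
    ext x y
    simp [Matrix.sum_apply]
  have h2 : ∀ a b, opNorm (Matrix.of fun (x y : Fin n × Fin r) =>
      if x.2 = a then if y.2 = b then g x.1 y.1 a b else 0 else 0) ≤ opNorm (entry a b g) := by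
    intro a b
    refine opNorm_le (opNorm_nonneg _) fun x => ?_
    refine le_trans (le_of_eq ?_) ((opNorm_bound (entry a b g) fun j => x (j, b)).trans
      (mul_le_mul_of_nonneg_left ?_ (sq_nonneg _)))
    · rw [Fintype.sum_prod_type]
      refine Finset.sum_congr rfl fun i _ => ?_
      rw [Finset.sum_eq_single a]
      · simp [Matrix.mulVec, dotProduct, Fintype.sum_prod_type, entry]
      · intro c _ hc
        simp [Matrix.mulVec, dotProduct, hc]
      · simp
    · rw [Fintype.sum_prod_type]
      exact Finset.sum_le_sum fun j _ => Finset.single_le_sum (f := fun c => ‖x (j, c)‖ ^ 2)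
        (fun _ _ => sq_nonneg _) (Finset.mem_univ b)
  change opNorm (Matrix.comp (Fin n) (Fin n) (Fin r) (Fin r) ℂ g) ≤ _
  rw [h1, Finset.mul_sum]
  refine (opNorm_sum_le _ _).trans (Finset.sum_le_sum fun a _ => ?_)
  refine (opNorm_sum_le _ _).trans ?_
  have h3 : ∑ _b : Fin r, mnorm (blockRow a g) = r * mnorm (blockRow a g) := by simp
  rw [← h3]
  exact Finset.sum_le_sum fun b _ => (h2 a b).trans (opNorm_coord_le (blockRow a g) b)

end RowMul

/-! ### Transition functions between frames -/

section Transition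

variable {d r : ℕ} {V : Type u} [AddCommGroup V] [Module ℂ V] [OperatorSpace V]
  {Ω : NCSubset (Fin d → ℂ)} {E F : NCSubset ((Fin d → ℂ) × V)}

theorem isNCSet_inter {M : Type*} [AddCommGroup M] [Module ℂ M] {U U' : NCSubset M}
    (hU : IsNCSet U) (hU' : IsNCSet U') : IsNCSet (inter U U') :=
  fun n m X Y hX hY => ⟨hU n m X Y hX.1 hY.1, hU' n m X Y hX.2 hY.2⟩

theorem isUniformlyOpen_inter {M : Type*} [AddCommGroup M] [Module ℂ M] [OperatorSpace M]
    {U U' : NCSubset M} (hU : IsUniformlyOpen U) (hU' : IsUniformlyOpen U') :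
    IsUniformlyOpen (inter U U') := by
  intro n Y hY
  obtain ⟨ρ, hρ, h⟩ := hU n Y hY.1
  obtain ⟨ρ', hρ', h'⟩ := hU' n Y hY.2
  exact ⟨min ρ ρ', lt_min hρ hρ', fun k X hX =>
    ⟨h k (ncBall_mono (min_le_left _ _) k hX), h' k (ncBall_mono (min_le_right _ _) k hX)⟩⟩

open Classical in
/-- The transition function from the frame `w` to the frame `v`: its rows are the coordinates of
`w` with respect to `v`. -/
noncomputable def transition (v w : Fin r → GradedMap (Fin d → ℂ) V) :
    GradedMap (Fin d → ℂ) (Matrix (Fin r) (Fin r) ℂ) := fun n Z =>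
  ofBlockRows fun a =>
    if h : ∃ A : Mat n (Fin r → ℂ), act A (fun b => v b n Z) = w a n Z then h.choose else 0

variable {U U' : NCSubset (Fin d → ℂ)} {v w : Fin r → GradedMap (Fin d → ℂ) V}

theorem IsFrame.apply_mem (hw : IsFrame E U w) {n : ℕ+} {Z : Mat n (Fin d → ℂ)} (hZ : Z ∈ U n)
    (a : Fin r) : pair Z (w a n Z) ∈ E n :=
  (hw.mem_iff n Z hZ _).mpr ⟨unitRow n a, act_unitRow a _⟩

theorem IsFrame.act_blockRow_transition (hv : IsFrame E U v) (hw : IsFrame E U' w) {n : ℕ+}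
    {Z : Mat n (Fin d → ℂ)} (hZ : Z ∈ inter U U' n) (a : Fin r) :
    act (blockRow a (transition v w n Z)) (fun b => v b n Z) = w a n Z := by
  have h : ∃ A : Mat n (Fin r → ℂ), act A (fun b => v b n Z) = w a n Z :=
    (hv.mem_iff n Z hZ.1 _).mp (hw.apply_mem hZ.2 a)
  rw [transition, blockRow_ofBlockRows, dif_pos h]
  exact h.choose_spec

theorem IsFrame.act_rowMul_transition (hv : IsFrame E U v) (hw : IsFrame E U' w) {n : ℕ+}
    {Z : Mat n (Fin d → ℂ)} (hZ : Z ∈ inter U U' n) (A : Mat n (Fin r → ℂ)) :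
    act (rowMul A (transition v w n Z)) (fun b => v b n Z) = act A fun a => w a n Z := by
  rw [act_rowMul]
  simp only [hv.act_blockRow_transition hw hZ]

/-- Uniqueness of coordinates with respect to `v` transfers the nc property from the frames to the
transition function. The lower bound for `v` together with the bound for `w` makes it locally
bounded, and exchanging the frames gives the inverse. -/
theorem IsFrame.isAnalyticGL_transition (hv : IsFrame E U v) (hw : IsFrame E U' w)
    (hU : IsNCSet U) (ho : IsUniformlyOpen U) (hU' : IsNCSet U') (ho' : IsUniformlyOpen U') :
    IsAnalyticGL (inter U U') (transition v w) where
  isUniformlyAnalytic := by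
    refine IsNCFunction.isUniformlyAnalytic ⟨fun n m X Y hX hY => ?_, fun n S X hX hX' => ?_⟩ ?_
      (isNCSet_inter hU hU') (isUniformlyOpen_inter ho ho')
    · have hXY := isNCSet_inter hU hU' n m X Y hX hY
      rw [← ofBlockRows_blockRow (directSum (transition v w n X) _),
        ← ofBlockRows_blockRow (transition v w (n + m) _)]
      congr 1
      funext a
      apply hv.act_injective hXY.1
      refine ((hv.act_blockRow_transition hw hXY a).trans
        ((hw.isNCFunction a).map_directSum n m X Y hX.2 hY.2)).trans ?_
      simp only [blockRow_directSum,
        fun b => (hv.isNCFunction b).map_directSum n m X Y hX.1 hY.1, act_directSum,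
        hv.act_blockRow_transition hw hX, hv.act_blockRow_transition hw hY]
    · rw [← ofBlockRows_blockRow (conj S _),
        ← ofBlockRows_blockRow (transition v w n (conj S X))]
      congr 1
      funext a
      apply hv.act_injective hX'.1
      refine ((hv.act_blockRow_transition hw hX' a).trans
        ((hw.isNCFunction a).map_conj n S X hX.2 hX'.2)).trans ?_
      simp only [blockRow_conj, fun b => (hv.isNCFunction b).map_conj n S X hX.1 hX'.1, act_conj,
        hv.act_blockRow_transition hw hX]
    · intro n Z hZ
      obtain ⟨ρ, hρ, C, hC, hlow⟩ := hv.exists_lower_bound hU ho hZ.1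
      obtain ⟨ρ', hρ', C', hC', hb⟩ := exists_common_bound hw.isLocallyBounded hZ.2
      refine ⟨min ρ ρ', lt_min hρ hρ', r * (C * C'), fun k X hX hXZ => ?_⟩
      refine (mnorm_le_sum_blockRow _).trans (mul_le_mul_of_nonneg_left ?_ (Nat.cast_nonneg r))
      have h1 : ∑ a, mnorm (blockRow a (transition v w k X)) ≤ ∑ a, C * mnorm (w a k X) := by
        refine Finset.sum_le_sum fun a _ => ?_
        rw [← hv.act_blockRow_transition hw hX]
        exact (hlow k X (ncBall_mono (min_le_left _ _) k hXZ)).2 _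
      rw [← Finset.mul_sum] at h1
      exact h1.trans (mul_le_mul_of_nonneg_left
        (hb k X hX.2 (ncBall_mono (min_le_right _ _) k hXZ)) hC)
  isUnit n Z hZ := by
    have hmul : ∀ {U U' : NCSubset (Fin d → ℂ)} {v w : Fin r → GradedMap (Fin d → ℂ) V},
        IsFrame E U v → IsFrame E U' w → Z ∈ inter U U' n →
        transition v w n Z * transition w v n Z = 1 := by
      intro U U' v w hv hw hZ
      refine rowMul_ext fun A => hw.act_injective hZ.2 ?_
      simp only [rowMul_mul, rowMul_one]
      rw [hw.act_rowMul_transition hv hZ.symm, hv.act_rowMul_transition hw hZ]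
    exact ⟨⟨_, _, hmul hv hw hZ, hmul hw hv hZ.symm⟩, rfl⟩

theorem isTransitionCocycle_transition {ι : Type} {U : ι → NCSubset (Fin d → ℂ)}
    {v : ι → Fin r → GradedMap (Fin d → ℂ) V} (hU : IsNCCover Ω U)
    (hv : ∀ α, IsFrame E (U α) (v α)) :
    IsTransitionCocycle U (fun α => frameMap (v α)) fun α β => transition (v α) (v β) where
  isNCCocycle := by
    refine ⟨fun α β => (hv α).isAnalyticGL_transition (hv β) (hU.isNCSet α) (hU.isUniformlyOpen α)
      (hU.isNCSet β) (hU.isUniformlyOpen β), fun α β γ n Z hα hβ hγ => ?_⟩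
    refine rowMul_ext fun A => (hv α).act_injective hα ?_
    simp only [rowMul_mul, rowMul_one]
    rw [(hv α).act_rowMul_transition (hv β) ⟨hα, hβ⟩, (hv β).act_rowMul_transition (hv γ) ⟨hβ, hγ⟩,
      (hv γ).act_rowMul_transition (hv α) ⟨hγ, hα⟩]
  transition α β n Z hα hβ A :=
    congrArg (pair Z) ((hv α).act_rowMul_transition (hv β) ⟨hα, hβ⟩ A).symm

/-- A frame multiplied by an invertible analytic matrix function is a frame. -/
theorem IsFrame.mul (hv : IsFrame E U v) {lam : GradedMap (Fin d → ℂ) (Matrix (Fin r) (Fin r) ℂ)}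
    (hl : IsAnalyticGL U lam) :
    IsFrame E U fun a n Z => act (blockRow a (lam n Z)) fun b => v b n Z where
  isNCFunction a := by
    refine ⟨fun n m X Y hX hY => ?_, fun n S X hX hX' => ?_⟩
    · simp only [hl.isUniformlyAnalytic.isNCFunction.map_directSum n m X Y hX hY,
        blockRow_directSum, fun b => (hv.isNCFunction b).map_directSum n m X Y hX hY, act_directSum]
    · simp only [hl.isUniformlyAnalytic.isNCFunction.map_conj n S X hX hX',
        blockRow_conj, fun b => (hv.isNCFunction b).map_conj n S X hX hX', act_conj]
  isLocallyBounded a := by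
    intro n Z hZ
    obtain ⟨ρ, hρ, C, h⟩ := hl.isUniformlyAnalytic.isLocallyBounded n Z hZ
    obtain ⟨ρ', hρ', C', hC', h'⟩ := exists_common_bound hv.isLocallyBounded hZ
    refine ⟨min ρ ρ', lt_min hρ hρ', C * C', fun k X hX hXZ => ?_⟩
    have h1 := h k X hX (ncBall_mono (min_le_left _ _) k hXZ)
    have h2 := h' k X hX (ncBall_mono (min_le_right _ _) k hXZ)
    exact (mnorm_act_le _ _).trans (mul_le_mul ((mnorm_blockRow_le _ a).trans h1) h2
      (Finset.sum_nonneg fun _ _ => mnorm_nonneg _) ((mnorm_nonneg _).trans h1))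
  injective n Z hZ A hA := by
    obtain ⟨u, hu⟩ := hl.isUnit n Z hZ
    rw [← act_rowMul] at hA
    have h1 := hv.injective n Z hZ _ hA
    have h2 : A = rowMul (rowMul A (lam n Z)) (↑u⁻¹ : Mat n (Matrix (Fin r) (Fin r) ℂ)) := by
      rw [← rowMul_mul, ← hu, u.mul_inv, rowMul_one]
    rw [h2, h1, rowMul_eq_act, act_zero]
  mem_iff n Z hZ B := by
    obtain ⟨u, hu⟩ := hl.isUnit n Z hZ
    rw [hv.mem_iff n Z hZ]
    constructor
    · rintro ⟨A, rfl⟩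
      refine ⟨rowMul A (↑u⁻¹ : Mat n (Matrix (Fin r) (Fin r) ℂ)), ?_⟩
      rw [← act_rowMul, ← rowMul_mul, ← hu, u.inv_mul, rowMul_one]
    · rintro ⟨A, rfl⟩
      exact ⟨_, act_rowMul A (lam n Z) _⟩

end Transition

/-! ### Isomorphic bundles -/

section Isomorphism

variable {d r : ℕ} {V : Type u} [AddCommGroup V] [Module ℂ V] [OperatorSpace V]
  {Ω : NCSubset (Fin d → ℂ)} {E F : NCSubset ((Fin d → ℂ) × V)}

theorem isAnalyticGL_one (U : NCSubset (Fin d → ℂ)) (hU : IsNCSet U) (ho : IsUniformlyOpen U) :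
    IsAnalyticGL U fun n _ => (1 : Mat n (Matrix (Fin r) (Fin r) ℂ)) where
  isUnit _ _ _ := isUnit_one
  isUniformlyAnalytic := by
    have hrow : ∀ (n : ℕ+) (a : Fin r),
        blockRow a (1 : Mat n (Matrix (Fin r) (Fin r) ℂ)) = unitRow n a := by
      intro n a
      have h := rowMul_one (unitRow n a)
      rwa [rowMul_eq_act, act_unitRow] at h
    have hext : ∀ {n : ℕ+} {g h : Mat n (Matrix (Fin r) (Fin r) ℂ)},
        (∀ a, blockRow a g = blockRow a h) → g = h := by
      intro n g h H
      rw [← ofBlockRows_blockRow g, ← ofBlockRows_blockRow h]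
      simp only [H]
    refine IsNCFunction.isUniformlyAnalytic ⟨fun n m X Y _ _ => hext fun a => ?_,
      fun n S X _ _ => hext fun a => ?_⟩ (fun n Y _ => ⟨1, one_pos, 1, fun k X _ _ => ?_⟩) hU ho
    · rw [blockRow_directSum, hrow, hrow, hrow, unitRow_directSum]
    · rw [blockRow_conj, hrow, conj_unitRow]
    · refine le_trans (le_of_eq ?_) (opNorm_one_le (n := Fin k × Fin r))
      change opNorm (Matrix.comp (Fin k) (Fin k) (Fin r) (Fin r) ℂ 1) = _
      congr 1
      ext ⟨i, a⟩ ⟨j, b⟩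
      by_cases h : i = j <;> simp [Matrix.comp_apply, Matrix.one_apply, h]

/-- The image of a frame under an isomorphism of bundles. -/
theorem IsFrame.map {U : NCSubset (Fin d → ℂ)} {v : Fin r → GradedMap (Fin d → ℂ) V}
    (hv : IsFrame E U v) (hU : IsNCSet U) (ho : IsUniformlyOpen U)
    {f : GradedMap ((Fin d → ℂ) × V) ((Fin d → ℂ) × V)} (hf : IsNCFunction E f)
    (hb : IsLocallyBounded E f) (hbij : ∀ n, Set.BijOn (f n) (E n) (F n))
    (hbase : ∀ n, ∀ P ∈ E n, base (f n P) = base P) (hlin : IsFibrewiseLinear E f) :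
    IsFrame F U fun a n Z => fib (f n (pair Z (v a n Z))) := by
  have hmem : ∀ {n : ℕ+} {Z : Mat n (Fin d → ℂ)}, Z ∈ U n → ∀ A : Mat n (Fin r → ℂ),
      pair Z (act A fun a => v a n Z) ∈ E n := fun hZ A =>
    (hv.mem_iff _ _ hZ _).mpr ⟨A, rfl⟩
  have hact : ∀ {n : ℕ+} {Z : Mat n (Fin d → ℂ)}, Z ∈ U n → ∀ A : Mat n (Fin r → ℂ),
      f n (pair Z (act A fun a => v a n Z)) =
        pair Z (act A fun a => fib (f n (pair Z (v a n Z)))) := by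
    intro n Z hZ A
    rw [← hlin.fib_act (hmem hZ), ← pair_base_fib (f n _), hbase n _ (hmem hZ A)]
    rfl
  constructor
  · intro a
    refine ⟨fun n m X Y hX hY => ?_, fun n S X hX hX' => ?_⟩
    · rw [(hv.isNCFunction a).map_directSum n m X Y hX hY, ← directSum_pair,
        hf.map_directSum n m _ _ (hv.apply_mem hX a) (hv.apply_mem hY a), fib_directSum]
    · have h := hv.apply_mem hX' a
      rw [(hv.isNCFunction a).map_conj n S X hX hX', ← conj_pair] at h ⊢
      rw [hf.map_conj n S _ (hv.apply_mem hX a) h, fib_conj]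
  · intro a n Z hZ
    obtain ⟨ρ, hρ, C, hC⟩ := hb n _ (hv.apply_mem hZ a)
    obtain ⟨σ, hσ, L, hL, hlip⟩ :=
      (hv.isNCFunction a).exists_lipschitz (hv.isLocallyBounded a) hU ho hZ
    -- The ball for `f` is centred at `(Z, v_a(Z))`. The Lipschitz constant `L` of `v_a` forces `(X,
    -- v_a(X))` into it once `X` is within `ρ / (L + 1)`.
    refine ⟨min ρ (min σ (ρ / (L + 1))), lt_min hρ (lt_min hσ (by positivity)), C,
      fun k X hX hXZ => ?_⟩
    refine (le_max_right _ _).trans (hC k _ (hv.apply_mem hX a) (pair_mem_ncBall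
      (ncBall_mono (min_le_left _ _) k hXZ) ⟨hXZ.1, ?_⟩))
    have h1 := (hlip k X (ncBall_mono ((min_le_right _ _).trans (min_le_left _ _)) k hXZ)).2
    have h2 := (ncBall_mono ((min_le_right _ _).trans (min_le_right _ _)) k hXZ).2
    rw [lt_div_iff₀ (by positivity)] at h2
    have h3 := mnorm_nonneg (X - amp k Z)
    refine h1.trans_lt ?_
    rcases h3.eq_or_lt with h4 | h4
    · rw [← h4, mul_zero]
      exact hρ
    · linarith
  · intro n Z hZ A hA
    have h0 : act (0 : Mat n (Fin r → ℂ)) (fun a => v a n Z) = 0 := act_zero _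
    have h := (hbij n).injOn (hmem hZ A) (hmem hZ 0) (by
      rw [hact hZ, hact hZ, hA, act_zero])
    exact hv.injective n Z hZ A ((congrArg fib h).trans h0)
  · intro n Z hZ B
    constructor
    · intro hB
      obtain ⟨P, hP, hPB⟩ := (hbij n).surjOn hB
      have hbP : base P = Z := by rw [← hbase n P hP, hPB, base_pair]
      rw [← pair_base_fib P, hbP] at hP hPB
      obtain ⟨A, hA⟩ := (hv.mem_iff n Z hZ _).mp hP
      rw [← hA, hact hZ] at hPB
      exact ⟨A, congrArg fib hPB⟩
    · rintro ⟨A, rfl⟩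
      rw [← hact hZ]
      exact (hbij n).mapsTo (hmem hZ A)

/-- Two families of tuples of functions over a cover change in the same way between the sets of
the cover. -/
def HaveSameTransitions {ι : Type} (U : ι → NCSubset (Fin d → ℂ))
    (v w : ι → Fin r → GradedMap (Fin d → ℂ) V) : Prop :=
  ∀ α β n, ∀ Z : Mat n (Fin d → ℂ), Z ∈ U α n → Z ∈ U β n →
    ∃ h : Mat n (Matrix (Fin r) (Fin r) ℂ), ∀ A : Mat n (Fin r → ℂ),
      (act A fun a => v β a n Z) = (act (rowMul A h) fun a => v α a n Z) ∧
      (act A fun a => w β a n Z) = act (rowMul A h) fun a => w α a n Z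

variable {ι : Type} {U : ι → NCSubset (Fin d → ℂ)} {v w : ι → Fin r → GradedMap (Fin d → ℂ) V}

/-- The maps that send the frames `v` to the frames `w` fit together. -/
theorem exists_glued_map (hv : ∀ α, IsFrame E (U α) (v α)) (hvw : HaveSameTransitions U v w) :
    ∃ f : GradedMap ((Fin d → ℂ) × V) ((Fin d → ℂ) × V),
      ∀ α n, ∀ Z ∈ U α n, ∀ A : Mat n (Fin r → ℂ),
        f n (pair Z (act A fun a => v α a n Z)) = pair Z (act A fun a => w α a n Z) := by
  classical
  let R : ∀ n : ℕ+, Mat n ((Fin d → ℂ) × V) → Mat n ((Fin d → ℂ) × V) → Prop := fun n P P' =>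
    ∃ α, ∃ A : Mat n (Fin r → ℂ), base P ∈ U α n ∧ fib P = (act A fun a => v α a n (base P)) ∧
      P' = pair (base P) (act A fun a => w α a n (base P))
  -- Every point of `E` over a set `U α` is represented by a row, so the value `0` is taken only
  -- where nothing is claimed.
  refine ⟨fun n P => if h : ∃ P', R n P P' then h.choose else 0, fun α n Z hZ A => ?_⟩
  have h : ∃ P', R n (pair Z (act A fun a => v α a n Z)) P' := ⟨_, α, A, hZ, rfl, rfl⟩
  dsimp only
  rw [dif_pos h]
  obtain ⟨β, B, hZβ, hB, hP⟩ := h.choose_spec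
  rw [hP]
  simp only [base_pair, fib_pair] at hZβ hB ⊢
  -- The representation chosen for the point may use another set `U β`. The common transition matrix
  -- carries it back to `U α` for both families at once, and there the row is unique.
  obtain ⟨g, hg⟩ := hvw α β n Z hZ hZβ
  rw [(hg B).1] at hB
  rw [(hg B).2, (hv α).act_injective hZ hB]

/-- Locally `f` takes coordinates with respect to `v`, which is controlled by the lower bound, and
then combines the bounded frame `w`. -/
theorem isLocallyBounded_of_frames (hU : IsNCCover Ω U) (hsub : ∀ n, E n ⊆ trivialBundle V Ω n)
    (hv : ∀ α, IsFrame E (U α) (v α)) (hw : ∀ α, IsFrame F (U α) (w α))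
    {f : GradedMap ((Fin d → ℂ) × V) ((Fin d → ℂ) × V)}
    (hf : ∀ α n, ∀ Z ∈ U α n, ∀ A : Mat n (Fin r → ℂ),
      f n (pair Z (act A fun a => v α a n Z)) = pair Z (act A fun a => w α a n Z)) :
    IsLocallyBounded E f := by
  intro n P hP
  obtain ⟨α, hα⟩ := hU.covers n _ (hsub n hP)
  obtain ⟨ρ, hρ, C, hC, hlow⟩ := (hv α).exists_lower_bound (hU.isNCSet α) (hU.isUniformlyOpen α) hα
  obtain ⟨σ, hσ, C', hC', hb⟩ := exists_common_bound (hw α).isLocallyBounded hα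
  refine ⟨min ρ σ, lt_min hρ hσ, max (ρ + mnorm (base P)) (C * (ρ + mnorm (fib P)) * C'),
    fun k Q hQ hQP => ?_⟩
  have hQρ := ncBall_mono (min_le_left _ _) k hQP
  obtain ⟨hQU, hl⟩ := hlow k _ (base_mem_ncBall hQρ)
  obtain ⟨A, hA⟩ := ((hv α).mem_iff k (base Q) hQU (fib Q)).mp hQ
  have hfQ := hf α k (base Q) hQU A
  rw [hA, pair_base_fib] at hfQ
  rw [hfQ, mnorm_prod, base_pair, fib_pair]
  refine max_le_max (mnorm_le_of_mem_ncBall (base_mem_ncBall hQρ)) ((mnorm_act_le _ _).trans ?_)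
  have h1 := hl A
  rw [hA] at h1
  refine mul_le_mul (h1.trans (mul_le_mul_of_nonneg_left
    (mnorm_le_of_mem_ncBall (fib_mem_ncBall hQρ)) hC))
    (hb k _ hQU (base_mem_ncBall (ncBall_mono (min_le_right _ _) k hQP)))
    (Finset.sum_nonneg fun _ _ => mnorm_nonneg _) ?_
  have := mnorm_nonneg (fib P)
  positivity

/-- Gluing gives a map in each direction, inverse to each other on frames. Invariance of the cover
is what makes the map nc: the points compared by each nc identity lie over a single set, where one
pair of nc frames computes all the values. -/
theorem areIsomorphic_of_frames (hU : IsNCCover Ω U)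
    (hinv : ∀ α, IsSimilarityInvariant (U α) ∧ IsSummandInvariant (U α)) (hΩ : IsNCSet Ω)
    (hE : ∀ n, E n ⊆ trivialBundle V Ω n) (hF : ∀ n, F n ⊆ trivialBundle V Ω n)
    (hv : ∀ α, IsFrame E (U α) (v α)) (hw : ∀ α, IsFrame F (U α) (w α))
    (hvw : HaveSameTransitions U v w) : AreIsomorphic E F := by
  have hwv : HaveSameTransitions U w v := fun α β n Z hα hβ =>
    (hvw α β n Z hα hβ).imp fun h H A => (H A).symm
  obtain ⟨f, hf⟩ := exists_glued_map hv hvw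
  obtain ⟨f', hf'⟩ := exists_glued_map hw hwv
  have hrep : ∀ {n : ℕ+} {P : Mat n ((Fin d → ℂ) × V)}, P ∈ E n → ∀ {α}, base P ∈ U α n →
      ∃ A : Mat n (Fin r → ℂ), P = pair (base P) (act A fun a => v α a n (base P)) := by
    intro n P hP α hα
    obtain ⟨A, hA⟩ := ((hv α).mem_iff n (base P) hα (fib P)).mp hP
    exact ⟨A, by rw [hA, pair_base_fib]⟩
  have hrep' : ∀ {n : ℕ+} {P : Mat n ((Fin d → ℂ) × V)}, P ∈ F n → ∀ {α}, base P ∈ U α n →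
      ∃ A : Mat n (Fin r → ℂ), P = pair (base P) (act A fun a => w α a n (base P)) := by
    intro n P hP α hα
    obtain ⟨A, hA⟩ := ((hw α).mem_iff n (base P) hα (fib P)).mp hP
    exact ⟨A, by rw [hA, pair_base_fib]⟩
  have hmaps : ∀ n, Set.MapsTo (f n) (E n) (F n) := by
    intro n P hP
    obtain ⟨α, hα⟩ := hU.covers n _ (hE n hP)
    obtain ⟨A, hA⟩ := hrep hP hα
    rw [hA, hf α n _ hα]
    exact ((hw α).mem_iff n _ hα _).mpr ⟨A, rfl⟩
  have hmaps' : ∀ n, Set.MapsTo (f' n) (F n) (E n) := by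
    intro n P hP
    obtain ⟨α, hα⟩ := hU.covers n _ (hF n hP)
    obtain ⟨A, hA⟩ := hrep' hP hα
    rw [hA, hf' α n _ hα]
    exact ((hv α).mem_iff n _ hα _).mpr ⟨A, rfl⟩
  have hinvOn : ∀ n, Set.InvOn (f' n) (f n) (E n) (F n) := by
    intro n
    refine ⟨fun P hP => ?_, fun P hP => ?_⟩
    · obtain ⟨α, hα⟩ := hU.covers n _ (hE n hP)
      obtain ⟨A, hA⟩ := hrep hP hα
      rw [hA, hf α n _ hα, hf' α n _ hα]
    · obtain ⟨α, hα⟩ := hU.covers n _ (hF n hP)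
      obtain ⟨A, hA⟩ := hrep' hP hα
      rw [hA, hf' α n _ hα, hf α n _ hα]
  refine ⟨f, f', ⟨?_, ?_⟩, isLocallyBounded_of_frames hU hE hv hw hf,
    isLocallyBounded_of_frames hU hF hw hv hf', fun n => (hinvOn n).bijOn (hmaps n) (hmaps' n),
    hinvOn, ?_, ?_, ?_, ?_⟩
  · intro n m P Q hP hQ
    -- The set is chosen to contain the direct sum of the base points; summand invariance then puts
    -- both base points in it.
    obtain ⟨α, hα⟩ := hU.covers _ _ (hΩ _ _ _ _ (hE n hP) (hE m hQ))
    obtain ⟨hαP, hαQ⟩ := (hinv α).2 n m _ _ hα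
    obtain ⟨A, hA⟩ := hrep hP hαP
    obtain ⟨B, hB⟩ := hrep hQ hαQ
    generalize base P = X at *
    generalize base Q = Y at *
    subst hA hB
    have h1 := hf α (n + m) _ hα (directSum A B)
    simp only [fun a => ((hv α).isNCFunction a).map_directSum n m _ _ hαP hαQ,
      fun a => ((hw α).isNCFunction a).map_directSum n m _ _ hαP hαQ, act_directSum] at h1
    rw [hf α n _ hαP, hf α m _ hαQ, directSum_pair, directSum_pair, h1]
  · intro n S P hP _
    obtain ⟨α, hα⟩ := hU.covers _ _ (hE n hP)
    have hαS := (hinv α).1 n S _ hα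
    obtain ⟨A, hA⟩ := hrep hP hα
    generalize base P = X at *
    subst hA
    have h1 := hf α n _ hαS (conj S A)
    simp only [fun a => ((hv α).isNCFunction a).map_conj n S _ hα hαS,
      fun a => ((hw α).isNCFunction a).map_conj n S _ hα hαS, act_conj] at h1
    rw [hf α n _ hα, conj_pair, conj_pair, h1]
  · intro n P hP
    obtain ⟨α, hα⟩ := hU.covers _ _ (hE n hP)
    obtain ⟨A, hA⟩ := hrep hP hα
    have h1 := hf α n _ hα A
    rw [← hA] at h1
    rw [h1, base_pair]
  · intro n Z A B hA hB
    obtain ⟨α, hα⟩ := hU.covers n Z (hE n hA)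
    obtain ⟨A', rfl⟩ := ((hv α).mem_iff n Z hα A).mp hA
    obtain ⟨B', rfl⟩ := ((hv α).mem_iff n Z hα B).mp hB
    rw [← act_add, hf α n Z hα, hf α n Z hα, hf α n Z hα, fib_pair, fib_pair, fib_pair, act_add]
  · intro n Z c A hA
    obtain ⟨α, hα⟩ := hU.covers n Z (hE n hA)
    obtain ⟨A', rfl⟩ := ((hv α).mem_iff n Z hα A).mp hA
    rw [← act_smul, hf α n Z hα, hf α n Z hα, fib_pair, fib_pair, act_smul]
  · intro n Z S A hA
    obtain ⟨α, hα⟩ := hU.covers n Z (hE n hA)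
    obtain ⟨A', rfl⟩ := ((hv α).mem_iff n Z hα A).mp hA
    rw [← act_lmul, hf α n Z hα, hf α n Z hα, fib_pair, fib_pair, act_lmul]

end Isomorphism

end NCBundle

/-! ### Isomorphism and cohomologous cocycles -/

theorem theorem5p12 {d : ℕ} {V : Type u} [AddCommGroup V] [Module ℂ V] [NCBundle.OperatorSpace V]
    (Ω : NCBundle.NCSubset (Fin d → ℂ)) (hΩ : NCBundle.IsNCSet Ω)
    (hΩ_open : NCBundle.IsUniformlyOpen Ω) (hΩ_sim : NCBundle.IsSimilarityInvariant Ω)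
    (hΩ_sum : NCBundle.IsSummandInvariant Ω)
    (p q : ℕ) (E F : NCBundle.NCSubset ((Fin d → ℂ) × V))
    (hE : NCBundle.IsNCVectorBundle Ω p E) (hF : NCBundle.IsNCVectorBundle Ω q F) :
    NCBundle.AreIsomorphic E F ↔
      ∃ (r : ℕ) (ι : Type) (U : ι → NCBundle.NCSubset (Fin d → ℂ))
        (φ ψ : ι → NCBundle.GradedMap ((Fin d → ℂ) × (Fin r → ℂ)) ((Fin d → ℂ) × V))
        (g h : ι → ι → NCBundle.GradedMap (Fin d → ℂ) (Matrix (Fin r) (Fin r) ℂ)),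
        NCBundle.IsNCCover Ω U ∧
        (∀ α, NCBundle.IsSimilarityInvariant (U α) ∧ NCBundle.IsSummandInvariant (U α)) ∧
        (∀ α, NCBundle.IsTrivialization E r (U α) (φ α)) ∧
        (∀ α, NCBundle.IsTrivialization F r (U α) (ψ α)) ∧
        NCBundle.IsTransitionCocycle U φ g ∧
        NCBundle.IsTransitionCocycle U ψ h ∧
        NCBundle.AreCohomologous U g h := by
  constructor
  · rintro ⟨f, f', hf, hb, -, hbij, -, hbase, hlin⟩
    obtain ⟨ι, U₀, v₀, hU₀, hv₀⟩ := hE.exists_frames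
    -- The given cover need not be invariant under similarities and direct summands; envelopes are.
    let U := fun α => NCBundle.envelope (U₀ α)
    let v := fun α a => NCBundle.extension (U₀ α) (v₀ α a)
    have hU : NCBundle.IsNCCover Ω U :=
      { isNCSet := fun α => NCBundle.isNCSet_envelope (hU₀.isNCSet α)
        isUniformlyOpen := fun α => NCBundle.isUniformlyOpen_envelope (hU₀.isUniformlyOpen α)
        subset := fun α => NCBundle.envelope_subset hΩ_sim hΩ_sum (hU₀.subset α)
        covers := fun n Z hZ =>
          (hU₀.covers n Z hZ).imp fun α hα => NCBundle.subset_envelope n hα }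
    have hv : ∀ α, NCBundle.IsFrame E (U α) (v α) := fun α =>
      (hv₀ α).extension hE hΩ hΩ_sim hΩ_sum (hU₀.isNCSet α) (hU₀.isUniformlyOpen α) (hU₀.subset α)
    have hw := fun α =>
      (hv α).map (hU.isNCSet α) (hU.isUniformlyOpen α) hf hb hbij hbase hlin
    have hφ := fun α => (hv α).isTrivialization (hU.isNCSet α) (hU.isUniformlyOpen α)
    have hψ := fun α => (hw α).isTrivialization (hU.isNCSet α) (hU.isUniformlyOpen α)
    have hg := NCBundle.isTransitionCocycle_transition hU hv
    -- The common rank is that of `E`: the frames transported by `f` give `F` trivializations of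
    -- this rank as well. The same `g` serves as the cocycle of `F`, so the cohomology is through
    -- the identity.
    refine ⟨p, ι, U, _, _, _, _, hU, fun α => ⟨NCBundle.isSimilarityInvariant_envelope,
      NCBundle.isSummandInvariant_envelope⟩, hφ, hψ, hg, ⟨hg.isNCCocycle, ?_⟩,
      fun α n Z => 1, fun α => NCBundle.isAnalyticGL_one (U α) (hU.isNCSet α)
        (hU.isUniformlyOpen α), fun α β n Z _ _ => by rw [one_mul, mul_one]⟩
    -- Applying `f` to the transition relation of the frames of `E` yields that of their images, as
    -- `f` commutes with row combinations.
    intro α β n Z hα hβ A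
    have hmem : ∀ γ, Z ∈ U γ n → ∀ B : NCBundle.Mat n (Fin p → ℂ),
        NCBundle.pair Z (NCBundle.act B fun a => v γ a n Z) ∈ E n := fun γ hγ B =>
      ((hv γ).mem_iff n Z hγ _).mpr ⟨B, rfl⟩
    refine congrArg (NCBundle.pair Z) ?_
    change NCBundle.act A (fun a => NCBundle.fib (f n (NCBundle.pair Z (v β a n Z)))) =
      NCBundle.act _ fun a => NCBundle.fib (f n (NCBundle.pair Z (v α a n Z)))
    rw [← hlin.fib_act (hmem β hβ), ← hlin.fib_act (hmem α hα), NCBundle.fib_pair,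
      (hv α).act_rowMul_transition (hv β) ⟨hα, hβ⟩]
  · rintro ⟨r, ι, U, φ, ψ, g, h, hU, hinv, hφ, hψ, hg, hh, lam, hlam, heq⟩
    -- The frames of `E` are twisted by `λ`, after which their transition matrices are those of `ψ`.
    have hv := fun α => (hφ α).isFrame.mul (hlam α)
    refine NCBundle.areIsomorphic_of_frames hU hinv hΩ hE.subset hF.subset hv
      (fun α => (hψ α).isFrame) fun α β n Z hα hβ => ⟨h α β n Z, fun A => ⟨?_, ?_⟩⟩
    -- The row `A λ_β` in the frame of `φ_β` becomes `A λ_β g_{αβ} = A h_{αβ} λ_α` in that of `φ_α`,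
    -- which is the row `A h_{αβ}` in the twisted frame.
    · have h1 := hg.transition α β n Z hα hβ (NCBundle.rowMul A (lam β n Z))
      rw [(hφ β).eq_frameMap hβ, (hφ α).eq_frameMap hα] at h1
      have h2 := congrArg NCBundle.fib h1
      rw [NCBundle.fib_pair, NCBundle.fib_pair, ← NCBundle.rowMul_mul, heq α β n Z hα hβ,
        NCBundle.rowMul_mul, NCBundle.act_rowMul, NCBundle.act_rowMul _ (lam α n Z)] at h2
      exact h2
    · have h1 := hh.transition α β n Z hα hβ A
      rw [(hψ β).eq_frameMap hβ, (hψ α).eq_frameMap hα] at h1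
      exact congrArg NCBundle.fib h1
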